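/- Let $n\ge 2$. Consider either of the following two situations; in both, $S$ is a finite-dimensional complex space with a distinguished orthonormal basis $\{|a\rangle\}$, $d_S=\dim S$, $X_1,\dots,X_n$ are operators on $S$, and $\mathcal T$ is a set of transpositions in $S_n$, each acting on $S$ by an operator again denoted $\tau$. * $\mathrm U(1)$ case: $S$ is a charge sector of $n$ qubits, spanned by the computational basis strings with exactly $r$ zeros ($0\le r\le n$); $X_i=Z_i$ are the Pauli-$Z$ operators; $\mathcal T$ is any set of transpositions generating $S_n$, acting by permuting the qubits. * $\mathrm{SU}(d)$ case: $S=S^\lambda$ is the irreducible representation of $S_n$ of a Young diagram $\lambda$ with $n$ boxes (any $\lambda$, hence any $\lambda$ with at most $d$ rows, whatever $d$ is), in Young's orthogonal form, with the Young basis indexed by the standard tableaux of shape $\lambda$; $X_i=\sum_{k<i}(k,i)$ are the Young–Jucys–Murphy elements; $\mathcal T=\{(j,j+1):1\le j<n\}$. Identify $S^{\otimes 4}\cong\operatorname{End}(S^{\otimes 2})$ by $|a,c\rangle\langle b,d|=E^a_b\otimes E^c_d$ (kets are tensor factors $1,2$; bras are factors $3,4$; tensor signs are omitted below). Put $X_0=I$,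 $U_\beta=\exp\big(-i\sum_{0\le r\le s\le n}\beta_{rs}X_rX_s\big)$ and $$T_2=\mathbb E_\beta\big[U_\beta\otimes U_\beta\otimes\overline{U_\beta}\otimes\overline{U_\beta}\big],$$ with the $\beta_{rs}$ independent and uniform on $[0,2\pi]$. Define on $S^{\otimes 4}$ the modified moment operator and the Cayley moment operator $$M=\frac1{|\mathcal T|}\sum_{\tau\in\mathcal T}T_2\,\tfrac18\big(6\,IIII+I\tau I\tau+\tau I\tau I+\tau II\tau+I\tau\tau I-II\tau\tau-\tau\tau II\big)\,T_2,$$ $$\mathrm{Cay}=\frac1{|\mathcal T|}\sum_{\tau\in\mathcal T}T_2\,\tfrac18\big(6\,IIII+\tau I\tau I+I\tau I\tau\big)\,T_2 .$$ For unordered pairs $\{a,b\}$ of basis labels let $v_{aa}=E^a_aE^a_a$ and, for $a\ne b$, $v_{ab}=\frac12\big(E^a_aE^b_b+E^b_bE^a_a+E^a_bE^b_a+E^b_aE^a_b\big)$. Let $S_{++}=\operatorname{span}\{v_{ab}\}$ and $\mathrm{Sym}=\operatorname{span}\{\tfrac12(E^a_aE^b_b+E^b_bE^a_a)\}$ (where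 $a=b$ is allowed). For an operator $L$ with real spectrum on a space of dimension at least $2$ let $\Delta(L)=1-\lambda_2(L)$, where $\lambda_2$ is the second largest eigenvalue counted with multiplicity. Then: 1. The vectors $v_{ab}$ are linearly independent, $M$ maps $S_{++}$ to itself, and the matrix of $M_{++}=M|_{S_{++}}$ in the basis $(v_{ab})$ is real, nonnegative, irreducible, symmetric and doubly stochastic. 2. $\mathrm{Cay}$ maps $\mathrm{Sym}$ to itself, and, with $\mathrm{Cay}_{\mathrm{Sym}}=\mathrm{Cay}|_{\mathrm{Sym}}$, if $d_S\ge 2$ then $$\tfrac14\,\Delta(M_{++})\le\Delta(\mathrm{Cay}_{\mathrm{Sym}})\le 2\,\Delta(M_{++}).$$ 3. If $d_S\ge 2$, then for $\mathrm{Cay}$ on the whole of $S^{\otimes 4}$ also $$\tfrac14\,\Delta(M_{++})\le\Delta(\mathrm{Cay})\le 2\,\Delta(M_{++}).$$ In particular $\Delta(M_{++})=\Theta(\Delta(\mathrm{Cay}))$ with absolute constants. -/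

import Mathlib

open Matrix Equiv
open scoped Kronecker MeasureTheory

noncomputable section

/-! ### Operators on the fourfold tensor power of a space with basis `ι`

The fourfold tensor power of `ℂ^ι` has the basis indexed by `ι × ι × ι × ι`. It is identified with
`End (ℂ^ι ⊗ ℂ^ι)`: the first two factors are the kets and the last two are the bras, so that
`E^a_b ⊗ E^c_d = |a, c⟩⟨b, d|` is the basis vector with index `(a, c, b, d)`. -/

section General

variable {ι : Type*} [Fintype ι] [DecidableEq ι]

/-- Index set of the standard basis of the fourfold tensor power. -/
abbrev Idx4 (ι : Type*) : Type _ := ι × ι × ι × ι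

/-- The tensor product `A ⊗ B ⊗ C ⊗ D` of four operators. -/
def tensor4 (A B C D : Matrix ι ι ℂ) : Matrix (Idx4 ι) (Idx4 ι) ℂ :=
  A ⊗ₖ (B ⊗ₖ (C ⊗ₖ D))

/-- `Y 0 = I`, `Y 1 = X 0`, …, `Y n = X (n - 1)`: the products `Y r * Y s` with `r ≤ s` are the
products of order at most two of the given operators. -/
def withOne {n : ℕ} (X : Fin n → Matrix ι ι ℂ) : Fin (n + 1) → Matrix ι ι ℂ :=
  Fin.cons 1 X

/-- Index set of the products of order at most two. -/
abbrev PairIdx (n : ℕ) : Type := {p : Fin (n + 1) × Fin (n + 1) // p.1 ≤ p.2}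

/-- The unitary `exp (-i ∑_{r ≤ s} β_{rs} Y_r Y_s)`. -/
def evolution {n : ℕ} (X : Fin n → Matrix ι ι ℂ) (β : PairIdx n → ℝ) : Matrix ι ι ℂ :=
  NormedSpace.exp
    ((-Complex.I) • ∑ p : PairIdx n, (β p : ℂ) • (withOne X p.1.1 * withOne X p.1.2))

/-- The second moment operator `𝔼_β [U_β ⊗ U_β ⊗ conj U_β ⊗ conj U_β]` of `U_β = evolution X β`,
where the parameters `β_{rs}` are independent and uniform on `[0, 2π]`. -/
def secondMoment {n : ℕ} (X : Fin n → Matrix ι ι ℂ) : Matrix (Idx4 ι) (Idx4 ι) ℂ :=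
  Matrix.of fun x y =>
    ⨍ β in Set.univ.pi (fun _ : PairIdx n => Set.Icc (0 : ℝ) (2 * Real.pi)),
      tensor4 (evolution X β) (evolution X β)
        ((evolution X β).map star) ((evolution X β).map star) x y

/-- The modified moment operator
`(1/8) (6 IIII + IτIτ + τIτI + τIIτ + IττI - IIττ - ττII)` of one SWAP. -/
def modifiedSwap (τ : Matrix ι ι ℂ) : Matrix (Idx4 ι) (Idx4 ι) ℂ :=
  (1 / 8 : ℂ) • ((6 : ℂ) • tensor4 1 1 1 1 + tensor4 1 τ 1 τ + tensor4 τ 1 τ 1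
    + tensor4 τ 1 1 τ + tensor4 1 τ τ 1 - tensor4 1 1 τ τ - tensor4 τ τ 1 1)

/-- The operator `(1/8) (6 IIII + τIτI + IτIτ)` of one SWAP. -/
def cayleySwap (τ : Matrix ι ι ℂ) : Matrix (Idx4 ι) (Idx4 ι) ℂ :=
  (1 / 8 : ℂ) • ((6 : ℂ) • tensor4 1 1 1 1 + tensor4 τ 1 τ 1 + tensor4 1 τ 1 τ)

/-- The modified second moment operator `|𝒯|⁻¹ ∑_τ T₂ M₂^τ T₂`, with `T₂ = secondMoment X`. -/
def modifiedMoment {n : ℕ} (X : Fin n → Matrix ι ι ℂ) {J : Type*} [Fintype J]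
    (τ : J → Matrix ι ι ℂ) : Matrix (Idx4 ι) (Idx4 ι) ℂ :=
  (1 / (Fintype.card J : ℂ)) • ∑ j, secondMoment X * modifiedSwap (τ j) * secondMoment X

/-- The Cayley moment operator `|𝒯|⁻¹ ∑_τ T₂ (1/8) (6 IIII + τIτI + IτIτ) T₂`. -/
def cayleyMoment {n : ℕ} (X : Fin n → Matrix ι ι ℂ) {J : Type*} [Fintype J]
    (τ : J → Matrix ι ι ℂ) : Matrix (Idx4 ι) (Idx4 ι) ℂ :=
  (1 / (Fintype.card J : ℂ)) • ∑ j, secondMoment X * cayleySwap (τ j) * secondMoment X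

/-- The basis vector `E^a_b ⊗ E^c_d`. -/
def unitTensor (a b c d : ι) : Idx4 ι → ℂ := Pi.single (a, c, b, d) 1

/-- The basis states of `S_{++}`, indexed by unordered pairs: `E^a_a E^a_a` for `a = b`, and
`(1/2) (E^a_a E^b_b + E^b_b E^a_a + E^a_b E^b_a + E^b_a E^a_b)` for `a ≠ b`. -/
def plusState : Sym2 ι → (Idx4 ι → ℂ) :=
  Sym2.lift ⟨fun a b => if a = b then unitTensor a a a a else
      (1 / 2 : ℂ) • ((unitTensor a a b b + unitTensor b b a a)
        + (unitTensor a b b a + unitTensor b a a b)), by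
    intro a b
    by_cases h : a = b
    · subst h; rfl
    · have h' : ¬ b = a := fun e => h e.symm
      simp only [h, h', if_false]
      rw [add_comm (unitTensor a a b b), add_comm (unitTensor a b b a)]⟩

/-- The subspace `S_{++}`. -/
def plusSpace (ι : Type*) [DecidableEq ι] : Submodule ℂ (Idx4 ι → ℂ) :=
  Submodule.span ℂ (Set.range (plusState (ι := ι)))

/-- The vectors `E^a_a E^a_a` and `(1/2) (E^a_a E^b_b + E^b_b E^a_a)` for `a ≠ b`, indexed by
unordered pairs (the formula for `a ≠ b` gives `E^a_a E^a_a` when `a = b`). -/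
def symState : Sym2 ι → (Idx4 ι → ℂ) :=
  Sym2.lift ⟨fun a b => (1 / 2 : ℂ) • (unitTensor a a b b + unitTensor b b a a), by
    intro a b
    simp only [add_comm (unitTensor a a b b)]⟩

/-- The subspace `Sym`. -/
def symSpace (ι : Type*) [DecidableEq ι] : Submodule ℂ (Idx4 ι → ℂ) :=
  Submodule.span ℂ (Set.range (symState (ι := ι)))

end General

/-- The second largest eigenvalue, counted with algebraic multiplicity, of an operator with real
spectrum: the second entry of the decreasing list of (the real parts of) the roots of the
characteristic polynomial. It is meaningful in dimension at least two. -/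
def secondEigenvalue {V : Type*} [AddCommGroup V] [Module ℂ V] [FiniteDimensional ℂ V]
    (L : Module.End ℂ V) : ℝ :=
  ((L.charpoly.roots.map Complex.re).sort (fun x y => y ≤ x)).getD 1 0

/-- The spectral gap `Δ = 1 - λ₂`. -/
def spectralGap {V : Type*} [AddCommGroup V] [Module ℂ V] [FiniteDimensional ℂ V]
    (L : Module.End ℂ V) : ℝ :=
  1 - secondEigenvalue L

/-! ### Charge sectors of `n` qubits under `U(1)` symmetry -/

/-- The computational basis of the charge sector of `n` qubits: the strings with `r` zeros. -/
abbrev ChargeBasis (n r : ℕ) : Type :=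
  {x : Fin n → Fin 2 // (Finset.univ.filter fun i => x i = 0).card = r}

/-- The Pauli operator `Z_i` on the charge sector: `+1` on `0` and `-1` on `1` at site `i`. -/
def pauliZ (n r : ℕ) (i : Fin n) : Matrix (ChargeBasis n r) (ChargeBasis n r) ℂ :=
  Matrix.diagonal fun x => if x.1 i = 0 then 1 else -1

/-- The permutation operator `|x₁, …, xₙ⟩ ↦ |x_{σ⁻¹(1)}, …, x_{σ⁻¹(n)}⟩` on the charge sector. -/
def qubitPerm (n r : ℕ) (σ : Perm (Fin n)) : Matrix (ChargeBasis n r) (ChargeBasis n r) ℂ :=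
  Matrix.of fun y x => if y.1 = x.1 ∘ σ.symm then 1 else 0

/-- The modified CQA second moment operator on the fourfold tensor power of a charge sector, for a
set `𝒯` of SWAPs. -/
def modifiedU1 (n r : ℕ) (𝒯 : Finset (Perm (Fin n))) :
    Matrix (Idx4 (ChargeBasis n r)) (Idx4 (ChargeBasis n r)) ℂ :=
  modifiedMoment (pauliZ n r) fun σ : 𝒯 => qubitPerm n r σ

/-- The Cayley moment operator on the fourfold tensor power of a charge sector. -/
def cayleyU1 (n r : ℕ) (𝒯 : Finset (Perm (Fin n))) :
    Matrix (Idx4 (ChargeBasis n r)) (Idx4 (ChargeBasis n r)) ℂ :=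
  cayleyMoment (pauliZ n r) fun σ : 𝒯 => qubitPerm n r σ

/-! ### The irreducible representation of `S_n` of a Young diagram, in Young's orthogonal form -/

/-- A filling of the boxes of `μ` with the labels `0, …, n - 1`, given by the box of each label, is
standard if the labels increase along each row and down each column. -/
def IsStandardFilling {n : ℕ} {μ : YoungDiagram} (T : Fin n ≃ μ.cells) : Prop :=
  ∀ i j : Fin n,
    ((T i).1.1 = (T j).1.1 ∧ (T i).1.2 < (T j).1.2) ∨
      ((T i).1.2 = (T j).1.2 ∧ (T i).1.1 < (T j).1.1) → i < j

/-- The standard Young tableaux of shape `μ` with `n` boxes; they label the Young basis. -/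
def YoungTableau (n : ℕ) (μ : YoungDiagram) : Type :=
  {T : Fin n ≃ μ.cells // IsStandardFilling T}

instance (n : ℕ) (μ : YoungDiagram) : Finite (YoungTableau n μ) :=
  inferInstanceAs (Finite {T : Fin n ≃ μ.cells // IsStandardFilling T})

instance (n : ℕ) (μ : YoungDiagram) : Fintype (YoungTableau n μ) := Fintype.ofFinite _

instance (n : ℕ) (μ : YoungDiagram) : DecidableEq (YoungTableau n μ) := Classical.decEq _

/-- The content (column minus row) of the box that holds the label `i`. -/
def YoungTableau.content {n : ℕ} {μ : YoungDiagram} (T : YoungTableau n μ) (i : Fin n) : ℤ :=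
  ((T.1 i).1.2 : ℤ) - ((T.1 i).1.1 : ℤ)

/-- The axial distance `content (j + 1) - content j`. -/
def YoungTableau.axial {n : ℕ} {μ : YoungDiagram} (T : YoungTableau n μ) (j : ℕ)
    (h : j + 1 < n) : ℤ :=
  T.content ⟨j + 1, h⟩ - T.content ⟨j, Nat.lt_of_succ_lt h⟩

/-- Young's orthogonal form of the adjacent transposition `s_j` of `j` and `j + 1`:
`s_j |T⟩ = (1/r) |T⟩ + √(1 - 1/r²) |s_j · T⟩`, where `r` is the axial distance and `s_j · T` is `T`
with the labels `j` and `j + 1` exchanged (for `r = ±1` this filling is not standard and its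
coefficient is zero). The value for `j + 1 ≥ n` is irrelevant. -/
def adjacentSwap (n : ℕ) (μ : YoungDiagram) (j : ℕ) :
    Matrix (YoungTableau n μ) (YoungTableau n μ) ℂ :=
  Matrix.of fun T' T =>
    if h : j + 1 < n then
      if T' = T then ((1 / (T.axial j h : ℝ) : ℝ) : ℂ)
      else if T'.1 = (Equiv.swap ⟨j, Nat.lt_of_succ_lt h⟩ ⟨j + 1, h⟩).trans T.1 then
        ((Real.sqrt (1 - 1 / (T.axial j h : ℝ) ^ 2) : ℝ) : ℂ)
      else 0
    else 0

/-- The transposition `(k, i)` for `k < i`, through `(k, k + 1) = s_k` and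
`(k, i + 1) = s_i (k, i) s_i`. -/
def transposition (n : ℕ) (μ : YoungDiagram) (k : ℕ) :
    ℕ → Matrix (YoungTableau n μ) (YoungTableau n μ) ℂ
  | 0 => 0
  | i + 1 => if k = i then adjacentSwap n μ i
      else adjacentSwap n μ i * transposition n μ k i * adjacentSwap n μ i

/-- The Young–Jucys–Murphy element `X_i = ∑_{k < i} (k, i)`, labels starting from `0`. -/
def yjm (n : ℕ) (μ : YoungDiagram) (i : Fin n) :
    Matrix (YoungTableau n μ) (YoungTableau n μ) ℂ :=
  ∑ k ∈ Finset.range i, transposition n μ k i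

/-- The nearest-neighbour SWAPs on the irreducible representation of shape `μ`. -/
def nearestSwap (n : ℕ) (μ : YoungDiagram) (j : Fin (n - 1)) :
    Matrix (YoungTableau n μ) (YoungTableau n μ) ℂ :=
  adjacentSwap n μ j

/-- The modified CQA second moment operator on the fourfold tensor power of the irreducible
representation of shape `μ`, for the nearest-neighbour SWAPs. -/
def modifiedSU (n : ℕ) (μ : YoungDiagram) :
    Matrix (Idx4 (YoungTableau n μ)) (Idx4 (YoungTableau n μ)) ℂ :=
  modifiedMoment (yjm n μ) (nearestSwap n μ)

/-- The Cayley moment operator on the fourfold tensor power of the irreducible representation of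
shape `μ`, for the nearest-neighbour SWAPs. -/
def cayleySU (n : ℕ) (μ : YoungDiagram) :
    Matrix (Idx4 (YoungTableau n μ)) (Idx4 (YoungTableau n μ)) ℂ :=
  cayleyMoment (yjm n μ) (nearestSwap n μ)

end

/-! Both moment operators are Markov chains on pairs of basis labels in disguise, and their gaps are
compared through Dirichlet forms.

The `X_i` are diagonal with integer joint eigenvalues that separate the basis: signs for qubits,
contents for tableaux. Averaging a phase over `[0, 2π]` keeps only the exponent zero, and if all
exponents of order at most two vanish at `(a, c, b, d)`, then `{a, c} = {b, d}` as multisets. Hence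
`T₂` is the projection `matchedProj` (`secondMoment_diagonal`).

Between two such projections a real symmetric orthogonal swap `t` acts through the probabilities `t
a b ^ 2`, apart from products `t a a * t c c`. Let `p = hopping t` be the average of these
probabilities. On `Sym`, `Cay` moves two particles independently by `p` (`pairChain p 0`); on
`S_{++}` the products cancel and `M` is the same chain with an exchange correction (`pairChain p
1`). The first chain is reversible for the weight 1 on diagonal and 2 on other pairs, the second for
the counting measure. With `E = pairEnergy p f`, their Dirichlet forms are `E/8` and `E/16 + R/8`
with `0 ≤ R ≤ E`. So the forms agree up to factors 1/2 and 3/2 and the norms up to a factor 2, which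
gives `Δ(M)/3 ≤ Δ(Cay_Sym) ≤ 2 Δ(M)` (`poincare_pair`, `le_spectralGap_of_poincare`).

On the whole space `Cay` splits into three blocks. At the indices `(a, c, a, c)` it describes two
distinguishable particles, whose Poincaré inequality follows from the symmetric one
(`poincare_ordered`). At `(a, c, c, a)` with `a ≠ c` it is diagonal, and the eigenvalue is
controlled by a diagonal entry of `M` (`spectralGap_le_diag`). At unmatched indices it is zero.

Irreducibility needs `p` to be connected: the transpositions generate `S_n` in the qubit case, and a
sorting argument joins any two standard tableaux. -/

noncomputable section

/-! ### The second eigenvalue of a reversible real matrix -/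

section Spectral

variable {κ : Type*} [Fintype κ] [DecidableEq κ]

/-- Only the characteristic polynomial enters, so this applies to a restricted operator, or to one
not symmetric in the given basis, once it shares its polynomial with a real symmetric matrix. -/
lemma secondEigenvalue_eq_eigenvalues₀ {V : Type*} [AddCommGroup V] [Module ℂ V]
    [FiniteDimensional ℂ V] (L : Module.End ℂ V) {B : Matrix κ κ ℝ} (hB : B.IsHermitian)
    (hL : L.charpoly = B.charpoly.map (algebraMap ℝ ℂ)) (h : 1 < Fintype.card κ) :
    secondEigenvalue L = hB.eigenvalues₀ ⟨1, h⟩ := by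
  have hs : B.charpoly.Splits := hB.splits_charpoly
  have h1 : L.charpoly.roots.map Complex.re = B.charpoly.roots.map RCLike.re := by
    rw [hL, hs.roots_map (algebraMap ℝ ℂ), Multiset.map_map]
    rfl
  have h2 := hB.sort_roots_charpoly_eq_eigenvalues₀
  unfold secondEigenvalue
  rw [h1]
  have h3 : ((B.charpoly.roots.map RCLike.re).sort (fun x y => y ≤ x))
      = List.ofFn hB.eigenvalues₀ := h2
  rw [h3]
  simp [List.getD, h]

/-- A real matrix that is symmetric with respect to a positive weight has an eigenbasis that is
orthonormal with respect to this weight. -/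
lemma exists_weighted_eigenbasis {V : Type*} [AddCommGroup V] [Module ℂ V]
    [FiniteDimensional ℂ V] (L : Module.End ℂ V) (Q : Matrix κ κ ℝ) (w : κ → ℝ)
    (hw : ∀ x, 0 < w x) (hQ : ∀ x y, w x * Q x y = w y * Q y x)
    (hL : L.charpoly = Q.charpoly.map (algebraMap ℝ ℂ)) (h : 1 < Fintype.card κ) :
    ∃ (φ : Fin (Fintype.card κ) → κ → ℝ) (l : Fin (Fintype.card κ) → ℝ),
      Antitone l ∧ secondEigenvalue L = l ⟨1, h⟩ ∧ (∀ i, Q *ᵥ φ i = l i • φ i) ∧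
      (∀ i j, ∑ x, w x * φ i x * φ j x = if i = j then 1 else 0) ∧
      ∀ f : κ → ℝ, f = ∑ i, (∑ x, w x * φ i x * f x) • φ i := by
  have hs : ∀ x, 0 < √(w x) := fun x => Real.sqrt_pos.2 (hw x)
  have hss : ∀ x, √(w x) * √(w x) = w x := fun x => Real.mul_self_sqrt (hw x).le
  -- Conjugation by `diag √w` turns reversibility into symmetry. The eigenvectors are pulled back by
  -- division by `√w`.
  set B : Matrix κ κ ℝ := Matrix.of fun x y => √(w x) * Q x y / √(w y) with hBdef
  have hB : B.IsHermitian := by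
    ext x y
    simp only [hBdef, conjTranspose_apply, of_apply, star_trivial]
    rw [div_eq_div_iff (hs x).ne' (hs y).ne']
    have := hQ x y
    rw [← hss x, ← hss y] at this
    linarith
  let D : (Matrix κ κ ℝ)ˣ :=
    ⟨diagonal fun x => √(w x), diagonal fun x => (√(w x))⁻¹,
      by rw [diagonal_mul_diagonal, ← diagonal_one]; congr 1; ext x; exact mul_inv_cancel₀ (hs x).ne',
      by rw [diagonal_mul_diagonal, ← diagonal_one]; congr 1; ext x; exact inv_mul_cancel₀ (hs x).ne'⟩
  have hBQ : B = D.val * Q * D.inv := by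
    ext x y
    simp [D, hBdef, div_eq_mul_inv]
  have hchar : B.charpoly = Q.charpoly := by
    have : D.val * Q * D.inv = D.val * Q * (D.val)⁻¹ := by
      rw [← coe_units_inv]; rfl
    rw [hBQ, this]; exact charpoly_units_conj D Q
  have hBsym := isSymmetric_toEuclideanLin_iff.mpr hB
  let e := hBsym.eigenvectorBasis finrank_euclideanSpace
  refine ⟨fun i x => e i x / √(w x), hB.eigenvalues₀, hB.eigenvalues₀_antitone,
    secondEigenvalue_eq_eigenvalues₀ L hB (by rw [hL, hchar]) h, ?_, ?_, ?_⟩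
  · intro i
    have h1 := hBsym.apply_eigenvectorBasis finrank_euclideanSpace i
    ext x
    have h2 : (B *ᵥ (e i).ofLp) x = hB.eigenvalues₀ i * e i x := by
      have := congrArg (fun v : EuclideanSpace ℝ κ => v x) h1
      simpa only [toLpLin_apply, PiLp.smul_apply, smul_eq_mul] using! this
    have h3 : (B *ᵥ (e i).ofLp) x = √(w x) * ∑ y, Q x y * (e i y / √(w y)) := by
      simp only [mulVec, dotProduct, hBdef, of_apply, Finset.mul_sum]
      exact Finset.sum_congr rfl fun y _ => by ring
    simp only [mulVec, dotProduct, Pi.smul_apply, smul_eq_mul]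
    rw [h3] at h2
    rw [eq_comm, ← mul_div_assoc, div_eq_iff (hs x).ne', ← h2]
    ring
  · intro i j
    have h1 := orthonormal_iff_ite.1 e.orthonormal i j
    rw [← h1, PiLp.inner_apply]
    refine Finset.sum_congr rfl fun x _ => ?_
    have := (hs x).ne'
    simp only [RCLike.inner_apply, conj_trivial]
    field_simp
    rw [Real.sq_sqrt (hw x).le]; ring
  · intro f
    let g : EuclideanSpace ℝ κ := WithLp.toLp 2 fun x => √(w x) * f x
    have h1 := e.sum_repr' g
    ext x
    have h2 := congrArg (fun v : EuclideanSpace ℝ κ => v x) h1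
    simp only [WithLp.ofLp_sum, Finset.sum_apply, PiLp.smul_apply, smul_eq_mul] at h2
    have hgx : g x = √(w x) * f x := rfl
    rw [hgx] at h2
    have h4 : ∀ i, inner ℝ (e i) g = ∑ x, w x * (e i x / √(w x)) * f x := by
      intro i
      rw [PiLp.inner_apply]
      refine Finset.sum_congr rfl fun y _ => ?_
      have := (hs y).ne'
      simp only [RCLike.inner_apply, conj_trivial, g]
      field_simp
      rw [Real.sq_sqrt (hw y).le]; ring
    simp only [Finset.sum_apply, Pi.smul_apply, smul_eq_mul]
    rw [← mul_right_inj' (hs x).ne', ← h2, Finset.mul_sum]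
    refine Finset.sum_congr rfl fun i _ => ?_
    rw [h4]
    have := (hs x).ne'
    field_simp

/-- A Poincaré inequality on the orthogonal complement of one vector bounds the spectral gap from
below. -/
lemma le_spectralGap {V : Type*} [AddCommGroup V] [Module ℂ V]
    [FiniteDimensional ℂ V] (L : Module.End ℂ V) (Q : Matrix κ κ ℝ) (w : κ → ℝ)
    (hw : ∀ x, 0 < w x) (hQ : ∀ x y, w x * Q x y = w y * Q y x)
    (hL : L.charpoly = Q.charpoly.map (algebraMap ℝ ℂ)) (h : 1 < Fintype.card κ)
    (v : κ → ℝ) (g : ℝ)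
    (hg : ∀ f : κ → ℝ, ∑ x, w x * f x * v x = 0 →
      g * ∑ x, w x * f x * f x ≤ ∑ x, w x * f x * (f x - (Q *ᵥ f) x)) :
    g ≤ spectralGap L := by
  obtain ⟨φ, l, hl, hsec, heig, horth, -⟩ := exists_weighted_eigenbasis L Q w hw hQ hL h
  set i₀ : Fin (Fintype.card κ) := ⟨0, by omega⟩
  set i₁ : Fin (Fintype.card κ) := ⟨1, h⟩
  have h01 : i₀ ≠ i₁ := by simp [i₀, i₁]
  -- Courant–Fischer: the plane of the two leading eigenvectors contains a unit vector orthogonal to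
  -- `v`. No eigenvector property of `v` is needed here.
  obtain ⟨α, β, hαβ, hv⟩ : ∃ α β : ℝ, α ^ 2 + β ^ 2 = 1 ∧
      α * (∑ x, w x * φ i₀ x * v x) + β * (∑ x, w x * φ i₁ x * v x) = 0 := by
    set a := ∑ x, w x * φ i₀ x * v x
    set b := ∑ x, w x * φ i₁ x * v x
    by_cases hab : a ^ 2 + b ^ 2 = 0
    · refine ⟨1, 0, by norm_num, ?_⟩
      have : a ^ 2 = 0 := by nlinarith [sq_nonneg a, sq_nonneg b]
      simpa using this
    · have hpos : 0 < a ^ 2 + b ^ 2 := lt_of_le_of_ne (by positivity) (Ne.symm hab)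
      refine ⟨b / √(a ^ 2 + b ^ 2), -a / √(a ^ 2 + b ^ 2), ?_, ?_⟩
      · rw [div_pow, div_pow, Real.sq_sqrt hpos.le, ← add_div, neg_sq, add_comm, div_self hab]
      · ring
  set f : κ → ℝ := α • φ i₀ + β • φ i₁
  have hQf : ∀ x, f x - (Q *ᵥ f) x = (1 - l i₀) * α * φ i₀ x + (1 - l i₁) * β * φ i₁ x := by
    intro x
    have : Q *ᵥ f = α • (l i₀ • φ i₀) + β • (l i₁ • φ i₁) := by
      rw [← heig, ← heig, mulVec_add, mulVec_smul, mulVec_smul]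
    rw [this]
    simp only [f, Pi.add_apply, Pi.smul_apply, smul_eq_mul]
    ring
  have hbil : ∀ s t s' t' : ℝ, ∑ x, w x * (s * φ i₀ x + t * φ i₁ x)
      * (s' * φ i₀ x + t' * φ i₁ x) = s * s' + t * t' := by
    intro s t s' t'
    have e : ∀ x, w x * (s * φ i₀ x + t * φ i₁ x) * (s' * φ i₀ x + t' * φ i₁ x)
        = s * s' * (w x * φ i₀ x * φ i₀ x) + s * t' * (w x * φ i₀ x * φ i₁ x)
          + (t * s' * (w x * φ i₁ x * φ i₀ x) + t * t' * (w x * φ i₁ x * φ i₁ x)) := by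
      intro x; ring
    simp only [e, Finset.sum_add_distrib, ← Finset.mul_sum, horth]
    simp [h01, h01.symm]
  have hfv : ∑ x, w x * f x * v x = 0 := by
    rw [← hv, Finset.mul_sum, Finset.mul_sum, ← Finset.sum_add_distrib]
    exact Finset.sum_congr rfl fun x _ => by
      simp only [f, Pi.add_apply, Pi.smul_apply, smul_eq_mul]; ring
  have key := hg f hfv
  have e1 : ∑ x, w x * f x * f x = 1 := by
    have := hbil α β α β
    simp only [f, Pi.add_apply, Pi.smul_apply, smul_eq_mul]
    rw [this, ← hαβ]; ring
  have e2 : ∑ x, w x * f x * (f x - (Q *ᵥ f) x) = (1 - l i₀) * α ^ 2 + (1 - l i₁) * β ^ 2 := by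
    have := hbil α β ((1 - l i₀) * α) ((1 - l i₁) * β)
    simp only [hQf]
    simp only [f, Pi.add_apply, Pi.smul_apply, smul_eq_mul]
    rw [this]; ring
  rw [e1, e2] at key
  have hle : l i₁ ≤ l i₀ := hl (by simp [i₀, i₁])
  rw [spectralGap, hsec]
  have h2 : (1 - l i₁) * (α ^ 2 + β ^ 2) = 1 - l i₁ := by rw [hαβ, mul_one]
  have h3 := mul_le_mul_of_nonneg_right hle (sq_nonneg α)
  linarith

/-- The spectral gap is a constant in the Poincaré inequality. -/
lemma spectralGap_mul_le {V : Type*} [AddCommGroup V] [Module ℂ V]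
    [FiniteDimensional ℂ V] (L : Module.End ℂ V) (Q : Matrix κ κ ℝ) (w : κ → ℝ)
    (hw : ∀ x, 0 < w x) (hQ : ∀ x y, w x * Q x y = w y * Q y x)
    (hL : L.charpoly = Q.charpoly.map (algebraMap ℝ ℂ)) (h : 1 < Fintype.card κ)
    (v : κ → ℝ) (hv : v ≠ 0) (hQv : Q *ᵥ v = v)
    (hpos : ∀ f : κ → ℝ, 0 ≤ ∑ x, w x * f x * (f x - (Q *ᵥ f) x))
    (f : κ → ℝ) (hf : ∑ x, w x * f x * v x = 0) :
    spectralGap L * ∑ x, w x * f x * f x ≤ ∑ x, w x * f x * (f x - (Q *ᵥ f) x) := by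
  obtain ⟨φ, l, hl, hsec, heig, horth, hexp⟩ := exists_weighted_eigenbasis L Q w hw hQ hL h
  set i₀ : Fin (Fintype.card κ) := ⟨0, by omega⟩
  set i₁ : Fin (Fintype.card κ) := ⟨1, h⟩
  rw [spectralGap, hsec]
  have hff : 0 ≤ ∑ x, w x * f x * f x := Finset.sum_nonneg fun x _ => by
    rw [mul_assoc]; exact mul_nonneg (hw x).le (mul_self_nonneg _)
  -- If `λ₂ ≥ 1`, the left side is nonpositive. Otherwise 1 is not among the lower eigenvalues, so
  -- the fixed vector `v` spans the leading eigenline and `f ⟂ v` has no component there.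
  by_cases h1 : 1 ≤ l i₁
  · exact le_trans (mul_nonpos_of_nonpos_of_nonneg (by linarith) hff) (hpos f)
  push Not at h1
  -- the expansion of a weighted product in the eigenbasis
  have hpars : ∀ a b : κ → ℝ, ∑ x, w x * a x * b x
      = ∑ i, (∑ x, w x * φ i x * a x) * (∑ x, w x * φ i x * b x) := by
    intro a b
    conv_lhs => rw [hexp b]
    simp only [Finset.sum_apply, Pi.smul_apply, smul_eq_mul]
    rw [Finset.sum_congr rfl fun x _ => Finset.mul_sum _ _ _, Finset.sum_comm]
    refine Finset.sum_congr rfl fun i _ => ?_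
    rw [Finset.sum_mul]
    exact Finset.sum_congr rfl fun x _ => by ring
  have hadj : ∀ i (a : κ → ℝ), ∑ x, w x * φ i x * (Q *ᵥ a) x = l i * ∑ x, w x * φ i x * a x := by
    intro i a
    have e1 : ∑ x, w x * φ i x * (Q *ᵥ a) x = ∑ y, w y * a y * (Q *ᵥ φ i) y := by
      simp only [mulVec, dotProduct, Finset.mul_sum]
      rw [Finset.sum_comm]
      refine Finset.sum_congr rfl fun y _ => Finset.sum_congr rfl fun x _ => ?_
      have := hQ x y
      linear_combination (φ i x * a y) * this
    rw [e1, heig, Finset.mul_sum]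
    exact Finset.sum_congr rfl fun x _ => by simp only [Pi.smul_apply, smul_eq_mul]; ring
  have hle1 : ∀ i, i ≠ i₀ → l i ≤ l i₁ := by
    intro i hi
    refine hl ?_
    have : i.val ≠ 0 := fun e => hi (Fin.ext e)
    exact Fin.mk_le_of_le_val (by omega)
  have hvi : ∀ i, i ≠ i₀ → ∑ x, w x * φ i x * v x = 0 := by
    intro i hi
    have := hadj i v
    rw [hQv] at this
    have h2 := hle1 i hi
    have h3 : (1 - l i) * ∑ x, w x * φ i x * v x = 0 := by linarith
    rcases mul_eq_zero.1 h3 with h4 | h4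
    · linarith
    · exact h4
  have hv0 : ∑ x, w x * φ i₀ x * v x ≠ 0 := by
    intro h0
    apply hv
    rw [hexp v]
    refine Finset.sum_eq_zero fun i _ => ?_
    by_cases hi : i = i₀
    · rw [hi, h0, zero_smul]
    · rw [hvi i hi, zero_smul]
  have hf0 : ∑ x, w x * φ i₀ x * f x = 0 := by
    have := hpars f v
    rw [hf, Finset.sum_eq_single i₀ (fun i _ hi => by rw [hvi i hi, mul_zero])
      (fun h => absurd (Finset.mem_univ _) h)] at this
    exact (mul_eq_zero.1 this.symm).resolve_right hv0
  have e3 : ∑ x, w x * f x * (f x - (Q *ᵥ f) x)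
      = ∑ i, (1 - l i) * (∑ x, w x * φ i x * f x) ^ 2 := by
    have := hpars f (f - Q *ᵥ f)
    simp only [Pi.sub_apply] at this
    rw [this]
    refine Finset.sum_congr rfl fun i _ => ?_
    simp only [mul_sub, Finset.sum_sub_distrib]
    rw [hadj]; ring
  rw [e3, hpars f f, Finset.mul_sum]
  refine Finset.sum_le_sum fun i _ => ?_
  by_cases hi : i = i₀
  · rw [hi, hf0]; simp
  · have := hle1 i hi
    nlinarith [sq_nonneg (∑ x, w x * φ i x * f x)]

end Spectral

/-! ### Chains on unordered pairs -/

section PairChain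

variable {ι : Type*} [Fintype ι] [DecidableEq ι]

/-- The number of ordered pairs that represent an unordered pair. -/
def pairWeight (x : Sym2 ι) : ℝ :=
  ((Finset.univ.filter fun q : ι × ι => s(q.1, q.2) = x).card : ℝ)

lemma sum_pairWeight_mul (h : Sym2 ι → ℝ) :
    ∑ x, pairWeight x * h x = ∑ a, ∑ b, h s(a, b) := by
  rw [← Fintype.sum_prod_type' (fun a b => h s(a, b)),
    ← Finset.sum_fiberwise (s := Finset.univ) (g := fun q : ι × ι => s(q.1, q.2))]
  refine Finset.sum_congr rfl fun x _ => ?_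
  rw [Finset.sum_congr rfl (g := fun _ => h x)
    (fun q hq => by rw [(Finset.mem_filter.1 hq).2]), Finset.sum_const, nsmul_eq_mul, pairWeight]

lemma pairWeight_add_diag (x : Sym2 ι) :
    pairWeight x + ((Finset.univ.filter fun a : ι => s(a, a) = x).card : ℝ) = 2 := by
  induction x using Sym2.ind with
  | _ a b =>
  have h1 : (Finset.univ.filter fun q : ι × ι => s(q.1, q.2) = s(a, b)) = {(a, b), (b, a)} := by
    ext ⟨c, d⟩
    simp
  rw [pairWeight, h1]
  by_cases h : a = b
  · subst h
    have h2 : (Finset.univ.filter fun c : ι => s(c, c) = s(a, a)) = {a} := by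
      ext c; simp
    rw [h2]; norm_num
  · have h2 : (Finset.univ.filter fun c : ι => s(c, c) = s(a, b)) = ∅ := by
      ext c
      simp only [Sym2.eq_iff, Finset.mem_filter, Finset.mem_univ, true_and, Finset.notMem_empty,
        iff_false]
      rintro (⟨rfl, h3⟩ | ⟨rfl, h3⟩) <;> exact h (by simp [h3])
    rw [h2, Finset.card_pair (by simp [h])]
    norm_num

lemma pairWeight_le_two (x : Sym2 ι) : pairWeight x ≤ 2 := by
  have := pairWeight_add_diag x
  have h : (0 : ℝ) ≤ ((Finset.univ.filter fun a : ι => s(a, a) = x).card : ℝ) := by positivity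
  linarith

lemma one_le_pairWeight (x : Sym2 ι) : 1 ≤ pairWeight x := by
  induction x using Sym2.ind with
  | _ a b =>
  rw [pairWeight]
  exact_mod_cast Finset.card_pos.2 ⟨(a, b), by simp⟩

/-- Ordered pairs count a diagonal pair once and any other pair twice; adding the diagonal evens
this out. This links the counting measure to sums over ordered pairs. -/
lemma two_mul_sum_sym2 (h : Sym2 ι → ℝ) :
    2 * ∑ x, h x = ∑ a, ∑ b, h s(a, b) + ∑ a, h s(a, a) := by
  have h2 : ∑ a, h s(a, a)
      = ∑ x, ((Finset.univ.filter fun a : ι => s(a, a) = x).card : ℝ) * h x := by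
    rw [← Finset.sum_fiberwise (s := Finset.univ) (g := fun a : ι => s(a, a))]
    refine Finset.sum_congr rfl fun x _ => ?_
    rw [Finset.sum_congr rfl (g := fun _ => h x)
      (fun q hq => by rw [(Finset.mem_filter.1 hq).2]), Finset.sum_const, nsmul_eq_mul]
  rw [h2, ← sum_pairWeight_mul, ← Finset.sum_add_distrib, Finset.mul_sum]
  exact Finset.sum_congr rfl fun x _ => by rw [← add_mul, pairWeight_add_diag]

/-- Two particles on `a` and `b` move independently by `p`, with rate `1 / 8` each; `ε` scales the
correction for the exchange of the two particles. -/
def pairRow (p : Matrix ι ι ℝ) (ε : ℝ) (a b : ι) : Sym2 ι → ℝ :=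
  (1 / 8 : ℝ) • ((6 : ℝ) • Pi.single s(a, b) 1
    + (∑ c, p b c • Pi.single s(a, c) (1 : ℝ) + ∑ c, p a c • Pi.single s(b, c) (1 : ℝ))
    + (ε * (p a b + p b a) / 2) • (Pi.single s(a, a) 1 + Pi.single s(b, b) 1
      - (2 : ℝ) • Pi.single s(a, b) 1))

lemma pairRow_comm (p : Matrix ι ι ℝ) (ε : ℝ) (a b : ι) : pairRow p ε a b = pairRow p ε b a := by
  unfold pairRow
  rw [show s(b, a) = s(a, b) from Sym2.eq_swap]
  module

/-- The matrix on unordered pairs with the rows `pairRow`. -/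
def pairChain (p : Matrix ι ι ℝ) (ε : ℝ) : Matrix (Sym2 ι) (Sym2 ι) ℝ :=
  Matrix.of fun x => Sym2.lift ⟨pairRow p ε, pairRow_comm p ε⟩ x

lemma pairChain_mk (p : Matrix ι ι ℝ) (ε : ℝ) (a b : ι) :
    pairChain p ε s(a, b) = pairRow p ε a b := rfl

lemma sum_pairChain_smul {p : Matrix ι ι ℝ} (hs : ∀ a b, p a b = p b a) (ε : ℝ) {V : Type*}
    [AddCommGroup V] [Module ℝ V] (u : Sym2 ι → V) (a b : ι) :
    ∑ y, pairChain p ε s(a, b) y • u y = (1 / 8 : ℝ) • ((6 : ℝ) • u s(a, b)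
      + (∑ c, p b c • u s(a, c) + ∑ c, p a c • u s(b, c))
      + (ε * p a b) • (u s(a, a) + u s(b, b) - (2 : ℝ) • u s(a, b))) := by
  have h : ε * (p a b + p b a) / 2 = ε * p a b := by rw [hs b a]; ring
  rw [← Fintype.linearCombination_apply ℝ u, pairChain_mk]
  simp only [pairRow, map_smul, map_add, map_sub, map_sum, h,
    Fintype.linearCombination_apply_single, one_smul]

lemma pairChain_mulVec {p : Matrix ι ι ℝ} (hs : ∀ a b, p a b = p b a) (ε : ℝ)
    (f : Sym2 ι → ℝ) (a b : ι) :
    (pairChain p ε *ᵥ f) s(a, b) = 1 / 8 * (6 * f s(a, b)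
      + (∑ c, p b c * f s(a, c) + ∑ c, p a c * f s(b, c))
      + ε * p a b * (f s(a, a) + f s(b, b) - 2 * f s(a, b))) :=
  sum_pairChain_smul hs ε f a b

/-- A nonnegative symmetric matrix with unit row sums. -/
structure IsSymmStochastic (p : Matrix ι ι ℝ) : Prop where
  symm : ∀ a b, p a b = p b a
  nonneg : ∀ a b, 0 ≤ p a b
  sum_row : ∀ a, ∑ b, p a b = 1

omit [DecidableEq ι] in
lemma IsSymmStochastic.le_one {p : Matrix ι ι ℝ} (hp : IsSymmStochastic p) (a b : ι) :
    p a b ≤ 1 := by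
  rw [← hp.sum_row a]
  exact Finset.single_le_sum (fun c _ => hp.nonneg a c) (Finset.mem_univ b)

lemma IsSymmStochastic.pairChain_mulVec_one {p : Matrix ι ι ℝ} (hp : IsSymmStochastic p)
    (ε : ℝ) : pairChain p ε *ᵥ 1 = 1 := by
  ext x
  induction x using Sym2.ind with
  | _ a b =>
  rw [pairChain_mulVec hp.symm]
  simp only [Pi.one_apply, mul_one, hp.sum_row]
  ring

lemma apply_symm_of_bilin {κ : Type*} [Fintype κ] [DecidableEq κ] (Q : Matrix κ κ ℝ) (w : κ → ℝ)
    (h : ∀ f g : κ → ℝ, ∑ x, w x * (g x * (Q *ᵥ f) x) = ∑ x, w x * (f x * (Q *ᵥ g) x)) (x y : κ) :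
    w x * Q x y = w y * Q y x := by
  simpa [Pi.single_apply] using h (Pi.single y 1) (Pi.single x 1)

/-- Detailed balance: with the weight, sums run over ordered pairs, where each particle moves by the
symmetric matrix `p` while the other one rests. -/
lemma IsSymmStochastic.pairChain_zero_symm {p : Matrix ι ι ℝ} (hp : IsSymmStochastic p)
    (x y : Sym2 ι) : pairWeight x * pairChain p 0 x y = pairWeight y * pairChain p 0 y x := by
  have key : ∀ f g : Sym2 ι → ℝ, ∑ x, pairWeight x * (g x * (pairChain p 0 *ᵥ f) x)
      = 1 / 8 * (6 * ∑ a, ∑ b, g s(a, b) * f s(a, b)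
        + 2 * ∑ a, ∑ b, ∑ c, p b c * (g s(a, b) * f s(a, c))) := by
    intro f g
    rw [sum_pairWeight_mul (fun x => g x * (pairChain p 0 *ᵥ f) x)]
    -- Renaming the two particles shows that both moves contribute equally.
    have e : ∑ a, ∑ b, ∑ c, p b c * (g s(a, b) * f s(a, c))
        = ∑ a, ∑ b, ∑ c, p a c * (g s(a, b) * f s(b, c)) := by
      rw [Finset.sum_comm]
      exact Finset.sum_congr rfl fun a _ => Finset.sum_congr rfl fun b _ =>
        Finset.sum_congr rfl fun c _ => by rw [Sym2.eq_swap]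
    rw [two_mul]
    nth_rewrite 2 [e]
    simp only [Finset.mul_sum, ← Finset.sum_add_distrib, mul_add]
    refine Finset.sum_congr rfl fun a _ => Finset.sum_congr rfl fun b _ => ?_
    rw [pairChain_mulVec hp.symm]
    simp only [zero_mul, add_zero, mul_add, Finset.mul_sum, ← Finset.sum_add_distrib]
    congr 1
    · ring
    · exact Finset.sum_congr rfl fun c _ => by ring
  refine apply_symm_of_bilin _ _ (fun f g => ?_) x y
  have e1 : ∑ a, ∑ b, g s(a, b) * f s(a, b) = ∑ a, ∑ b, f s(a, b) * g s(a, b) :=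
    Finset.sum_congr rfl fun a _ => Finset.sum_congr rfl fun b _ => mul_comm _ _
  have e2 : ∑ a, ∑ b, ∑ c, p b c * (g s(a, b) * f s(a, c))
      = ∑ a, ∑ b, ∑ c, p b c * (f s(a, b) * g s(a, c)) := by
    refine Finset.sum_congr rfl fun a _ => ?_
    rw [Finset.sum_comm]
    exact Finset.sum_congr rfl fun b _ => Finset.sum_congr rfl fun c _ => by
      rw [hp.symm]; ring
  rw [key, key, e1, e2]

/-- The bilinear form for the counting measure is written as the reversible form of the independent
chain plus an expression visibly symmetric in `f` and `g`. This yields the symmetry of the exchange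
chain and, for `f = g`, its Dirichlet form. -/
lemma IsSymmStochastic.two_mul_sum_pairChain_one {p : Matrix ι ι ℝ} (hp : IsSymmStochastic p)
    (f g : Sym2 ι → ℝ) : 2 * ∑ x, g x * (pairChain p 1 *ᵥ f) x
      = ∑ x, pairWeight x * (g x * (pairChain p 0 *ᵥ f) x)
        + 1 / 8 * (∑ a, ∑ b, 2 * p a b * (g s(a, b) * f s(a, a) + g s(a, a) * f s(a, b)
          - g s(a, b) * f s(a, b)) + ∑ a, 6 * (g s(a, a) * f s(a, a))) := by
  rw [two_mul_sum_sym2 (fun x => g x * (pairChain p 1 *ᵥ f) x),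
    sum_pairWeight_mul (fun x => g x * (pairChain p 0 *ᵥ f) x)]
  have e1 : ∀ a b, g s(a, b) * (pairChain p 1 *ᵥ f) s(a, b)
      = g s(a, b) * (pairChain p 0 *ᵥ f) s(a, b)
        + 1 / 8 * (p a b * (g s(a, b) * (f s(a, a) + f s(b, b) - 2 * f s(a, b)))) := by
    intro a b
    rw [pairChain_mulVec hp.symm, pairChain_mulVec hp.symm]; ring
  have e2 : ∀ a, g s(a, a) * (pairChain p 1 *ᵥ f) s(a, a)
      = 1 / 8 * (6 * (g s(a, a) * f s(a, a)) + ∑ b, 2 * p a b * (g s(a, a) * f s(a, b))) := by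
    intro a
    rw [pairChain_mulVec hp.symm]
    have : ∑ b, 2 * p a b * (g s(a, a) * f s(a, b))
        = 2 * g s(a, a) * ∑ c, p a c * f s(a, c) := by
      rw [Finset.mul_sum]; exact Finset.sum_congr rfl fun b _ => by ring
    rw [this]; ring
  have e3 : ∑ a, ∑ b, p a b * (g s(a, b) * f s(b, b))
      = ∑ a, ∑ b, p a b * (g s(a, b) * f s(a, a)) := by
    rw [Finset.sum_comm]
    exact Finset.sum_congr rfl fun a _ => Finset.sum_congr rfl fun b _ => by
      rw [hp.symm, Sym2.eq_swap]
  have e4 : ∑ a, ∑ b, p a b * (g s(a, b) * (f s(a, a) + f s(b, b) - 2 * f s(a, b)))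
      = ∑ a, ∑ b, 2 * p a b * (g s(a, b) * f s(a, a) - g s(a, b) * f s(a, b)) := by
    have l : ∀ a b, p a b * (g s(a, b) * (f s(a, a) + f s(b, b) - 2 * f s(a, b)))
        = p a b * (g s(a, b) * f s(a, a)) + p a b * (g s(a, b) * f s(b, b))
          - 2 * (p a b * (g s(a, b) * f s(a, b))) := by intro a b; ring
    have r : ∀ a b, 2 * p a b * (g s(a, b) * f s(a, a) - g s(a, b) * f s(a, b))
        = p a b * (g s(a, b) * f s(a, a)) + p a b * (g s(a, b) * f s(a, a))
          - 2 * (p a b * (g s(a, b) * f s(a, b))) := by intro a b; ring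
    simp only [l, r, Finset.sum_add_distrib, Finset.sum_sub_distrib, e3]
  have e5 : ∀ a b, 2 * p a b * (g s(a, b) * f s(a, a) + g s(a, a) * f s(a, b)
      - g s(a, b) * f s(a, b)) = 2 * p a b * (g s(a, b) * f s(a, a) - g s(a, b) * f s(a, b))
        + 2 * p a b * (g s(a, a) * f s(a, b)) := by intro a b; ring
  simp only [e2]
  simp only [e1, e5, Finset.sum_add_distrib, ← Finset.mul_sum]
  rw [e4]
  ring

lemma IsSymmStochastic.pairChain_one_symm {p : Matrix ι ι ℝ} (hp : IsSymmStochastic p)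
    (x y : Sym2 ι) : pairChain p 1 x y = pairChain p 1 y x := by
  have h0 : ∀ f g : Sym2 ι → ℝ, ∑ x, pairWeight x * (g x * (pairChain p 0 *ᵥ f) x)
      = ∑ x, pairWeight x * (f x * (pairChain p 0 *ᵥ g) x) := by
    intro f g
    simp only [mulVec, dotProduct, Finset.mul_sum]
    rw [Finset.sum_comm]
    refine Finset.sum_congr rfl fun x _ => Finset.sum_congr rfl fun y _ => ?_
    linear_combination (f x * g y) * hp.pairChain_zero_symm y x
  have := apply_symm_of_bilin (pairChain p 1) (fun _ => 1) (fun f g => ?_) x y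
  · simpa using this
  · simp only [one_mul]
    have e1 : ∀ a b, 2 * p a b * (g s(a, b) * f s(a, a) + g s(a, a) * f s(a, b)
        - g s(a, b) * f s(a, b)) = 2 * p a b * (f s(a, b) * g s(a, a) + f s(a, a) * g s(a, b)
        - f s(a, b) * g s(a, b)) := by intro a b; ring
    have e2 : ∀ a, g s(a, a) * f s(a, a) = f s(a, a) * g s(a, a) := fun a => mul_comm _ _
    rw [← mul_right_inj' (two_ne_zero (α := ℝ)), hp.two_mul_sum_pairChain_one,
      hp.two_mul_sum_pairChain_one, h0]
    simp only [e1, e2]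

omit [DecidableEq ι] in
-- Rows and columns of `p` sum to 1, so both square terms of the expansion give `∑ h b ^ 2`.
lemma IsSymmStochastic.sum_sq_sub {p : Matrix ι ι ℝ} (hp : IsSymmStochastic p) (h : ι → ℝ) :
    ∑ b, ∑ c, p b c * (h b - h c) ^ 2 = 2 * ∑ b, h b * (h b - ∑ c, p b c * h c) := by
  have e : ∀ b c, p b c * (h b - h c) ^ 2
      = p b c * h b ^ 2 + p b c * h c ^ 2 - 2 * (h b * (p b c * h c)) := by intro b c; ring
  have e2 : ∑ b, ∑ c, p b c * h c ^ 2 = ∑ b, h b ^ 2 := by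
    rw [Finset.sum_comm]
    refine Finset.sum_congr rfl fun c _ => ?_
    rw [← Finset.sum_mul]
    simp only [hp.symm _ c, hp.sum_row, one_mul]
  have e3 : ∑ b, ∑ c, p b c * h b ^ 2 = ∑ b, h b ^ 2 :=
    Finset.sum_congr rfl fun b _ => by rw [← Finset.sum_mul, hp.sum_row, one_mul]
  simp only [e, Finset.sum_sub_distrib, Finset.sum_add_distrib, e2, e3, ← Finset.mul_sum, mul_sub,
    ← sq]
  ring

/-- The Dirichlet form of two independent particles, up to a constant. -/
def pairEnergy (p : Matrix ι ι ℝ) (f : Sym2 ι → ℝ) : ℝ :=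
  ∑ a, ∑ b, ∑ c, p b c * (f s(a, b) - f s(a, c)) ^ 2

omit [DecidableEq ι] in
lemma IsSymmStochastic.pairEnergy_nonneg {p : Matrix ι ι ℝ} (hp : IsSymmStochastic p)
    (f : Sym2 ι → ℝ) : 0 ≤ pairEnergy p f :=
  Finset.sum_nonneg fun _ _ => Finset.sum_nonneg fun b _ => Finset.sum_nonneg fun c _ =>
    mul_nonneg (hp.nonneg b c) (sq_nonneg _)

lemma IsSymmStochastic.dirichlet_zero {p : Matrix ι ι ℝ} (hp : IsSymmStochastic p)
    (f : Sym2 ι → ℝ) : ∑ x, pairWeight x * (f x * (f x - (pairChain p 0 *ᵥ f) x))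
      = 1 / 8 * pairEnergy p f := by
  rw [sum_pairWeight_mul (fun x => f x * (f x - (pairChain p 0 *ᵥ f) x)), pairEnergy]
  have e1 : ∀ a, ∑ b, ∑ c, p b c * (f s(a, b) - f s(a, c)) ^ 2
      = 2 * ∑ b, f s(a, b) * (f s(a, b) - ∑ c, p b c * f s(a, c)) :=
    fun a => hp.sum_sq_sub (fun b => f s(a, b))
  have e2 : ∑ a, ∑ b, f s(a, b) * (f s(a, b) - ∑ c, p b c * f s(a, c))
      = ∑ a, ∑ b, f s(a, b) * (f s(a, b) - ∑ c, p a c * f s(b, c)) := by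
    rw [Finset.sum_comm]
    exact Finset.sum_congr rfl fun a _ => Finset.sum_congr rfl fun b _ => by rw [Sym2.eq_swap]
  simp only [e1, ← Finset.mul_sum]
  rw [two_mul]
  nth_rewrite 2 [e2]
  rw [← Finset.sum_add_distrib, Finset.mul_sum]
  refine Finset.sum_congr rfl fun a _ => ?_
  rw [← Finset.sum_add_distrib, Finset.mul_sum]
  refine Finset.sum_congr rfl fun b _ => ?_
  rw [pairChain_mulVec hp.symm]; ring

/-- Passing from ordered pairs to the counting measure halves the independent energy. The exchange
correction, together with the diagonal pairs, completes a sum of squares over the moves that leave a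
diagonal pair. -/
lemma IsSymmStochastic.dirichlet_one {p : Matrix ι ι ℝ} (hp : IsSymmStochastic p)
    (f : Sym2 ι → ℝ) : ∑ x, f x * (f x - (pairChain p 1 *ᵥ f) x)
      = 1 / 16 * pairEnergy p f
        + 1 / 8 * ∑ a, ∑ c, p a c * (f s(a, a) - f s(a, c)) ^ 2 := by
  have h1 := hp.two_mul_sum_pairChain_one f f
  have h2 := hp.dirichlet_zero f
  have h3 := two_mul_sum_sym2 (fun x => f x * f x)
  have h4 := sum_pairWeight_mul (fun x => f x * f x)
  have e1 : ∑ a, ∑ b, 2 * p a b * (f s(a, b) * f s(a, a) + f s(a, a) * f s(a, b)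
      - f s(a, b) * f s(a, b)) + ∑ a, 6 * (f s(a, a) * f s(a, a))
      = 8 * ∑ a, f s(a, a) * f s(a, a)
        - 2 * ∑ a, ∑ c, p a c * (f s(a, a) - f s(a, c)) ^ 2 := by
    rw [← Finset.sum_add_distrib, Finset.mul_sum, Finset.mul_sum, ← Finset.sum_sub_distrib]
    refine Finset.sum_congr rfl fun a _ => ?_
    have : ∑ c, p a c * (f s(a, a) * f s(a, a)) = f s(a, a) * f s(a, a) := by
      rw [← Finset.sum_mul, hp.sum_row, one_mul]
    have e : ∀ c, p a c * (f s(a, a) - f s(a, c)) ^ 2 = p a c * (f s(a, a) * f s(a, a))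
      - p a c * (f s(a, c) * f s(a, a) + f s(a, a) * f s(a, c) - f s(a, c) * f s(a, c)) := by
      intro c; ring
    simp only [e, Finset.sum_sub_distrib, this, mul_assoc, ← Finset.mul_sum]
    ring
  rw [e1] at h1
  simp only [mul_sub, Finset.sum_sub_distrib] at h2 ⊢
  linarith

lemma IsSymmStochastic.dirichlet_zero_le {p : Matrix ι ι ℝ} (hp : IsSymmStochastic p)
    (f : Sym2 ι → ℝ) : 1 / 16 * pairEnergy p f ≤ ∑ x, f x * (f x - (pairChain p 1 *ᵥ f) x) := by
  rw [hp.dirichlet_one]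
  have : 0 ≤ ∑ a, ∑ c, p a c * (f s(a, a) - f s(a, c)) ^ 2 :=
    Finset.sum_nonneg fun a _ => Finset.sum_nonneg fun c _ =>
      mul_nonneg (hp.nonneg a c) (sq_nonneg _)
  linarith

/-- The extra sum consists of the terms `b = a` of `pairEnergy`, so it is at most the whole energy,
and `1/16 + 1/8 = 3/16`. -/
lemma IsSymmStochastic.dirichlet_one_le {p : Matrix ι ι ℝ} (hp : IsSymmStochastic p)
    (f : Sym2 ι → ℝ) : ∑ x, f x * (f x - (pairChain p 1 *ᵥ f) x) ≤ 3 / 16 * pairEnergy p f := by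
  rw [hp.dirichlet_one]
  have : ∑ a, ∑ c, p a c * (f s(a, a) - f s(a, c)) ^ 2 ≤ pairEnergy p f :=
    Finset.sum_le_sum fun a _ => Finset.single_le_sum
      (f := fun b => ∑ c, p b c * (f s(a, b) - f s(a, c)) ^ 2)
      (fun b _ => Finset.sum_nonneg fun c _ => mul_nonneg (hp.nonneg b c) (sq_nonneg _))
      (Finset.mem_univ a)
  linarith

end PairChain

/-! ### The exchange chain is irreducible and doubly stochastic -/

section Stochastic

variable {ι : Type*} [Fintype ι] [DecidableEq ι] {p : Matrix ι ι ℝ}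

/-- The only negative term is `-2 p a b` at the pair itself, and `6 - 2 p a b ≥ 4`. Keeping one move
`b → c` besides gives both nonnegativity and positive transition probabilities. -/
lemma IsSymmStochastic.le_pairChain_one (hp : IsSymmStochastic p) (a b c : ι) (y : Sym2 ι) :
    1 / 8 * (4 * (Pi.single s(a, b) 1 : Sym2 ι → ℝ) y
      + p b c * (Pi.single s(a, c) 1 : Sym2 ι → ℝ) y) ≤ pairChain p 1 s(a, b) y := by
  have h0 : ∀ z : Sym2 ι, 0 ≤ (Pi.single z 1 : Sym2 ι → ℝ) y := by
    intro z; rw [Pi.single_apply]; split_ifs <;> norm_num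
  rw [pairChain_mk, pairRow, hp.symm b a]
  simp only [Pi.smul_apply, Pi.add_apply, Pi.sub_apply, Finset.sum_apply, smul_eq_mul]
  have h1 : p b c * (Pi.single s(a, c) 1 : Sym2 ι → ℝ) y
      ≤ ∑ c, p b c * (Pi.single s(a, c) 1 : Sym2 ι → ℝ) y :=
    Finset.single_le_sum (f := fun c => p b c * (Pi.single s(a, c) 1 : Sym2 ι → ℝ) y)
      (fun c _ => mul_nonneg (hp.nonneg b c) (h0 _)) (Finset.mem_univ c)
  have h2 : 0 ≤ ∑ c, p a c * (Pi.single s(b, c) 1 : Sym2 ι → ℝ) y :=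
    Finset.sum_nonneg fun c _ => mul_nonneg (hp.nonneg a c) (h0 _)
  have h3 := mul_le_mul_of_nonneg_right (hp.le_one a b) (h0 s(a, b))
  have h4 := mul_nonneg (hp.nonneg a b) (h0 s(a, a))
  have h5 := mul_nonneg (hp.nonneg a b) (h0 s(b, b))
  linarith

lemma IsSymmStochastic.pairChain_one_nonneg (hp : IsSymmStochastic p) (x y : Sym2 ι) :
    0 ≤ pairChain p 1 x y := by
  induction x using Sym2.ind with
  | _ a b =>
  refine le_trans ?_ (hp.le_pairChain_one a b b y)
  have := hp.nonneg b b
  have h0 : 0 ≤ (Pi.single s(a, b) 1 : Sym2 ι → ℝ) y := by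
    rw [Pi.single_apply]; split_ifs <;> norm_num
  positivity

lemma IsSymmStochastic.pairChain_one_mem_doublyStochastic (hp : IsSymmStochastic p) :
    pairChain p 1 ∈ doublyStochastic ℝ (Sym2 ι) := by
  have h : ∀ x, ∑ y, pairChain p 1 x y = 1 := fun x => by
    simpa [mulVec, dotProduct] using congrFun (hp.pairChain_mulVec_one 1) x
  rw [mem_doublyStochastic_iff_sum]
  exact ⟨hp.pairChain_one_nonneg, h, fun y => by simpa only [hp.pairChain_one_symm] using h y⟩

lemma IsSymmStochastic.pairChain_one_isIrreducible (hp : IsSymmStochastic p)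
    (hconn : ∀ a b, Relation.ReflTransGen (fun a b => 0 < p a b) a b) :
    (pairChain p 1).IsIrreducible := by
  refine ⟨hp.pairChain_one_nonneg, ?_⟩
  let _ : Quiver (Sym2 ι) := toQuiver (pairChain p 1)
  have hstep : ∀ a b c, 0 < p b c → 0 < pairChain p 1 s(a, b) s(a, c) := by
    intro a b c h
    refine lt_of_lt_of_le ?_ (hp.le_pairChain_one a b c _)
    have h0 : 0 ≤ (Pi.single s(a, b) 1 : Sym2 ι → ℝ) s(a, c) := by
      rw [Pi.single_apply]; split_ifs <;> norm_num
    rw [Pi.single_eq_same]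
    linarith
  have hself : ∀ x, 0 < pairChain p 1 x x := by
    intro x
    induction x using Sym2.ind with
    | _ a b =>
    refine lt_of_lt_of_le ?_ (hp.le_pairChain_one a b b _)
    rw [Pi.single_eq_same]
    have := hp.nonneg b b
    linarith
  have hpath : ∀ a b c, Nonempty (Quiver.Path (V := Sym2 ι) s(a, b) s(a, c)) := by
    intro a b c
    induction hconn b c with
    | refl => exact ⟨Quiver.Path.nil⟩
    | tail _ h ih => exact ih.map fun q => q.cons ⟨hstep a _ _ h⟩
  intro x y
  induction x using Sym2.ind with
  | _ a b =>
  induction y using Sym2.ind with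
  | _ c d =>
  -- Move the second particle from `b` to `d`, then, with the roles exchanged, the first one from
  -- `a` to `c`. The self-loop appended at the end makes the path length positive.
  obtain ⟨q₁⟩ := hpath a b d
  obtain ⟨q₂⟩ := hpath d a c
  rw [show s(d, a) = s(a, d) from Sym2.eq_swap, show s(d, c) = s(c, d) from Sym2.eq_swap] at q₂
  exact ⟨(q₁.comp q₂).cons ⟨hself _⟩, by simp⟩

end Stochastic

/-! ### Comparison of spectral gaps -/

section Gaps

variable {ι : Type*} [Fintype ι] [DecidableEq ι] {p : Matrix ι ι ℝ}
  {V : Type*} [AddCommGroup V] [Module ℂ V] [FiniteDimensional ℂ V] {L : Module.End ℂ V}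

omit [DecidableEq ι] in
lemma two_lt_card_sym2 (hι : 2 ≤ Fintype.card ι) : 2 < Fintype.card (Sym2 ι) := by
  rw [Sym2.card]
  calc 2 < Nat.choose 3 2 := by decide
    _ ≤ _ := Nat.choose_le_choose 2 (by omega)

omit [DecidableEq ι] in
lemma pairEnergy_sub_const (f : Sym2 ι → ℝ) (c : ℝ) :
    pairEnergy p (fun x => f x - c) = pairEnergy p f := by
  simp [pairEnergy]

lemma IsSymmStochastic.spectralGap_nonneg (hp : IsSymmStochastic p)
    (hL : L.charpoly = (pairChain p 1).charpoly.map (algebraMap ℝ ℂ))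
    (hι : 2 ≤ Fintype.card ι) : 0 ≤ spectralGap L := by
  refine le_spectralGap L (pairChain p 1) (fun _ => 1) (fun _ => one_pos)
    (fun x y => by rw [hp.pairChain_one_symm]) hL (by have := two_lt_card_sym2 hι; omega) 1 0
    fun f _ => ?_
  have h1 := hp.dirichlet_zero_le f
  have h2 := hp.pairEnergy_nonneg f
  simp only [one_mul, zero_mul]
  linarith

lemma IsSymmStochastic.spectralGap_mul_le (hp : IsSymmStochastic p)
    (hL : L.charpoly = (pairChain p 1).charpoly.map (algebraMap ℝ ℂ))
    (hι : 2 ≤ Fintype.card ι) (f : Sym2 ι → ℝ) (hf : ∑ x, f x = 0) :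
    spectralGap L * ∑ x, f x * f x ≤ ∑ x, f x * (f x - (pairChain p 1 *ᵥ f) x) := by
  have hcard := two_lt_card_sym2 hι
  have : Nonempty (Sym2 ι) := Fintype.card_pos_iff.1 (by omega)
  simpa using _root_.spectralGap_mul_le L (pairChain p 1) (fun _ => 1) (fun _ => one_pos)
    (fun x y => by rw [hp.pairChain_one_symm]) hL (by omega) 1 one_ne_zero
    (hp.pairChain_mulVec_one 1)
    (fun f => by
      have h1 := hp.dirichlet_zero_le f
      have h2 := hp.pairEnergy_nonneg f
      simp only [one_mul]
      linarith) f (by simpa using hf)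

/-- Poincaré inequality for two independent particles in terms of the gap of the exchange chain. -/
lemma IsSymmStochastic.poincare_pair (hp : IsSymmStochastic p)
    (hL : L.charpoly = (pairChain p 1).charpoly.map (algebraMap ℝ ℂ))
    (hι : 2 ≤ Fintype.card ι) (f : Sym2 ι → ℝ) (hf : ∑ a, ∑ b, f s(a, b) = 0) :
    spectralGap L / 3 * ∑ a, ∑ b, f s(a, b) * f s(a, b) ≤ 1 / 8 * pairEnergy p f := by
  have hcard := two_lt_card_sym2 hι
  have hN : (Fintype.card (Sym2 ι) : ℝ) ≠ 0 := by
    have : Fintype.card (Sym2 ι) ≠ 0 := by omega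
    exact_mod_cast this
  -- `f` has mean zero for the weight, so it is recentred for the counting measure. The energy is
  -- unchanged, and the weighted norm about `c` is at least the norm about the weighted mean.
  set c : ℝ := (∑ x, f x) / Fintype.card (Sym2 ι)
  have h0 := hp.spectralGap_nonneg hL hι
  have h1 := hp.spectralGap_mul_le hL hι (fun x => f x - c) (by
    rw [Finset.sum_sub_distrib, Finset.sum_const, Finset.card_univ, nsmul_eq_mul,
      mul_div_cancel₀ _ hN, sub_self])
  have h2 := hp.dirichlet_one_le (fun x => f x - c)
  rw [pairEnergy_sub_const] at h2
  have h3 : ∑ a, ∑ b, f s(a, b) * f s(a, b) ≤ 2 * ∑ x, (f x - c) * (f x - c) := by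
    rw [Finset.mul_sum]
    refine le_trans ?_ (Finset.sum_le_sum fun x _ =>
      mul_le_mul_of_nonneg_right (pairWeight_le_two x) (mul_self_nonneg _))
    rw [sum_pairWeight_mul (fun x => (f x - c) * (f x - c))]
    have e : ∀ a b, (f s(a, b) - c) * (f s(a, b) - c)
        = f s(a, b) * f s(a, b) - 2 * c * f s(a, b) + c * c := by intro a b; ring
    have : 0 ≤ ∑ _a : ι, ∑ _b : ι, c * c :=
      Finset.sum_nonneg fun _ _ => Finset.sum_nonneg fun _ _ => mul_self_nonneg c
    simp only [e, Finset.sum_add_distrib, Finset.sum_sub_distrib, ← Finset.mul_sum, hf] at this ⊢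
    linarith
  -- The 3 in the denominator is the norm factor 2 times the form factor 3/2.
  have h4 := mul_le_mul_of_nonneg_left h3 h0
  linarith

/-- A Poincaré inequality for two independent particles bounds the gap of the exchange chain. -/
lemma IsSymmStochastic.le_spectralGap_of_poincare (hp : IsSymmStochastic p)
    (hL : L.charpoly = (pairChain p 1).charpoly.map (algebraMap ℝ ℂ))
    (hι : 2 ≤ Fintype.card ι) {g : ℝ} (hg0 : 0 ≤ g)
    (hg : ∀ f : Sym2 ι → ℝ, ∑ a, ∑ b, f s(a, b) = 0 →
      g * ∑ a, ∑ b, f s(a, b) * f s(a, b) ≤ 1 / 8 * pairEnergy p f) :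
    g / 2 ≤ spectralGap L := by
  have hcard := two_lt_card_sym2 hι
  refine le_spectralGap L (pairChain p 1) (fun _ => 1) (fun _ => one_pos)
    (fun x y => by rw [hp.pairChain_one_symm]) hL (by omega) 1 (g / 2) fun f hf => ?_
  simp only [one_mul, Pi.one_apply, mul_one] at hf ⊢
  have hN : (Fintype.card ι : ℝ) * Fintype.card ι ≠ 0 := by
    have : Fintype.card ι ≠ 0 := by omega
    positivity
  -- Here the weighted mean is subtracted. Only the form comparison costs a factor 2: since `f` has
  -- counting mean zero and the weight is at least 1, the norm does not decrease.
  set c : ℝ := (∑ a, ∑ b, f s(a, b)) / (Fintype.card ι * Fintype.card ι)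
  have h1 := hg (fun x => f x - c) (by
    simp only [Finset.sum_sub_distrib, Finset.sum_const, Finset.card_univ, nsmul_eq_mul]
    rw [← mul_assoc, mul_div_cancel₀ _ hN, sub_self])
  rw [pairEnergy_sub_const] at h1
  have h2 := hp.dirichlet_zero_le f
  have h3 : ∑ x, f x * f x ≤ ∑ a, ∑ b, (f s(a, b) - c) * (f s(a, b) - c) := by
    rw [← sum_pairWeight_mul (fun x => (f x - c) * (f x - c))]
    refine le_trans ?_ (Finset.sum_le_sum fun x _ =>
      mul_le_mul_of_nonneg_right (one_le_pairWeight x) (mul_self_nonneg _))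
    have e : ∀ x, 1 * ((f x - c) * (f x - c)) = f x * f x - 2 * c * f x + c * c := by
      intro x; ring
    have : 0 ≤ ∑ _x : Sym2 ι, c * c := Finset.sum_nonneg fun _ _ => mul_self_nonneg c
    simp only [e, Finset.sum_add_distrib, Finset.sum_sub_distrib, ← Finset.mul_sum, hf] at this ⊢
    linarith
  have h4 := mul_le_mul_of_nonneg_left h3 hg0
  linarith

/-- Test the Poincaré inequality on the centred indicator of `x`: its energy is `1 - P x x` and its
norm is `1 - 1/N`, where `N ≥ 3` is the number of unordered pairs. -/
lemma IsSymmStochastic.spectralGap_le_diag (hp : IsSymmStochastic p)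
    (hL : L.charpoly = (pairChain p 1).charpoly.map (algebraMap ℝ ℂ))
    (hι : 2 ≤ Fintype.card ι) (x : Sym2 ι) :
    spectralGap L ≤ 3 / 2 * (1 - pairChain p 1 x x) := by
  have hcard := two_lt_card_sym2 hι
  have h0 := hp.spectralGap_nonneg hL hι
  set N : ℝ := (Fintype.card (Sym2 ι) : ℝ) with hN
  have hN3 : 3 ≤ N := by rw [hN]; exact_mod_cast hcard
  have hN0 : N ≠ 0 := by linarith
  set f : Sym2 ι → ℝ := Pi.single x 1 - N⁻¹ • 1
  have hfy : ∀ y, f y = (Pi.single x 1 : Sym2 ι → ℝ) y - N⁻¹ := fun y => by simp [f]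
  have hsum : ∑ y, f y = 0 := by
    simp only [hfy, Finset.sum_sub_distrib, Finset.sum_const, Finset.card_univ, nsmul_eq_mul,
      Finset.sum_pi_single', Finset.mem_univ, if_true]
    rw [← hN, mul_inv_cancel₀ hN0, sub_self]
  have h1 := hp.spectralGap_mul_le hL hι f hsum
  have hcol : ∑ y, pairChain p 1 y x = 1 :=
    (mem_doublyStochastic_iff_sum.1 hp.pairChain_one_mem_doublyStochastic).2.2 x
  have hQf : ∀ y, (pairChain p 1 *ᵥ f) y = pairChain p 1 y x - N⁻¹ := by
    intro y
    simp only [f, mulVec_sub, mulVec_smul, hp.pairChain_mulVec_one 1]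
    simp
  have h2 : ∑ y, f y * (f y - (pairChain p 1 *ᵥ f) y) = 1 - pairChain p 1 x x := by
    have e : ∀ y, f y * (f y - (pairChain p 1 *ᵥ f) y)
        = (Pi.single x 1 : Sym2 ι → ℝ) y * ((Pi.single x 1 : Sym2 ι → ℝ) y - pairChain p 1 y x)
          - N⁻¹ * ((Pi.single x 1 : Sym2 ι → ℝ) y - pairChain p 1 y x) := by
      intro y; rw [hQf, hfy]; ring
    simp only [e, Finset.sum_sub_distrib, ← Finset.mul_sum, hcol]
    simp [Pi.single_apply]
  have h3 : ∑ y, f y * f y = 1 - N⁻¹ := by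
    have e : ∀ y, f y * f y = (Pi.single x 1 : Sym2 ι → ℝ) y * (1 - N⁻¹) - N⁻¹ * f y := by
      intro y
      rw [hfy, Pi.single_apply]
      split_ifs <;> ring
    simp only [e, Finset.sum_sub_distrib, ← Finset.mul_sum, hsum, ← Finset.sum_mul]
    simp
  rw [h2, h3] at h1
  have h4 : N⁻¹ ≤ 1 / 3 := by rw [inv_le_comm₀ (by linarith) (by norm_num)]; linarith
  have h5 : spectralGap L * (2 / 3) ≤ spectralGap L * (1 - N⁻¹) :=
    mul_le_mul_of_nonneg_left (by linarith) h0
  linarith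

/-- The gap of two independent particles on unordered pairs is comparable to the gap of the
exchange chain. -/
lemma IsSymmStochastic.spectralGap_pair_bounds (hp : IsSymmStochastic p)
    (hL : L.charpoly = (pairChain p 1).charpoly.map (algebraMap ℝ ℂ))
    {V' : Type*} [AddCommGroup V'] [Module ℂ V'] [FiniteDimensional ℂ V'] {L' : Module.End ℂ V'}
    (hL' : L'.charpoly = (pairChain p 0).charpoly.map (algebraMap ℝ ℂ))
    (hι : 2 ≤ Fintype.card ι) :
    1 / 4 * spectralGap L ≤ spectralGap L' ∧ spectralGap L' ≤ 2 * spectralGap L := by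
  have hcard := two_lt_card_sym2 hι
  have hne : Nonempty (Sym2 ι) := Fintype.card_pos_iff.1 (by omega)
  have h0 := hp.spectralGap_nonneg hL hι
  have hw : ∀ x : Sym2 ι, 0 < pairWeight x := fun x => one_pos.trans_le (one_le_pairWeight x)
  have hd : ∀ f : Sym2 ι → ℝ, ∑ x, pairWeight x * f x * (f x - (pairChain p 0 *ᵥ f) x)
      = 1 / 8 * pairEnergy p f := fun f => by simpa only [mul_assoc] using hp.dirichlet_zero f
  have hm : ∀ f g : Sym2 ι → ℝ, ∑ x, pairWeight x * f x * g x
      = ∑ a, ∑ b, f s(a, b) * g s(a, b) := fun f g => by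
    simpa only [mul_assoc] using sum_pairWeight_mul (fun x => f x * g x)
  have hm1 : ∀ f : Sym2 ι → ℝ, ∑ x, pairWeight x * f x * (1 : Sym2 ι → ℝ) x
      = ∑ a, ∑ b, f s(a, b) := fun f => by rw [hm]; simp
  constructor
  · refine le_spectralGap L' (pairChain p 0) pairWeight hw hp.pairChain_zero_symm hL' (by omega) 1
      _ fun f hf => ?_
    rw [hm1] at hf
    rw [hd, hm]
    have h1 := hp.poincare_pair hL hι f hf
    have h2 : 0 ≤ ∑ a, ∑ b, f s(a, b) * f s(a, b) :=
      Finset.sum_nonneg fun _ _ => Finset.sum_nonneg fun _ _ => mul_self_nonneg _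
    have := mul_nonneg h0 h2
    linarith
  · have h1 : 0 ≤ spectralGap L' :=
      le_spectralGap L' (pairChain p 0) pairWeight hw hp.pairChain_zero_symm hL' (by omega) 1
        _ fun f _ => by
          rw [hd, zero_mul]; have := hp.pairEnergy_nonneg f; positivity
    have h2 := hp.le_spectralGap_of_poincare hL hι h1 fun f hf => by
      rw [← hd, ← hm]
      exact _root_.spectralGap_mul_le L' (pairChain p 0) pairWeight hw hp.pairChain_zero_symm hL'
        (by omega) 1 one_ne_zero (hp.pairChain_mulVec_one 0)
        (fun f => by rw [hd]; have := hp.pairEnergy_nonneg f; positivity) f (by rw [hm1, hf])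
    linarith

end Gaps

/-! ### Two distinguishable particles -/

section Ordered

variable {ι : Type*} [Fintype ι] {p : Matrix ι ι ℝ}

/-- A Poincaré inequality for symmetric functions of two particles implies one for a single
particle. -/
lemma poincare_single {g : ℝ}
    (hg : ∀ f : Sym2 ι → ℝ, ∑ a, ∑ b, f s(a, b) = 0 →
      g * ∑ a, ∑ b, f s(a, b) * f s(a, b) ≤ 1 / 8 * pairEnergy p f)
    (h : ι → ℝ) (c : ℝ) (hc : ∑ a, (h a - c) = 0) :
    16 * g * ∑ a, (h a - c) * (h a - c) ≤ ∑ b, ∑ c, p b c * (h b - h c) ^ 2 := by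
  rcases isEmpty_or_nonempty ι with hι | hι
  · simp
  have hd : (0 : ℝ) < Fintype.card ι := by exact_mod_cast Fintype.card_pos
  set k : ι → ℝ := fun a => h a - c
  -- A centred function of one particle is tested as the symmetric sum `k a + k b`. Cross terms
  -- vanish, so the norm is `2d` times and the energy `d` times that of one particle; with the 1/8
  -- this produces the factor 16.
  let f : Sym2 ι → ℝ := Sym2.lift ⟨fun a b => k a + k b, fun a b => add_comm _ _⟩
  have hf : ∀ a b, f s(a, b) = k a + k b := fun a b => rfl
  have h1 := hg f (by
    simp only [hf, Finset.sum_add_distrib, hc, Finset.sum_const, smul_zero, add_zero,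
      ← Finset.smul_sum])
  have e1 : ∑ a, ∑ b, f s(a, b) * f s(a, b) = 2 * Fintype.card ι * ∑ a, k a * k a := by
    have e : ∀ a b, f s(a, b) * f s(a, b) = k a * k a + k b * k b + 2 * k a * k b := by
      intro a b; rw [hf]; ring
    simp only [e, Finset.sum_add_distrib, ← Finset.mul_sum, hc, mul_zero, add_zero,
      Finset.sum_const, Finset.card_univ, nsmul_eq_mul]
    simp only [mul_left_comm _ (Fintype.card ι : ℝ), ← Finset.mul_sum]
    ring
  have e2 : pairEnergy p f = Fintype.card ι * ∑ b, ∑ c, p b c * (h b - h c) ^ 2 := by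
    simp only [pairEnergy, hf, k, add_sub_add_left_eq_sub, sub_sub_sub_cancel_right,
      Finset.sum_const, Finset.card_univ, nsmul_eq_mul]
  rw [e1, e2] at h1
  refine le_of_mul_le_mul_left ?_ hd
  linarith

/-- The Poincaré inequality for two distinguishable particles. -/
lemma poincare_ordered {g : ℝ} (hg0 : 0 ≤ g)
    (hg : ∀ f : Sym2 ι → ℝ, ∑ a, ∑ b, f s(a, b) = 0 →
      g * ∑ a, ∑ b, f s(a, b) * f s(a, b) ≤ 1 / 8 * pairEnergy p f)
    (F : ι → ι → ℝ) (hF : ∑ a, ∑ b, F a b = 0) :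
    g * ∑ a, ∑ b, F a b * F a b ≤ 1 / 16 * (∑ a, ∑ b, ∑ c, p b c * (F a b - F a c) ^ 2
      + ∑ b, ∑ a, ∑ c, p a c * (F a b - F c b) ^ 2) := by
  rcases isEmpty_or_nonempty ι with hι | hι
  · simp
  set d : ℝ := (Fintype.card ι : ℝ) with hd
  have hd0 : d ≠ 0 := by rw [hd]; exact_mod_cast Fintype.card_ne_zero
  set m : ι → ℝ := fun a => (∑ b, F a b) / d
  set k : ι → ℝ := fun b => (∑ a, F a b) / d
  have hm : ∀ a, ∑ b, F a b = d * m a := fun a => by simp only [m]; field_simp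
  have hk : ∀ b, ∑ a, F a b = d * k b := fun a => by simp only [k]; field_simp
  have hm0 : ∑ a, m a = 0 := by
    simp only [m, ← Finset.sum_div, hF, zero_div]
  have hk0 : ∑ b, k b = 0 := by
    rw [Finset.sum_comm] at hF
    simp only [k, ← Finset.sum_div, hF, zero_div]
  -- The one-particle inequality is applied in each row and each column, about its own mean.
  have h1 : 16 * g * ∑ a, ∑ b, (F a b - m a) * (F a b - m a)
      ≤ ∑ a, ∑ b, ∑ c, p b c * (F a b - F a c) ^ 2 := by
    rw [Finset.mul_sum]
    refine Finset.sum_le_sum fun a _ => poincare_single hg (F a) (m a) ?_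
    rw [Finset.sum_sub_distrib, hm, Finset.sum_const, Finset.card_univ, nsmul_eq_mul, ← hd,
      sub_self]
  have h2 : 16 * g * ∑ b, ∑ a, (F a b - k b) * (F a b - k b)
      ≤ ∑ b, ∑ a, ∑ c, p a c * (F a b - F c b) ^ 2 := by
    rw [Finset.mul_sum]
    refine Finset.sum_le_sum fun b _ => poincare_single hg (fun a => F a b) (k b) ?_
    rw [Finset.sum_sub_distrib, hk, Finset.sum_const, Finset.card_univ, nsmul_eq_mul, ← hd,
      sub_self]
  have e1 : ∑ a, ∑ b, (F a b - m a) * (F a b - m a)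
      = ∑ a, ∑ b, F a b * F a b - d * ∑ a, m a * m a := by
    rw [Finset.mul_sum, ← Finset.sum_sub_distrib]
    refine Finset.sum_congr rfl fun a _ => ?_
    have e : ∀ b, (F a b - m a) * (F a b - m a) = F a b * F a b - 2 * m a * F a b + m a * m a := by
      intro b; ring
    simp only [e, Finset.sum_add_distrib, Finset.sum_sub_distrib, ← Finset.mul_sum, hm,
      Finset.sum_const, Finset.card_univ, nsmul_eq_mul, ← hd]
    ring
  have e2 : ∑ b, ∑ a, (F a b - k b) * (F a b - k b)
      = ∑ a, ∑ b, F a b * F a b - d * ∑ b, k b * k b := by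
    rw [Finset.mul_sum, Finset.sum_comm (f := fun a b => F a b * F a b),
      ← Finset.sum_sub_distrib]
    refine Finset.sum_congr rfl fun b _ => ?_
    have e : ∀ a, (F a b - k b) * (F a b - k b) = F a b * F a b - 2 * k b * F a b + k b * k b := by
      intro a; ring
    simp only [e, Finset.sum_add_distrib, Finset.sum_sub_distrib, ← Finset.mul_sum, hk,
      Finset.sum_const, Finset.card_univ, nsmul_eq_mul, ← hd]
    ring
  -- The part of `F` orthogonal to functions of one variable has nonnegative norm. So the row and
  -- column variances together are at least the full norm of `F`.
  have e3 : ∑ a, ∑ b, (F a b - m a - k b) * (F a b - m a - k b)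
      = ∑ a, ∑ b, F a b * F a b - d * ∑ a, m a * m a - d * ∑ b, k b * k b := by
    have e : ∀ a b, (F a b - m a - k b) * (F a b - m a - k b)
        = (F a b - m a) * (F a b - m a) - 2 * (k b * F a b) + 2 * (m a * k b) + k b * k b := by
      intro a b; ring
    have e4 : ∑ a, ∑ b, k b * F a b = d * ∑ b, k b * k b := by
      rw [Finset.sum_comm, Finset.mul_sum]
      exact Finset.sum_congr rfl fun b _ => by rw [← Finset.mul_sum, hk]; ring
    simp only [e, Finset.sum_add_distrib, Finset.sum_sub_distrib, e1, ← Finset.mul_sum, e4, hk0,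
      mul_zero, Finset.sum_const, Finset.card_univ, nsmul_eq_mul, ← hd]
    ring
  have h3 : 0 ≤ ∑ a, ∑ b, (F a b - m a - k b) * (F a b - m a - k b) :=
    Finset.sum_nonneg fun _ _ => Finset.sum_nonneg fun _ _ => mul_self_nonneg _
  rw [e1] at h1
  rw [e2] at h2
  rw [e3] at h3
  have h4 := mul_nonneg hg0 h3
  linarith

end Ordered

/-! ### The action of the moment operators on matched indices -/

section Action

variable {ι : Type*} [Fintype ι] [DecidableEq ι]

/-- The kets and the bras of the index agree as unordered pairs. -/
def IsMatched (x : Idx4 ι) : Prop :=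
  (x.1 = x.2.2.1 ∧ x.2.1 = x.2.2.2) ∨ (x.1 = x.2.2.2 ∧ x.2.1 = x.2.2.1)

instance : DecidablePred (IsMatched (ι := ι)) := fun _ => inferInstanceAs (Decidable (_ ∨ _))

/-- The projection onto the matched indices. -/
def matchedProj (ι : Type*) [Fintype ι] [DecidableEq ι] : Matrix (Idx4 ι) (Idx4 ι) ℂ :=
  diagonal fun x => if IsMatched x then 1 else 0

lemma matchedProj_mulVec (u : Idx4 ι → ℂ) (x : Idx4 ι) :
    (matchedProj ι *ᵥ u) x = if IsMatched x then u x else 0 := by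
  simp [matchedProj, mulVec_diagonal]

omit [DecidableEq ι] in
lemma tensor4_mulVec (A B C D : Matrix ι ι ℂ) (u : Idx4 ι → ℂ) (a c b d : ι) :
    (tensor4 A B C D *ᵥ u) (a, c, b, d) = ∑ a', ∑ c', ∑ b', ∑ d',
      A a a' * (B c c' * (C b b' * D d d')) * u (a', c', b', d') := by
  simp only [mulVec, dotProduct, Fintype.sum_prod_type, tensor4, kroneckerMap_apply]

/-- The vector vanishes at the unmatched indices. -/
def MatchedSupport (u : Idx4 ι → ℂ) : Prop := ∀ x, ¬ IsMatched x → u x = 0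

variable {u : Idx4 ι → ℂ} (hu : MatchedSupport u) (τ : Matrix ι ι ℂ)
include hu

/-- In this lemma and the following ones the digits are the tensor factors on which `τ` acts, and
`diag` and `cross` refer to the target indices `(a, c, a, c)` and `(a, c, c, a)`. Matched support
removes all but the listed summands: moving one ket with its paired bra gives squares of entries,
moving it with the other bra leaves a product of two diagonal entries. -/
lemma tensor4_24_diag (a c : ι) : (tensor4 1 τ 1 τ *ᵥ u) (a, c, a, c)
    = ∑ x, τ c x ^ 2 * u (a, x, a, x) := by
  rw [tensor4_mulVec]
  simp only [one_apply, ite_mul, one_mul, zero_mul, mul_ite, mul_zero, Finset.sum_ite_irrel,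
    Finset.sum_const_zero, Finset.sum_ite_eq, Finset.mem_univ, if_true]
  refine Finset.sum_congr rfl fun x _ => ?_
  rw [Finset.sum_eq_single x]
  · ring
  · intro y _ hy
    rw [hu (a, x, a, y), mul_zero]
    rintro (⟨-, h⟩ | ⟨h1, h2⟩)
    · exact hy h.symm
    · exact hy (h1.symm.trans h2.symm)
  · simp

lemma tensor4_24_cross {a c : ι} (h : a ≠ c) : (tensor4 1 τ 1 τ *ᵥ u) (a, c, c, a)
    = τ a a * τ c c * u (a, c, c, a) := by
  rw [tensor4_mulVec]
  simp only [one_apply, ite_mul, one_mul, zero_mul, mul_ite, mul_zero, Finset.sum_ite_irrel,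
    Finset.sum_const_zero, Finset.sum_ite_eq, Finset.mem_univ, if_true]
  rw [Finset.sum_eq_single c, Finset.sum_eq_single a]
  · ring
  · intro y _ hy
    rw [hu (a, c, c, y), mul_zero]
    rintro (⟨h1, -⟩ | ⟨h1, -⟩)
    · exact h h1
    · exact hy h1.symm
  · simp
  · intro x _ hx
    refine Finset.sum_eq_zero fun y _ => ?_
    rw [hu (a, x, c, y), mul_zero]
    rintro (⟨h1, -⟩ | ⟨-, h1⟩)
    · exact h h1
    · exact hx h1
  · simp

lemma tensor4_13_diag (a c : ι) : (tensor4 τ 1 τ 1 *ᵥ u) (a, c, a, c)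
    = ∑ x, τ a x ^ 2 * u (x, c, x, c) := by
  rw [tensor4_mulVec]
  simp only [one_apply, ite_mul, one_mul, zero_mul, mul_ite, mul_zero, Finset.sum_ite_irrel,
    Finset.sum_const_zero, Finset.sum_ite_eq, Finset.mem_univ, if_true, mul_one]
  refine Finset.sum_congr rfl fun x _ => ?_
  rw [Finset.sum_eq_single x]
  · ring
  · intro y _ hy
    rw [hu (x, c, y, c), mul_zero]
    rintro (⟨h, -⟩ | ⟨h1, h2⟩)
    · exact hy h.symm
    · exact hy (h2.symm.trans h1.symm)
  · simp

lemma tensor4_13_cross {a c : ι} (h : a ≠ c) : (tensor4 τ 1 τ 1 *ᵥ u) (a, c, c, a)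
    = τ a a * τ c c * u (a, c, c, a) := by
  rw [tensor4_mulVec]
  simp only [one_apply, ite_mul, one_mul, zero_mul, mul_ite, mul_zero, Finset.sum_ite_irrel,
    Finset.sum_const_zero, Finset.sum_ite_eq, Finset.mem_univ, if_true, mul_one]
  rw [Finset.sum_eq_single a, Finset.sum_eq_single c]
  · intro y _ hy
    rw [hu (a, c, y, a), mul_zero]
    rintro (⟨-, h1⟩ | ⟨-, h1⟩)
    · exact h h1.symm
    · exact hy h1.symm
  · simp
  · intro x _ hx
    refine Finset.sum_eq_zero fun y _ => ?_
    rw [hu (x, c, y, a), mul_zero]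
    rintro (⟨-, h1⟩ | ⟨h1, -⟩)
    · exact h h1.symm
    · exact hx h1
  · simp

lemma tensor4_14_cross (a c : ι) : (tensor4 τ 1 1 τ *ᵥ u) (a, c, c, a)
    = ∑ x, τ a x ^ 2 * u (x, c, c, x) := by
  rw [tensor4_mulVec]
  simp only [one_apply, ite_mul, one_mul, zero_mul, mul_ite, mul_zero, Finset.sum_ite_irrel,
    Finset.sum_const_zero, Finset.sum_ite_eq, Finset.mem_univ, if_true]
  refine Finset.sum_congr rfl fun x _ => ?_
  rw [Finset.sum_eq_single x]
  · ring
  · intro y _ hy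
    rw [hu (x, c, c, y), mul_zero]
    rintro (⟨h1, h2⟩ | ⟨h1, -⟩)
    · exact hy (h2.symm.trans h1.symm)
    · exact hy h1.symm
  · simp

lemma tensor4_14_diag {a c : ι} (h : a ≠ c) : (tensor4 τ 1 1 τ *ᵥ u) (a, c, a, c)
    = τ a a * τ c c * u (a, c, a, c) := by
  rw [tensor4_mulVec]
  simp only [one_apply, ite_mul, one_mul, zero_mul, mul_ite, mul_zero, Finset.sum_ite_irrel,
    Finset.sum_const_zero, Finset.sum_ite_eq, Finset.mem_univ, if_true]
  rw [Finset.sum_eq_single a, Finset.sum_eq_single c]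
  · intro y _ hy
    rw [hu (a, c, a, y), mul_zero]
    rintro (⟨-, h1⟩ | ⟨-, h1⟩)
    · exact hy h1.symm
    · exact h h1.symm
  · simp
  · intro x _ hx
    refine Finset.sum_eq_zero fun y _ => ?_
    rw [hu (x, c, a, y), mul_zero]
    rintro (⟨h1, -⟩ | ⟨-, h1⟩)
    · exact hx h1
    · exact h h1.symm
  · simp

lemma tensor4_23_cross (a c : ι) : (tensor4 1 τ τ 1 *ᵥ u) (a, c, c, a)
    = ∑ x, τ c x ^ 2 * u (a, x, x, a) := by
  rw [tensor4_mulVec]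
  simp only [one_apply, ite_mul, one_mul, zero_mul, mul_ite, mul_zero, Finset.sum_ite_irrel,
    Finset.sum_const_zero, Finset.sum_ite_eq, Finset.mem_univ, if_true, mul_one]
  refine Finset.sum_congr rfl fun x _ => ?_
  rw [Finset.sum_eq_single x]
  · ring
  · intro y _ hy
    rw [hu (a, x, y, a), mul_zero]
    rintro (⟨h1, h2⟩ | ⟨-, h1⟩)
    · exact hy (h1.symm.trans h2.symm)
    · exact hy h1.symm
  · simp

lemma tensor4_23_diag {a c : ι} (h : a ≠ c) : (tensor4 1 τ τ 1 *ᵥ u) (a, c, a, c)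
    = τ a a * τ c c * u (a, c, a, c) := by
  rw [tensor4_mulVec]
  simp only [one_apply, ite_mul, one_mul, zero_mul, mul_ite, mul_zero, Finset.sum_ite_irrel,
    Finset.sum_const_zero, Finset.sum_ite_eq, Finset.mem_univ, if_true, mul_one]
  rw [Finset.sum_eq_single c, Finset.sum_eq_single a]
  · ring
  · intro y _ hy
    rw [hu (a, c, y, c), mul_zero]
    rintro (⟨h1, -⟩ | ⟨h1, -⟩)
    · exact hy h1.symm
    · exact h h1
  · simp
  · intro x _ hx
    refine Finset.sum_eq_zero fun y _ => ?_
    rw [hu (a, x, y, c), mul_zero]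
    rintro (⟨-, h1⟩ | ⟨h1, -⟩)
    · exact hx h1
    · exact h h1
  · simp

lemma tensor4_34_same (a : ι) : (tensor4 1 1 τ τ *ᵥ u) (a, a, a, a)
    = τ a a ^ 2 * u (a, a, a, a) := by
  rw [tensor4_mulVec]
  simp only [one_apply, ite_mul, one_mul, zero_mul, mul_ite, mul_zero, Finset.sum_ite_irrel,
    Finset.sum_const_zero, Finset.sum_ite_eq, Finset.mem_univ, if_true]
  rw [Finset.sum_eq_single a, Finset.sum_eq_single a]
  · ring
  · intro y _ hy
    rw [hu (a, a, a, y), mul_zero]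
    rintro (⟨-, h1⟩ | ⟨h1, -⟩) <;> exact hy h1.symm
  · simp
  · intro x _ hx
    refine Finset.sum_eq_zero fun y _ => ?_
    rw [hu (a, a, x, y), mul_zero]
    rintro (⟨h1, -⟩ | ⟨-, h1⟩) <;> exact hx h1.symm
  · simp

lemma tensor4_12_same (a : ι) : (tensor4 τ τ 1 1 *ᵥ u) (a, a, a, a)
    = τ a a ^ 2 * u (a, a, a, a) := by
  rw [tensor4_mulVec]
  simp only [one_apply, ite_mul, zero_mul, mul_ite, mul_zero, Finset.sum_ite_eq,
    Finset.mem_univ, if_true, mul_one]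
  rw [Finset.sum_eq_single a, Finset.sum_eq_single a]
  · ring
  · intro y _ hy
    rw [hu (a, y, a, a), mul_zero]
    rintro (⟨-, h1⟩ | ⟨-, h1⟩) <;> exact hy h1
  · simp
  · intro x _ hx
    refine Finset.sum_eq_zero fun y _ => ?_
    rw [hu (x, y, a, a), mul_zero]
    rintro (⟨h1, -⟩ | ⟨h1, -⟩) <;> exact hx h1
  · simp

lemma tensor4_34_pair {a c : ι} (h : a ≠ c) (b d : ι) : (tensor4 1 1 τ τ *ᵥ u) (a, c, b, d)
    = τ b a * τ d c * u (a, c, a, c) + τ b c * τ d a * u (a, c, c, a) := by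
  rw [tensor4_mulVec]
  simp only [one_apply, ite_mul, one_mul, zero_mul, mul_ite, mul_zero, Finset.sum_ite_irrel,
    Finset.sum_const_zero, Finset.sum_ite_eq, Finset.mem_univ, if_true]
  rw [Fintype.sum_eq_add a c h, Finset.sum_eq_single c, Finset.sum_eq_single a]
  · intro y _ hy
    rw [hu (a, c, c, y), mul_zero]
    rintro (⟨h1, -⟩ | ⟨h1, -⟩)
    · exact h h1
    · exact hy h1.symm
  · simp
  · intro y _ hy
    rw [hu (a, c, a, y), mul_zero]
    rintro (⟨-, h1⟩ | ⟨-, h1⟩)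
    · exact hy h1.symm
    · exact h h1.symm
  · simp
  · rintro x ⟨hx, hx'⟩
    refine Finset.sum_eq_zero fun y _ => ?_
    rw [hu (a, c, x, y), mul_zero]
    rintro (⟨h1, -⟩ | ⟨-, h1⟩)
    · exact hx h1.symm
    · exact hx' h1.symm

lemma tensor4_12_pair {b d : ι} (h : b ≠ d) (a c : ι) : (tensor4 τ τ 1 1 *ᵥ u) (a, c, b, d)
    = τ a b * τ c d * u (b, d, b, d) + τ a d * τ c b * u (d, b, b, d) := by
  rw [tensor4_mulVec]
  simp only [one_apply, ite_mul, zero_mul, mul_ite, mul_zero, Finset.sum_ite_eq,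
    Finset.mem_univ, if_true, mul_one]
  rw [Fintype.sum_eq_add b d h, Finset.sum_eq_single d, Finset.sum_eq_single b]
  · intro y _ hy
    rw [hu (d, y, b, d), mul_zero]
    rintro (⟨h1, -⟩ | ⟨-, h1⟩)
    · exact h h1.symm
    · exact hy h1
  · simp
  · intro y _ hy
    rw [hu (b, y, b, d), mul_zero]
    rintro (⟨-, h1⟩ | ⟨h1, -⟩)
    · exact hy h1
    · exact h h1
  · simp
  · rintro x ⟨hx, hx'⟩
    refine Finset.sum_eq_zero fun y _ => ?_
    rw [hu (x, y, b, d), mul_zero]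
    rintro (⟨h1, -⟩ | ⟨h1, -⟩)
    · exact hx h1
    · exact hx' h1

omit hu in
lemma tensor4_one (x : Idx4 ι) : (tensor4 1 1 1 1 *ᵥ u) x = u x := by
  simp only [tensor4, one_kronecker_one, one_mulVec]

end Action

/-! ### The moment operators as Markov chains -/

section Moment

variable {ι : Type*} [Fintype ι] [DecidableEq ι]

/-- The transition probabilities of an orthogonal matrix. -/
def sqEntries (t : Matrix ι ι ℝ) : Matrix ι ι ℝ := Matrix.of fun a b => t a b ^ 2

/-- `1` for `a = c` and `1 / 2` otherwise. -/
def pairNorm (a c : ι) : ℝ := if a = c then 1 else 1 / 2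

lemma pairNorm_mul_pairWeight (a c : ι) : pairNorm a c * pairWeight s(a, c) = 1 := by
  have h := pairWeight_add_diag s(a, c)
  rw [pairNorm]
  split_ifs with hac
  · subst hac
    have h2 : (Finset.univ.filter fun b : ι => s(b, b) = s(a, a)) = {a} := by
      ext c; simp
    rw [h2] at h
    norm_num at h
    linarith
  · have h2 : (Finset.univ.filter fun b : ι => s(b, b) = s(a, c)) = ∅ := by
      ext b
      simp only [Sym2.eq_iff, Finset.mem_filter, Finset.mem_univ, true_and, Finset.notMem_empty,
        iff_false]
      rintro (⟨rfl, h3⟩ | ⟨rfl, h3⟩) <;> exact hac (by simp [h3])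
    rw [h2] at h
    norm_num at h
    linarith

/-- The combination of the vectors `plusState` with the given coefficients. -/
def plusVec (g : Sym2 ι → ℝ) : Idx4 ι → ℂ := fun x =>
  if IsMatched x then ((pairNorm x.1 x.2.1 * g s(x.1, x.2.1) : ℝ) : ℂ) else 0

/-- The combination of the vectors `symState` with the given coefficients, up to normalization. -/
def symVec (g : Sym2 ι → ℝ) : Idx4 ι → ℂ := fun x =>
  if x.1 = x.2.2.1 ∧ x.2.1 = x.2.2.2 then ((g s(x.1, x.2.1) : ℝ) : ℂ) else 0

omit [Fintype ι] in
lemma plusVec_matchedSupport (g : Sym2 ι → ℝ) : MatchedSupport (plusVec g) := fun _ hx => if_neg hx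

omit [Fintype ι] in
lemma symVec_matchedSupport (g : Sym2 ι → ℝ) : MatchedSupport (symVec g) :=
  fun _ hx => if_neg fun h => hx (Or.inl h)

omit [Fintype ι] in
lemma plusVec_diag (g : Sym2 ι → ℝ) (a c : ι) :
    plusVec g (a, c, a, c) = ((pairNorm a c * g s(a, c) : ℝ) : ℂ) := by
  simp [plusVec, IsMatched]

omit [Fintype ι] in
lemma plusVec_cross (g : Sym2 ι → ℝ) (a c : ι) :
    plusVec g (a, c, c, a) = ((pairNorm a c * g s(a, c) : ℝ) : ℂ) := by
  simp [plusVec, IsMatched]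

omit [Fintype ι] in
lemma symVec_diag (g : Sym2 ι → ℝ) (a c : ι) : symVec g (a, c, a, c) = (g s(a, c) : ℂ) := by
  simp [symVec]

omit [Fintype ι] in
lemma symVec_cross (g : Sym2 ι → ℝ) {a c : ι} (h : a ≠ c) : symVec g (a, c, c, a) = 0 := by
  simp [symVec, h]

omit [Fintype ι] in
lemma plusState_eq (z : Sym2 ι) : plusState z = plusVec (Pi.single z 1) := by
  induction z using Sym2.ind with
  | _ a b =>
  ext ⟨p, q, r, s⟩
  rw [plusState, Sym2.lift_mk]
  simp only [plusVec, IsMatched, pairNorm, unitTensor, Pi.single_apply]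
  by_cases hab : a = b
  · subst hab
    simp only [if_true, Pi.single_apply, Prod.mk.injEq, Sym2.eq_iff]
    by_cases hp : p = a <;> by_cases hq : q = a <;> by_cases hr : r = a <;> by_cases hs : s = a <;>
      simp_all [eq_comm]
  · simp only [if_neg hab, Pi.smul_apply, Pi.add_apply, Pi.single_apply, Prod.mk.injEq,
      Sym2.eq_iff, smul_eq_mul]
    by_cases hm : (p = r ∧ q = s) ∨ (p = s ∧ q = r)
    · rw [if_pos hm]
      have hba : ¬ b = a := fun h => hab h.symm
      rcases hm with ⟨rfl, rfl⟩ | ⟨rfl, rfl⟩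
      · by_cases h1 : p = a
        · subst h1
          by_cases h2 : q = b
          · subst h2; simp [hab, hba]
          · simp [hab, h2]
        · by_cases h2 : p = b
          · subst h2
            by_cases h3 : q = a
            · subst h3; simp [hab, hba]
            · simp [h1, h3]
          · simp [h1, h2]
      · by_cases h1 : p = a
        · subst h1
          by_cases h2 : q = b
          · subst h2; simp [hab, hba]
          · simp [hab, h2]
        · by_cases h2 : p = b
          · subst h2
            by_cases h3 : q = a
            · subst h3; simp [hab, hba]
            · simp [h1, h3]
          · simp [h1, h2]
    · rw [if_neg hm, if_neg, if_neg, if_neg, if_neg]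
      · simp
      all_goals
        rintro ⟨rfl, rfl, rfl, rfl⟩
        exact hm (by simp)

omit [Fintype ι] in
lemma symState_mk_eq (a b : ι) : symState s(a, b) = symVec (pairNorm a b • Pi.single s(a, b) 1) := by
  ext ⟨p, q, r, s⟩
  rw [symState, Sym2.lift_mk]
  simp only [symVec, pairNorm, unitTensor, Pi.single_apply, Pi.smul_apply, Pi.add_apply,
    Prod.mk.injEq, Sym2.eq_iff, smul_eq_mul]
  by_cases hm : p = r ∧ q = s
  · rw [if_pos hm]
    obtain ⟨rfl, rfl⟩ := hm
    by_cases hab : a = b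
    · subst hab
      by_cases h1 : p = a <;> by_cases h2 : q = a <;> simp_all
      norm_num
    · have hba : ¬ b = a := fun h => hab h.symm
      by_cases h1 : p = a
      · subst h1
        by_cases h2 : q = b
        · subst h2; simp [hab, hba]
        · simp [hab, h2]
      · by_cases h2 : p = b
        · subst h2
          by_cases h3 : q = a
          · subst h3; simp [hab, hba]
          · simp [h1, h3, hab]
        · simp [h1, h2]
  · rw [if_neg hm, if_neg, if_neg]
    · simp
    all_goals
      rintro ⟨rfl, rfl, rfl, rfl⟩
      exact hm (by simp)

lemma sum_smul_plusState (g : Sym2 ι → ℝ) : ∑ z, (g z : ℂ) • plusState z = plusVec g := by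
  ext x
  simp only [plusState_eq, Finset.sum_apply, Pi.smul_apply, smul_eq_mul, plusVec]
  split_ifs with h
  · rw [Finset.sum_eq_single s(x.1, x.2.1)]
    · simp [mul_comm]
    · intro z _ hz
      simp [hz.symm]
    · simp
  · simp

lemma sum_smul_symState (g : Sym2 ι → ℝ) :
    ∑ z, (g z : ℂ) • symState z = symVec fun z => g z / pairWeight z := by
  ext x
  have h : ∀ z : Sym2 ι, symState z x = symVec (fun y => (Pi.single z 1 : Sym2 ι → ℝ) y
      / pairWeight y) x := by
    intro z
    induction z using Sym2.ind with
    | _ a b =>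
    rw [symState_mk_eq]
    congr 2
    ext y
    by_cases hy : y = s(a, b)
    · subst hy
      have := pairNorm_mul_pairWeight a b
      have h0 : pairWeight s(a, b) ≠ 0 := fun h0 => by simp [h0] at this
      simp only [Pi.smul_apply, Pi.single_eq_same, smul_eq_mul, mul_one]
      rw [eq_div_iff h0, this]
    · simp [hy]
  simp only [Finset.sum_apply, Pi.smul_apply, smul_eq_mul, h, symVec]
  split_ifs with h
  · rw [Finset.sum_eq_single s(x.1, x.2.1)]
    · simp [div_eq_mul_inv]
    · intro z _ hz
      simp [hz.symm]
    · simp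
  · simp

lemma modifiedSwap_mulVec (τ : Matrix ι ι ℂ) (u : Idx4 ι → ℂ) (x : Idx4 ι) :
    (modifiedSwap τ *ᵥ u) x = 1 / 8 * (6 * u x + (tensor4 1 τ 1 τ *ᵥ u) x
      + (tensor4 τ 1 τ 1 *ᵥ u) x + (tensor4 τ 1 1 τ *ᵥ u) x + (tensor4 1 τ τ 1 *ᵥ u) x
      - (tensor4 1 1 τ τ *ᵥ u) x - (tensor4 τ τ 1 1 *ᵥ u) x) := by
  simp only [modifiedSwap, smul_mulVec, add_mulVec, sub_mulVec, Pi.smul_apply, Pi.add_apply,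
    Pi.sub_apply, tensor4_one, smul_eq_mul]

lemma cayleySwap_mulVec (τ : Matrix ι ι ℂ) (u : Idx4 ι → ℂ) (x : Idx4 ι) :
    (cayleySwap τ *ᵥ u) x = 1 / 8 * (6 * u x + (tensor4 τ 1 τ 1 *ᵥ u) x
      + (tensor4 1 τ 1 τ *ᵥ u) x) := by
  simp only [cayleySwap, smul_mulVec, add_mulVec, Pi.smul_apply, Pi.add_apply,
    tensor4_one, smul_eq_mul]

omit [Fintype ι] in
lemma pairNorm_comm (a c : ι) : pairNorm a c = pairNorm c a := by
  simp only [pairNorm, eq_comm]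

/-- A diagonal pair carries the norm 1 instead of 1/2. The surplus is the gain `p a b * f s(a, a)`
in the exchange correction. -/
lemma sum_mul_pairNorm (r : ι → ℝ) (g : Sym2 ι → ℝ) (a : ι) :
    ∑ x, r x * (pairNorm a x * g s(a, x)) = 1 / 2 * (∑ x, r x * g s(a, x) + r a * g s(a, a)) := by
  have e : ∀ x, r x * (pairNorm a x * g s(a, x))
      = 1 / 2 * (r x * g s(a, x)) + if a = x then 1 / 2 * (r x * g s(a, x)) else 0 := by
    intro x
    rw [pairNorm]
    split_ifs <;> ring
  simp only [e, Finset.sum_add_distrib, Finset.sum_ite_eq, Finset.mem_univ, if_true,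
    ← Finset.mul_sum]
  ring

/-- At `a ≠ c`, two of the four mixed terms each give `t a a * t c c`, while each negative term
removes `t a a * t c c + t a c ^ 2`. The products cancel and `-2 t a c ^ 2` remains, which is the
loss in the exchange correction. At `a = c` the negative terms cancel the surplus from
`sum_mul_pairNorm`. -/
lemma modifiedSwap_mulVec_plusVec {t : Matrix ι ι ℝ} (ht : ∀ a b, t a b = t b a)
    (g : Sym2 ι → ℝ) (x : Idx4 ι) (hx : IsMatched x) :
    (modifiedSwap (t.map Complex.ofReal) *ᵥ plusVec g) x
      = plusVec (pairChain (sqEntries t) 1 *ᵥ g) x := by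
  have hu := plusVec_matchedSupport g
  have hs : ∀ a b, sqEntries t a b = sqEntries t b a := fun a b => by simp [sqEntries, ht a b]
  have hsum : ∀ a c : ι, (∑ x, (t.map Complex.ofReal) c x ^ 2
      * ((pairNorm a x * g s(a, x) : ℝ) : ℂ) : ℂ)
      = ((1 / 2 * (∑ x, sqEntries t c x * g s(a, x) + sqEntries t c a * g s(a, a)) : ℝ) : ℂ) := by
    intro a c
    rw [← sum_mul_pairNorm]
    push_cast [sqEntries, of_apply, map_apply]
    rfl
  have hsum' : ∀ a c : ι, (∑ x, (t.map Complex.ofReal) a x ^ 2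
      * ((pairNorm x c * g s(x, c) : ℝ) : ℂ) : ℂ)
      = ((1 / 2 * (∑ x, sqEntries t a x * g s(c, x) + sqEntries t a c * g s(c, c)) : ℝ) : ℂ) := by
    intro a c
    rw [← hsum]
    exact Finset.sum_congr rfl fun x _ => by rw [pairNorm_comm, Sym2.eq_swap]
  obtain ⟨a, c, b, d⟩ := x
  by_cases hac : a = c
  · subst hac
    obtain ⟨rfl, rfl⟩ : a = b ∧ a = d := by
      rcases hx with ⟨h1, h2⟩ | ⟨h1, h2⟩ <;> exact ⟨by assumption, by assumption⟩
    rw [modifiedSwap_mulVec, tensor4_24_diag hu, tensor4_13_diag hu, tensor4_14_cross hu,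
      tensor4_23_cross hu, tensor4_34_same hu, tensor4_12_same hu]
    simp only [plusVec_diag, plusVec_cross, hsum, hsum', pairChain_mulVec hs]
    simp only [pairNorm, if_true, map_apply, sqEntries, of_apply]
    push_cast
    ring
  · have hn : pairNorm a c = 1 / 2 := if_neg hac
    rcases hx with ⟨h1, h2⟩ | ⟨h1, h2⟩
    · simp only at h1 h2
      subst h1 h2
      rw [modifiedSwap_mulVec, tensor4_24_diag hu, tensor4_13_diag hu, tensor4_14_diag hu _ hac,
        tensor4_23_diag hu _ hac, tensor4_34_pair hu _ hac, tensor4_12_pair hu _ hac]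
      simp only [plusVec_diag, plusVec_cross, hsum, hsum', pairChain_mulVec hs]
      simp only [pairNorm_comm c a, hn, map_apply, ht c a, sqEntries, of_apply,
        show s(c, a) = s(a, c) from Sym2.eq_swap]
      push_cast
      ring
    · simp only at h1 h2
      subst h1 h2
      rw [modifiedSwap_mulVec, tensor4_24_cross hu _ hac, tensor4_13_cross hu _ hac,
        tensor4_14_cross hu, tensor4_23_cross hu, tensor4_34_pair hu _ hac,
        tensor4_12_pair hu _ (Ne.symm hac)]
      simp only [plusVec_diag, plusVec_cross, hsum, hsum', pairChain_mulVec hs]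
      simp only [pairNorm_comm c a, hn, map_apply, ht c a, sqEntries, of_apply,
        show s(c, a) = s(a, c) from Sym2.eq_swap]
      push_cast
      ring

/-- A diagonal index moves only to diagonal indices, and at a cross index the operator is a multiple
of the entry there, which is zero for `symVec`. -/
lemma cayleySwap_mulVec_symVec {t : Matrix ι ι ℝ} (ht : ∀ a b, t a b = t b a)
    (g : Sym2 ι → ℝ) (x : Idx4 ι) (hx : IsMatched x) :
    (cayleySwap (t.map Complex.ofReal) *ᵥ symVec g) x
      = symVec (pairChain (sqEntries t) 0 *ᵥ g) x := by
  have hu := symVec_matchedSupport g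
  have hs : ∀ a b, sqEntries t a b = sqEntries t b a := fun a b => by simp [sqEntries, ht a b]
  obtain ⟨a, c, b, d⟩ := x
  by_cases h : a = b ∧ c = d
  · obtain ⟨rfl, rfl⟩ := h
    rw [cayleySwap_mulVec, tensor4_24_diag hu, tensor4_13_diag hu]
    simp only [symVec_diag, pairChain_mulVec hs, show ∀ x, s(x, c) = s(c, x) from
      fun x => Sym2.eq_swap]
    simp only [sqEntries, of_apply, map_apply]
    push_cast
    ring
  · rcases hx with hx | ⟨h1, h2⟩
    · exact absurd hx h
    · simp only at h1 h2
      subst h1 h2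
      have hac : a ≠ c := fun hac => h ⟨hac, hac.symm⟩
      rw [cayleySwap_mulVec, tensor4_24_cross hu _ hac, tensor4_13_cross hu _ hac,
        symVec_cross _ hac, symVec_cross _ hac]
      ring

end Moment

/-! ### Averages over the swaps -/

section Average

variable {ι : Type*} [Fintype ι] [DecidableEq ι] {J : Type*} [Fintype J]

/-- The average transition probabilities of a family of orthogonal matrices. -/
def hopping (t : J → Matrix ι ι ℝ) : Matrix ι ι ℝ :=
  Matrix.of fun a b => 1 / (Fintype.card J : ℝ) * ∑ j, t j a b ^ 2

/-- The average product of two diagonal entries of a family of matrices. -/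
def diagOverlap (t : J → Matrix ι ι ℝ) (a c : ι) : ℝ :=
  1 / (Fintype.card J : ℝ) * ∑ j, t j a a * t j c c

omit [Fintype ι] [DecidableEq ι] in
lemma card_inv_mul_sum_const [Nonempty J] (r : ℝ) :
    1 / (Fintype.card J : ℝ) * ∑ _j : J, r = r := by
  rw [Finset.sum_const, Finset.card_univ, nsmul_eq_mul]
  have : (Fintype.card J : ℝ) ≠ 0 := by exact_mod_cast Fintype.card_ne_zero
  field_simp

omit [DecidableEq ι] in
lemma hopping_isSymmStochastic [Nonempty J] {t : J → Matrix ι ι ℝ}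
    (ht : ∀ j a b, t j a b = t j b a) (hrow : ∀ j a, ∑ b, t j a b ^ 2 = 1) :
    IsSymmStochastic (hopping t) where
  symm a b := by simp only [hopping, of_apply, ht _ a b]
  nonneg a b := by simp only [hopping, of_apply]; positivity
  sum_row a := by
    simp only [hopping, of_apply, ← Finset.mul_sum]
    rw [Finset.sum_comm]
    simp only [hrow]
    exact card_inv_mul_sum_const 1

omit [Fintype ι] [DecidableEq ι] in
lemma hopping_pos {t : J → Matrix ι ι ℝ} {a b : ι} (h : ∃ j, t j a b ≠ 0) :
    0 < hopping t a b := by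
  obtain ⟨j, hj⟩ := h
  have : Nonempty J := ⟨j⟩
  have hc : (0 : ℝ) < Fintype.card J := by exact_mod_cast Fintype.card_pos
  refine mul_pos (by positivity) (lt_of_lt_of_le (by positivity : 0 < t j a b ^ 2) ?_)
  exact Finset.single_le_sum (f := fun j => t j a b ^ 2) (fun j _ => sq_nonneg _)
    (Finset.mem_univ j)

lemma pairChain_hopping_mulVec [Nonempty J] {t : J → Matrix ι ι ℝ}
    (ht : ∀ j a b, t j a b = t j b a) (ε : ℝ) (g : Sym2 ι → ℝ) (x : Sym2 ι) :
    (pairChain (hopping t) ε *ᵥ g) x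
      = 1 / (Fintype.card J : ℝ) * ∑ j, (pairChain (sqEntries (t j)) ε *ᵥ g) x := by
  induction x using Sym2.ind with
  | _ a b =>
  have hs : ∀ j a b, sqEntries (t j) a b = sqEntries (t j) b a :=
    fun j a b => by simp [sqEntries, ht j a b]
  have hs' : ∀ a b, hopping t a b = hopping t b a :=
    fun a b => by simp only [hopping, of_apply, ht _ a b]
  have hh : ∀ a b, hopping t a b = 1 / (Fintype.card J : ℝ) * ∑ j, sqEntries (t j) a b :=
    fun a b => rfl
  have e1 : ∀ b (f : ι → ℝ), ∑ c, hopping t b c * f c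
      = 1 / (Fintype.card J : ℝ) * ∑ j, ∑ c, sqEntries (t j) b c * f c := by
    intro b f
    rw [Finset.sum_comm, Finset.mul_sum]
    exact Finset.sum_congr rfl fun c _ => by rw [hh, mul_assoc, Finset.sum_mul]
  rw [pairChain_mulVec hs', e1, e1, hh]
  simp only [pairChain_mulVec (hs _), ← Finset.mul_sum, Finset.sum_add_distrib, ← Finset.sum_mul]
  have := card_inv_mul_sum_const (J := J) (g s(a, b))
  linear_combination (-3 / 4 : ℝ) * this

/-- The average over `j` of the operators `K j` between two projections to matched indices. -/
def matchedAverage (K : J → Matrix (Idx4 ι) (Idx4 ι) ℂ) : Matrix (Idx4 ι) (Idx4 ι) ℂ :=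
  (1 / (Fintype.card J : ℂ)) • ∑ j, matchedProj ι * K j * matchedProj ι

lemma matchedAverage_mulVec (K : J → Matrix (Idx4 ι) (Idx4 ι) ℂ) (u : Idx4 ι → ℂ) (x : Idx4 ι) :
    (matchedAverage K *ᵥ u) x = if IsMatched x then
      1 / (Fintype.card J : ℂ) * ∑ j, (K j *ᵥ (matchedProj ι *ᵥ u)) x else 0 := by
  simp only [matchedAverage, smul_mulVec, sum_mulVec, ← mulVec_mulVec, Pi.smul_apply,
    Finset.sum_apply, smul_eq_mul, matchedProj_mulVec _ x]
  split_ifs <;> simp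

lemma MatchedSupport.matchedProj_mulVec {u : Idx4 ι → ℂ} (hu : MatchedSupport u) :
    matchedProj ι *ᵥ u = u := by
  ext x
  rw [_root_.matchedProj_mulVec]
  split_ifs with h
  · rfl
  · exact (hu x h).symm

lemma matchedProj_mulVec_support (u : Idx4 ι → ℂ) : MatchedSupport (matchedProj ι *ᵥ u) :=
  fun x hx => by rw [matchedProj_mulVec, if_neg hx]

variable {t : J → Matrix ι ι ℝ}

lemma modified_mulVec_plusVec [Nonempty J] (ht : ∀ j a b, t j a b = t j b a) (g : Sym2 ι → ℝ) :
    matchedAverage (fun j => modifiedSwap ((t j).map Complex.ofReal)) *ᵥ plusVec g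
      = plusVec (pairChain (hopping t) 1 *ᵥ g) := by
  ext x
  rw [matchedAverage_mulVec, (plusVec_matchedSupport g).matchedProj_mulVec]
  by_cases hx : IsMatched x
  · rw [if_pos hx]
    simp only [modifiedSwap_mulVec_plusVec (ht _) g x hx]
    simp only [plusVec, if_pos hx, pairChain_hopping_mulVec ht]
    push_cast
    rw [← Finset.mul_sum]
    ring
  · rw [if_neg hx, plusVec_matchedSupport _ x hx]

lemma cayley_mulVec_symVec [Nonempty J] (ht : ∀ j a b, t j a b = t j b a) (g : Sym2 ι → ℝ) :
    matchedAverage (fun j => cayleySwap ((t j).map Complex.ofReal)) *ᵥ symVec g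
      = symVec (pairChain (hopping t) 0 *ᵥ g) := by
  ext x
  rw [matchedAverage_mulVec, (symVec_matchedSupport g).matchedProj_mulVec]
  by_cases hx : IsMatched x
  · rw [if_pos hx]
    simp only [cayleySwap_mulVec_symVec (ht _) g x hx]
    simp only [symVec]
    split_ifs
    · simp only [pairChain_hopping_mulVec ht]
      push_cast
      rfl
    · simp
  · rw [if_neg hx, symVec_matchedSupport _ x hx]

lemma modified_mulVec_plusState [Nonempty J] (ht : ∀ j a b, t j a b = t j b a)
    (hrow : ∀ j a, ∑ b, t j a b ^ 2 = 1) (x : Sym2 ι) :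
    matchedAverage (fun j => modifiedSwap ((t j).map Complex.ofReal)) *ᵥ plusState x
      = ∑ y, (pairChain (hopping t) 1 x y : ℂ) • plusState y := by
  rw [sum_smul_plusState, plusState_eq, modified_mulVec_plusVec ht]
  congr 1
  ext z
  rw [(hopping_isSymmStochastic ht hrow).pairChain_one_symm]
  simp

/-- `cayley_mulVec_symVec` acts on coefficient functions and so produces a column of the chain. The
vectors `symState` differ from indicators by the reciprocal weight, and detailed balance turns the
column into a row. -/
lemma cayley_mulVec_symState [Nonempty J] (ht : ∀ j a b, t j a b = t j b a)
    (hrow : ∀ j a, ∑ b, t j a b ^ 2 = 1) (x : Sym2 ι) :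
    matchedAverage (fun j => cayleySwap ((t j).map Complex.ofReal)) *ᵥ symState x
      = ∑ y, (pairChain (hopping t) 0 x y : ℂ) • symState y := by
  rw [sum_smul_symState]
  induction x using Sym2.ind with
  | _ a b =>
  rw [symState_mk_eq, cayley_mulVec_symVec ht]
  congr 1
  ext z
  have h1 := (hopping_isSymmStochastic ht hrow).pairChain_zero_symm s(a, b) z
  have h2 := pairNorm_mul_pairWeight a b
  have h3 : pairWeight z ≠ 0 := (one_pos.trans_le (one_le_pairWeight z)).ne'
  rw [mulVec_smul]
  simp only [mulVec_single, Pi.smul_apply, smul_eq_mul, MulOpposite.op_one, one_smul, col_apply]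
  rw [eq_div_iff h3]
  linear_combination pairNorm a b * (-h1) + pairChain (hopping t) 0 s(a, b) z * h2

lemma linearIndependent_plusState : LinearIndependent ℂ (plusState (ι := ι)) := by
  rw [Fintype.linearIndependent_iff]
  intro g hg z
  induction z using Sym2.ind with
  | _ a b =>
  have h := congrFun hg (a, b, a, b)
  simp only [Finset.sum_apply, Pi.smul_apply, smul_eq_mul, plusState_eq, plusVec_diag] at h
  rw [Finset.sum_eq_single s(a, b) (fun z _ hz => by simp [hz.symm]) (by simp)] at h
  have : pairNorm a b ≠ 0 := by rw [pairNorm]; split_ifs <;> norm_num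
  simpa [this] using h

lemma linearIndependent_symState : LinearIndependent ℂ (symState (ι := ι)) := by
  rw [Fintype.linearIndependent_iff]
  intro g hg z
  induction z using Sym2.ind with
  | _ a b =>
  have h := congrFun hg (a, b, a, b)
  simp only [Finset.sum_apply, Pi.smul_apply, smul_eq_mul] at h
  have h0 : ∀ z : Sym2 ι, z ≠ s(a, b) → symState z (a, b, a, b) = 0 := by
    intro z hz
    induction z using Sym2.ind with
    | _ c d => rw [symState_mk_eq, symVec_diag]; simp [hz.symm]
  rw [Finset.sum_eq_single s(a, b) (fun z _ hz => by rw [h0 z hz, mul_zero]) (by simp)] at h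
  have : pairNorm a b ≠ 0 := by rw [pairNorm]; split_ifs <;> norm_num
  rw [symState_mk_eq, symVec_diag] at h
  simpa [this] using h

end Average

/-! ### Restriction to the span of linearly independent vectors -/

section Restrict

variable {κ : Type*} [Fintype κ] {E : Type*} [AddCommGroup E] [Module ℂ E]

lemma map_mem_span_range (A : Module.End ℂ E) (v : κ → E) (P : Matrix κ κ ℝ)
    (h : ∀ x, A (v x) = ∑ y, (P x y : ℂ) • v y) :
    ∀ w ∈ Submodule.span ℂ (Set.range v), A w ∈ Submodule.span ℂ (Set.range v) := by
  intro w hw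
  have : Submodule.span ℂ (Set.range v) ≤ (Submodule.span ℂ (Set.range v)).comap A := by
    rw [Submodule.span_le]
    rintro _ ⟨x, rfl⟩
    rw [SetLike.mem_coe, Submodule.mem_comap, h]
    exact Submodule.sum_mem _ fun y _ =>
      Submodule.smul_mem _ _ (Submodule.subset_span ⟨y, rfl⟩)
  exact this hw

lemma charpoly_restrict_span [DecidableEq κ] [FiniteDimensional ℂ E] (A : Module.End ℂ E)
    (v : κ → E) (hv : LinearIndependent ℂ v) (P : Matrix κ κ ℝ)
    (h : ∀ x, A (v x) = ∑ y, (P x y : ℂ) • v y)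
    (hA : ∀ w ∈ Submodule.span ℂ (Set.range v), A w ∈ Submodule.span ℂ (Set.range v)) :
    (A.restrict hA).charpoly = P.charpoly.map (algebraMap ℝ ℂ) := by
  let b := Module.Basis.span hv
  have hb : ∀ x, ((b x : Submodule.span ℂ (Set.range v)) : E) = v x := fun x => by
    rw [Module.Basis.span_apply]
  -- The rows of `P` hold the images, so `P` is the transpose of the matrix of the restriction; the
  -- characteristic polynomial does not see this.
  have hmat : LinearMap.toMatrix b b (A.restrict hA) = (P.map (algebraMap ℝ ℂ))ᵀ := by
    ext y x
    rw [LinearMap.toMatrix_apply]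
    have : (A.restrict hA) (b x) = ∑ y, (P x y : ℂ) • b y := by
      apply Subtype.ext
      rw [LinearMap.coe_restrict_apply, hb, h]
      simp [hb]
    rw [this, b.repr_sum_self]
    rfl
  rw [← LinearMap.charpoly_toMatrix _ b, hmat, charpoly_transpose, charpoly_map]

end Restrict

/-! ### The Cayley operator on the whole space -/

section Whole

variable {ι : Type*} [Fintype ι] [DecidableEq ι]

/-- The index is of the form `(a, c, a, c)`. -/
def IsDiagIdx (x : Idx4 ι) : Prop := x.1 = x.2.2.1 ∧ x.2.1 = x.2.2.2

instance : DecidablePred (IsDiagIdx (ι := ι)) := fun _ => inferInstanceAs (Decidable (_ ∧ _))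

lemma sum_filter_isDiagIdx (h : Idx4 ι → ℝ) :
    ∑ x with IsDiagIdx x, h x = ∑ a, ∑ c, h (a, c, a, c) := by
  rw [Finset.sum_filter]
  simp only [Fintype.sum_prod_type]
  refine Finset.sum_congr rfl fun a _ => Finset.sum_congr rfl fun c _ => ?_
  rw [Finset.sum_eq_single a, Finset.sum_eq_single c]
  · exact if_pos ⟨rfl, rfl⟩
  · exact fun d _ hd => if_neg fun h => hd h.2.symm
  · simp
  · exact fun b _ hb => Finset.sum_eq_zero fun d _ => if_neg fun h => hb h.1.symm
  · simp

lemma sum_idx4_eq (h : Idx4 ι → ℝ) :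
    ∑ x, h x = ∑ a, ∑ c, h (a, c, a, c) + ∑ x with ¬ IsDiagIdx x, h x := by
  rw [← sum_filter_isDiagIdx, Finset.sum_filter_add_sum_filter_not]

/-- The eigenvalue of the Cayley operator at an index that is not of the form `(a, c, a, c)`. -/
def crossEigenvalue (s : ι → ι → ℝ) (x : Idx4 ι) : ℝ :=
  if IsMatched x then 1 / 8 * (6 + 2 * s x.1 x.2.1) else 0

/-- The Cayley operator in coordinates. -/
def cayleyAction (p : Matrix ι ι ℝ) (s : ι → ι → ℝ) (f : Idx4 ι → ℝ) : Idx4 ι → ℝ := fun x =>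
  if IsDiagIdx x then 1 / 8 * (6 * f x + ∑ y, p x.1 y * f (y, x.2.1, y, x.2.1)
    + ∑ y, p x.2.1 y * f (x.1, y, x.1, y)) else crossEigenvalue s x * f x

variable {J : Type*} [Fintype J] {t : J → Matrix ι ι ℝ}

lemma cayley_mulVec_ofReal [Nonempty J] (f : Idx4 ι → ℝ) (x : Idx4 ι) :
    (matchedAverage (fun j => cayleySwap ((t j).map Complex.ofReal)) *ᵥ
      (fun y => (f y : ℂ))) x = (cayleyAction (hopping t) (diagOverlap t) f x : ℂ) := by
  have hu := matchedProj_mulVec_support fun y => (f y : ℂ)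
  have hm : ∀ y, IsMatched y → (matchedProj ι *ᵥ fun y => (f y : ℂ)) y = f y := fun y hy => by
    rw [matchedProj_mulVec, if_pos hy]
  have hd : ∀ a c : ι, IsMatched (a, c, a, c) := fun a c => Or.inl ⟨rfl, rfl⟩
  have hj : (Fintype.card J : ℂ) ≠ 0 := by exact_mod_cast Fintype.card_ne_zero
  rw [matchedAverage_mulVec]
  by_cases hx : IsDiagIdx x
  · obtain ⟨a, c, b, d⟩ := x
    obtain ⟨rfl, rfl⟩ : a = b ∧ c = d := hx
    rw [if_pos (hd a c), cayleyAction, if_pos ⟨rfl, rfl⟩]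
    simp only [cayleySwap_mulVec, tensor4_13_diag hu, tensor4_24_diag hu, hm _ (hd _ _)]
    have e : ∀ (a : ι) (h : ι → ℝ), ((∑ y, hopping t a y * h y : ℝ) : ℂ)
        = 1 / (Fintype.card J : ℂ) * ∑ j, ∑ y, (t j).map Complex.ofReal a y ^ 2 * (h y : ℂ) := by
      intro a h
      rw [Finset.sum_comm, Finset.mul_sum]
      push_cast
      refine Finset.sum_congr rfl fun y _ => ?_
      simp only [hopping, of_apply, map_apply, ← Finset.sum_mul]
      push_cast
      ring
    rw [Complex.ofReal_mul, Complex.ofReal_add, Complex.ofReal_add, e, e, ← Finset.mul_sum]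
    simp only [Finset.sum_add_distrib, Finset.sum_const, Finset.card_univ, nsmul_eq_mul]
    push_cast
    field_simp
  · rw [cayleyAction, if_neg hx, crossEigenvalue]
    split_ifs with hmx
    · obtain ⟨a, c, b, d⟩ := x
      rcases hmx with h | ⟨h1, h2⟩
      · exact absurd h hx
      · simp only at h1 h2
        subst h1 h2
        have hac : a ≠ c := fun h => hx ⟨h, h.symm⟩
        have hmx : IsMatched (a, c, c, a) := Or.inr ⟨rfl, rfl⟩
        simp only [cayleySwap_mulVec, tensor4_13_cross hu _ hac, tensor4_24_cross hu _ hac,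
          hm _ hmx, map_apply, diagOverlap]
        simp only [← Finset.mul_sum, Finset.sum_add_distrib, Finset.sum_const, Finset.card_univ,
          nsmul_eq_mul, ← Finset.sum_mul]
        push_cast
        field_simp
        ring
    · simp

/-- The real matrix of the Cayley operator. -/
def cayleyReal (p : Matrix ι ι ℝ) (s : ι → ι → ℝ) : Matrix (Idx4 ι) (Idx4 ι) ℝ :=
  Matrix.of fun x y => cayleyAction p s (Pi.single y 1) x

lemma cayley_eq_map [Nonempty J] :
    matchedAverage (fun j => cayleySwap ((t j).map Complex.ofReal))
      = (cayleyReal (hopping t) (diagOverlap t)).map Complex.ofReal := by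
  ext x y
  rw [map_apply, cayleyReal, of_apply, ← cayley_mulVec_ofReal]
  have : (fun z => (((Pi.single y 1 : Idx4 ι → ℝ) z : ℝ) : ℂ)) = Pi.single y 1 := by
    ext z; simp only [Pi.single_apply]; split_ifs <;> simp
  rw [this]
  simp

lemma cayleyReal_mulVec [Nonempty J] (f : Idx4 ι → ℝ) :
    cayleyReal (hopping t) (diagOverlap t) *ᵥ f = cayleyAction (hopping t) (diagOverlap t) f := by
  ext x
  have h := cayley_mulVec_ofReal (t := t) f x
  rw [cayley_eq_map] at h
  rw [← Complex.ofReal_inj, ← h]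
  simp [mulVec, dotProduct]

omit [Fintype ι] [DecidableEq ι] in
lemma tensor4_transpose (A B C D : Matrix ι ι ℂ) :
    (tensor4 A B C D)ᵀ = tensor4 Aᵀ Bᵀ Cᵀ Dᵀ := by
  simp only [tensor4, kroneckerMap_transpose]

/-- All factors `τ` and the projection are symmetric, so the whole operator is, and on the full
space no weight is needed. -/
lemma cayleyReal_symm [Nonempty J] (ht : ∀ j a b, t j a b = t j b a) (x y : Idx4 ι) :
    cayleyReal (hopping t) (diagOverlap t) x y = cayleyReal (hopping t) (diagOverlap t) y x := by
  have hT : ∀ j, ((t j).map Complex.ofReal)ᵀ = (t j).map Complex.ofReal := fun j => by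
    ext a b; simp [ht j a b]
  have h : (matchedAverage (fun j => cayleySwap ((t j).map Complex.ofReal)))ᵀ
      = matchedAverage (fun j => cayleySwap ((t j).map Complex.ofReal)) := by
    simp only [matchedAverage, transpose_smul, transpose_sum, transpose_mul, cayleySwap,
      transpose_add, tensor4_transpose, hT, transpose_one, matchedProj, diagonal_transpose,
      Matrix.mul_assoc]
  rw [cayley_eq_map] at h
  have := congrFun (congrFun h y) x
  simpa using this

/-- The Dirichlet form of the Cayley operator. -/
lemma dirichlet_cayleyAction {p : Matrix ι ι ℝ} (hp : IsSymmStochastic p) (s : ι → ι → ℝ)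
    (f : Idx4 ι → ℝ) : ∑ x, f x * (f x - cayleyAction p s f x)
      = 1 / 16 * (∑ a, ∑ b, ∑ c, p b c * (f (a, b, a, b) - f (a, c, a, c)) ^ 2
        + ∑ b, ∑ a, ∑ c, p a c * (f (a, b, a, b) - f (c, b, c, b)) ^ 2)
        + ∑ x with ¬ IsDiagIdx x, (1 - crossEigenvalue s x) * (f x * f x) := by
  rw [sum_idx4_eq]
  congr 1
  · have e1 : ∀ a, ∑ b, ∑ c, p b c * (f (a, b, a, b) - f (a, c, a, c)) ^ 2
        = 2 * ∑ b, f (a, b, a, b) * (f (a, b, a, b) - ∑ c, p b c * f (a, c, a, c)) :=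
      fun a => hp.sum_sq_sub fun b => f (a, b, a, b)
    have e2 : ∀ b, ∑ a, ∑ c, p a c * (f (a, b, a, b) - f (c, b, c, b)) ^ 2
        = 2 * ∑ a, f (a, b, a, b) * (f (a, b, a, b) - ∑ c, p a c * f (c, b, c, b)) :=
      fun b => hp.sum_sq_sub fun a => f (a, b, a, b)
    simp only [e1, e2, ← Finset.mul_sum]
    rw [Finset.sum_comm (f := fun b a => f (a, b, a, b) * _), ← mul_add, ← Finset.sum_add_distrib,
      Finset.mul_sum, Finset.mul_sum]
    refine Finset.sum_congr rfl fun a _ => ?_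
    rw [← Finset.sum_add_distrib, Finset.mul_sum, Finset.mul_sum]
    refine Finset.sum_congr rfl fun b _ => ?_
    rw [cayleyAction, if_pos (show IsDiagIdx (a, b, a, b) from ⟨rfl, rfl⟩)]
    ring
  · refine Finset.sum_congr rfl fun x hx => ?_
    rw [cayleyAction, if_neg (Finset.mem_filter.1 hx).2]
    ring

omit [Fintype ι] [DecidableEq ι] in
-- AM–GM, swap by swap. It bounds the cross eigenvalues by the holding probabilities of the hopping
-- chain.
lemma diagOverlap_le [Nonempty J] (a c : ι) :
    2 * diagOverlap t a c ≤ hopping t a a + hopping t c c := by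
  simp only [diagOverlap, hopping, of_apply]
  rw [← mul_add, ← Finset.sum_add_distrib, mul_left_comm, Finset.mul_sum]
  refine mul_le_mul_of_nonneg_left (Finset.sum_le_sum fun j _ => ?_) (by positivity)
  nlinarith [sq_nonneg (t j a a - t j c c)]

/-- The gap of the Cayley operator is comparable to the gap of the exchange chain. -/
lemma spectralGap_cayley_bounds [Nonempty J] (ht : ∀ j a b, t j a b = t j b a)
    (hrow : ∀ j a, ∑ b, t j a b ^ 2 = 1)
    {V : Type*} [AddCommGroup V] [Module ℂ V] [FiniteDimensional ℂ V] {L : Module.End ℂ V}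
    (hL : L.charpoly = (pairChain (hopping t) 1).charpoly.map (algebraMap ℝ ℂ))
    (hι : 2 ≤ Fintype.card ι) :
    1 / 4 * spectralGap L
        ≤ spectralGap (matchedAverage (fun j => cayleySwap ((t j).map Complex.ofReal))).toLin' ∧
      spectralGap (matchedAverage (fun j => cayleySwap ((t j).map Complex.ofReal))).toLin'
        ≤ 2 * spectralGap L := by
  set A := matchedAverage (fun j => cayleySwap ((t j).map Complex.ofReal)) with hA
  have hp := hopping_isSymmStochastic ht hrow
  have hcA : A.toLin'.charpoly
      = (cayleyReal (hopping t) (diagOverlap t)).charpoly.map (algebraMap ℝ ℂ) := by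
    rw [charpoly_toLin', hA, cayley_eq_map, ← charpoly_map]
    rfl
  have hcard : 1 < Fintype.card (Idx4 ι) := by
    simp only [Fintype.card_prod]
    calc 1 < 2 * (2 * (2 * 2)) := by norm_num
      _ ≤ _ := by gcongr
  have h0 := hp.spectralGap_nonneg hL hι
  have hsymm : ∀ x y : Idx4 ι, (1 : ℝ) * cayleyReal (hopping t) (diagOverlap t) x y
      = 1 * cayleyReal (hopping t) (diagOverlap t) y x := fun x y => by rw [cayleyReal_symm ht]
  have hov : ∀ a c, diagOverlap t a c ≤ 1 := fun a c => by
    have h1 := diagOverlap_le (t := t) a c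
    have h2 := hp.le_one a a
    have h3 := hp.le_one c c
    linarith
  have hcross : ∀ x : Idx4 ι, crossEigenvalue (diagOverlap t) x ≤ 1 := fun x => by
    rw [crossEigenvalue]
    split_ifs
    · have := hov x.1 x.2.1
      linarith
    · norm_num
  -- The constant function on the ordered-pair block is the fixed vector used for both bounds.
  set v : Idx4 ι → ℝ := fun x => if IsDiagIdx x then 1 else 0 with hv
  have hvd : ∀ a c : ι, v (a, c, a, c) = 1 := fun a c => if_pos ⟨rfl, rfl⟩
  have hfv : ∀ f : Idx4 ι → ℝ, ∑ x, 1 * f x * v x = ∑ a, ∑ c, f (a, c, a, c) := by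
    intro f
    rw [← sum_filter_isDiagIdx, Finset.sum_filter]
    exact Finset.sum_congr rfl fun x _ => by
      by_cases hx : IsDiagIdx x <;> simp [hv, hx]
  have hvA : cayleyReal (hopping t) (diagOverlap t) *ᵥ v = v := by
    rw [cayleyReal_mulVec]
    ext x
    rw [cayleyAction]
    split_ifs with hx
    · simp only [hvd, mul_one, hp.sum_row]
      rw [show v x = 1 from if_pos hx]
      norm_num
    · simp only [hv, if_neg hx, mul_zero]
  have hform : ∀ f : Idx4 ι → ℝ,
      ∑ x, 1 * f x * (f x - (cayleyReal (hopping t) (diagOverlap t) *ᵥ f) x)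
      = 1 / 16 * (∑ a, ∑ b, ∑ c, hopping t b c * (f (a, b, a, b) - f (a, c, a, c)) ^ 2
        + ∑ b, ∑ a, ∑ c, hopping t a c * (f (a, b, a, b) - f (c, b, c, b)) ^ 2)
        + ∑ x with ¬ IsDiagIdx x, (1 - crossEigenvalue (diagOverlap t) x) * (f x * f x) := by
    intro f
    simp only [one_mul, cayleyReal_mulVec, dirichlet_cayleyAction hp]
  have hpos : ∀ f : Idx4 ι → ℝ,
      0 ≤ ∑ x, 1 * f x * (f x - (cayleyReal (hopping t) (diagOverlap t) *ᵥ f) x) := by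
    intro f
    rw [hform]
    refine add_nonneg (mul_nonneg (by norm_num) (add_nonneg ?_ ?_)) ?_
    · exact Finset.sum_nonneg fun _ _ => Finset.sum_nonneg fun b _ => Finset.sum_nonneg fun c _ =>
        mul_nonneg (hp.nonneg b c) (sq_nonneg _)
    · exact Finset.sum_nonneg fun _ _ => Finset.sum_nonneg fun b _ => Finset.sum_nonneg fun c _ =>
        mul_nonneg (hp.nonneg b c) (sq_nonneg _)
    · exact Finset.sum_nonneg fun x _ => mul_nonneg (by linarith [hcross x]) (mul_self_nonneg _)
  obtain ⟨a₀, b₀, hab₀⟩ := Fintype.exists_pair_of_one_lt_card hι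
  constructor
  · refine le_spectralGap A.toLin' _ (fun _ => 1) (fun _ => one_pos) hsymm hcA hcard v _ ?_
    intro f hf
    rw [hfv] at hf
    rw [hform, show ∑ x, 1 * f x * f x = ∑ x, f x * f x from by simp only [one_mul],
      sum_idx4_eq (fun x => f x * f x), mul_add]
    refine add_le_add ?_ ?_
    · have h1 := poincare_ordered (p := hopping t) (g := spectralGap L / 3) (by positivity)
        (hp.poincare_pair hL hι) (fun a b => f (a, b, a, b)) hf
      refine le_trans (mul_le_mul_of_nonneg_right (by linarith) ?_) h1
      exact Finset.sum_nonneg fun _ _ => Finset.sum_nonneg fun _ _ => mul_self_nonneg _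
    · rw [Finset.mul_sum]
      refine Finset.sum_le_sum fun x hx => mul_le_mul_of_nonneg_right ?_ (mul_self_nonneg _)
      rw [crossEigenvalue]
      split_ifs with hmx
      · obtain ⟨a, c, b, d⟩ := x
        have hdiag := hp.spectralGap_le_diag hL hι s(a, c)
        have hac : a ≠ c := by
          rintro rfl
          refine (Finset.mem_filter.1 hx).2 ?_
          rcases hmx with h | ⟨h1, h2⟩
          · exact h
          · exact ⟨h2, h1⟩
        have hentry : pairChain (hopping t) 1 s(a, c) s(a, c)
            = 1 / 8 * (6 + hopping t c c + hopping t a a - 2 * hopping t a c) := by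
          have h1 := pairChain_mulVec hp.symm 1 (Pi.single s(a, c) 1) a c
          simp only [mulVec_single_one, col_apply] at h1
          rw [h1]
          have h2 : (Pi.single s(a, c) 1 : Sym2 ι → ℝ) s(a, a) = 0 := by
            simp [hac]
          have h3 : (Pi.single s(a, c) 1 : Sym2 ι → ℝ) s(c, c) = 0 := by
            simp [hac.symm]
          have h4 : ∑ x, hopping t c x * (Pi.single s(a, c) 1 : Sym2 ι → ℝ) s(a, x)
              = hopping t c c := by
            rw [Finset.sum_eq_single c (fun x _ hx => by simp [hac, hx]) (by simp)]
            simp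
          have h5 : ∑ x, hopping t a x * (Pi.single s(a, c) 1 : Sym2 ι → ℝ) s(c, x)
              = hopping t a a := by
            rw [show s(a, c) = s(c, a) from Sym2.eq_swap,
              Finset.sum_eq_single a (fun x _ hx => by simp [hac.symm, hx]) (by simp)]
            simp
          rw [h2, h3, h4, h5, Pi.single_eq_same]
          ring
        rw [hentry] at hdiag
        -- With `s` the overlap, the goal is `Δ/4 ≤ (1 - s)/4`. The diagonal entry gives `Δ ≤ 3/16
        -- (2 - p a a - p c c + 2 p a c)`; the row sums bound this by `3/8 (2 - p a a - p c c)`,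
        -- hence by `3/4 (1 - s)`.
        have h1 := diagOverlap_le (t := t) a c
        have h2 : hopping t a a + hopping t a c ≤ 1 := by
          rw [← hp.sum_row a, ← Finset.sum_pair hac]
          exact Finset.sum_le_sum_of_subset_of_nonneg (Finset.subset_univ _)
            fun b _ _ => hp.nonneg a b
        have h3 : hopping t c c + hopping t a c ≤ 1 := by
          rw [hp.symm a c, ← hp.sum_row c, ← Finset.sum_pair hac.symm]
          exact Finset.sum_le_sum_of_subset_of_nonneg (Finset.subset_univ _)
            fun b _ _ => hp.nonneg c b
        have h4 := hov a c
        simp only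
        linarith
      -- At an unmatched index the eigenvalue is 0, and `Δ ≤ 3/2` is enough.
      · have hdiag := hp.spectralGap_le_diag hL hι s(a₀, b₀)
        have := hp.pairChain_one_nonneg s(a₀, b₀) s(a₀, b₀)
        linarith
  · have hv0 : v ≠ 0 := fun h => by
      have := congrFun h (a₀, b₀, a₀, b₀)
      rw [hvd] at this
      exact one_ne_zero this
    have h1 : 0 ≤ spectralGap A.toLin' :=
      le_spectralGap A.toLin' _ (fun _ => 1) (fun _ => one_pos) hsymm hcA hcard v _ fun f _ => by
        rw [zero_mul]; exact hpos f
    have h2 := hp.le_spectralGap_of_poincare hL hι h1 fun f hf => by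
      -- A symmetric function is extended by zero from the ordered block. Its row and column
      -- energies coincide, so the inequality on the whole space restricts to unordered pairs.
      set F : Idx4 ι → ℝ := fun x => if IsDiagIdx x then f s(x.1, x.2.1) else 0 with hF
      have hFd : ∀ a c : ι, F (a, c, a, c) = f s(a, c) := fun a c => if_pos ⟨rfl, rfl⟩
      have hF0 : ∀ x, ¬ IsDiagIdx x → F x = 0 := fun x hx => if_neg hx
      have h3 := spectralGap_mul_le A.toLin' _ (fun _ => 1) (fun _ => one_pos) hsymm hcA hcard v hv0
        hvA hpos F (by rw [hfv]; simpa only [hFd] using hf)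
      rw [hform, show ∑ x, 1 * F x * F x = ∑ x, F x * F x from by simp only [one_mul],
        sum_idx4_eq (fun x => F x * F x)] at h3
      have h4 : ∑ x with ¬ IsDiagIdx x, F x * F x = 0 :=
        Finset.sum_eq_zero fun x hx => by rw [hF0 x (Finset.mem_filter.1 hx).2, zero_mul]
      have h5 : ∑ x with ¬ IsDiagIdx x, (1 - crossEigenvalue (diagOverlap t) x) * (F x * F x) = 0 :=
        Finset.sum_eq_zero fun x hx => by
          rw [hF0 x (Finset.mem_filter.1 hx).2, zero_mul, mul_zero]
      rw [h4, h5] at h3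
      simp only [hFd, add_zero] at h3
      have h6 : ∑ b, ∑ a, ∑ c, hopping t a c * (f s(a, b) - f s(c, b)) ^ 2
          = pairEnergy (hopping t) f := by
        rw [pairEnergy]
        refine Finset.sum_congr rfl fun b _ => Finset.sum_congr rfl fun a _ =>
          Finset.sum_congr rfl fun c _ => ?_
        rw [show s(a, b) = s(b, a) from Sym2.eq_swap, show s(c, b) = s(b, c) from Sym2.eq_swap]
      rw [h6, ← pairEnergy] at h3
      linarith
    linarith

end Whole

/-! ### The comparison theorem for a projected family of swaps -/

section Comparison

variable {ι : Type*} [Fintype ι] [DecidableEq ι] {J : Type*} [Fintype J]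

/-- The comparison of the modified and the Cayley moment operators when the second moment of the
diagonal evolution is the projection onto the matched indices. -/
theorem moment_comparison {n : ℕ} (X : Fin n → Matrix ι ι ℂ) (hX : secondMoment X = matchedProj ι)
    [Nonempty J] {τ : J → Matrix ι ι ℂ} (t : J → Matrix ι ι ℝ)
    (hτ : τ = fun j => (t j).map Complex.ofReal) (ht : ∀ j a b, t j a b = t j b a)
    (hrow : ∀ j a, ∑ b, t j a b ^ 2 = 1)
    (hconn : ∀ a b, Relation.ReflTransGen (fun a b => ∃ j, t j a b ≠ 0) a b) :
    LinearIndependent ℂ (plusState (ι := ι)) ∧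
    (∃ P : Matrix (Sym2 ι) (Sym2 ι) ℝ,
      (∀ x, (modifiedMoment X τ).mulVec (plusState x) = ∑ y, (P x y : ℂ) • plusState y) ∧
      P.IsIrreducible ∧ P.IsSymm ∧ P ∈ doublyStochastic ℝ (Sym2 ι)) ∧
    ∃ (hM : ∀ v ∈ plusSpace ι, (modifiedMoment X τ).toLin' v ∈ plusSpace ι)
      (hC : ∀ v ∈ symSpace ι, (cayleyMoment X τ).toLin' v ∈ symSpace ι),
      2 ≤ Fintype.card ι →
        (1 / 4 * spectralGap ((modifiedMoment X τ).toLin'.restrict hM)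
            ≤ spectralGap ((cayleyMoment X τ).toLin'.restrict hC) ∧
          spectralGap ((cayleyMoment X τ).toLin'.restrict hC)
            ≤ 2 * spectralGap ((modifiedMoment X τ).toLin'.restrict hM)) ∧
        (1 / 4 * spectralGap ((modifiedMoment X τ).toLin'.restrict hM)
            ≤ spectralGap (cayleyMoment X τ).toLin' ∧
          spectralGap (cayleyMoment X τ).toLin'
            ≤ 2 * spectralGap ((modifiedMoment X τ).toLin'.restrict hM)) := by
  have hMA : modifiedMoment X τ
      = matchedAverage (fun j => modifiedSwap ((t j).map Complex.ofReal)) := by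
    rw [modifiedMoment, hX, hτ, matchedAverage]
  have hCA : cayleyMoment X τ
      = matchedAverage (fun j => cayleySwap ((t j).map Complex.ofReal)) := by
    rw [cayleyMoment, hX, hτ, matchedAverage]
  rw [hMA, hCA]
  have hp := hopping_isSymmStochastic ht hrow
  have hM := modified_mulVec_plusState ht hrow
  have hC := cayley_mulVec_symState ht hrow
  refine ⟨linearIndependent_plusState, ⟨pairChain (hopping t) 1, hM,
    hp.pairChain_one_isIrreducible fun a b => 
      Relation.ReflTransGen.mono (fun _ _ h => hopping_pos (t := t) h) _ _ (hconn a b),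
    ?_, hp.pairChain_one_mem_doublyStochastic⟩,
    map_mem_span_range (toLin' _) plusState _ hM, map_mem_span_range (toLin' _) symState _ hC,
    fun hι => ?_⟩
  · ext x y
    exact hp.pairChain_one_symm y x
  · have hcM := charpoly_restrict_span (toLin' _) plusState linearIndependent_plusState _ hM
      (map_mem_span_range _ _ _ hM)
    have hcC := charpoly_restrict_span (toLin' _) symState linearIndependent_symState _ hC
      (map_mem_span_range _ _ _ hC)
    exact ⟨hp.spectralGap_pair_bounds hcM hcC hι, spectralGap_cayley_bounds ht hrow hcM hι⟩

end Comparison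

/-! ### The second moment of a diagonal evolution -/

section SecondMoment

variable {ι : Type*} [Fintype ι] [DecidableEq ι] {n : ℕ}

/-- The weights of a basis vector, preceded by `1`. -/
def augmentedWeight (w : Fin n → ι → ℤ) : Fin (n + 1) → ι → ℤ := Fin.cons 1 w

/-- The exponent of the phase that a product of order at most two gives to an index. -/
def phaseWeight (w : Fin n → ι → ℤ) (p : PairIdx n) (x : Idx4 ι) : ℤ :=
  augmentedWeight w p.1.1 x.1 * augmentedWeight w p.1.2 x.1
    + augmentedWeight w p.1.1 x.2.1 * augmentedWeight w p.1.2 x.2.1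
    - augmentedWeight w p.1.1 x.2.2.1 * augmentedWeight w p.1.2 x.2.2.1
    - augmentedWeight w p.1.1 x.2.2.2 * augmentedWeight w p.1.2 x.2.2.2

omit [Fintype ι] [DecidableEq ι] in
lemma isMatched_iff_phaseWeight {w : Fin n → ι → ℤ}
    (hw : ∀ a b, (∀ i, w i a = w i b) → a = b) (x : Idx4 ι) :
    IsMatched x ↔ ∀ p, phaseWeight w p x = 0 := by
  obtain ⟨a, c, b, d⟩ := x
  constructor
  · rintro (⟨h1, h2⟩ | ⟨h1, h2⟩) p <;> simp only at h1 h2 <;> subst h1 h2 <;>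
      simp only [phaseWeight] <;> ring
  · intro h
    set W := augmentedWeight w with hWdef
    have hW0 : ∀ a, W 0 a = 1 := fun a => rfl
    have hWinj : ∀ a b, (∀ i, W i a = W i b) → a = b := fun a b hab =>
      hw a b fun i => hab i.succ
    have hq : ∀ r s, W r a * W s a + W r c * W s c = W r b * W s b + W r d * W s d := by
      intro r s
      rcases le_total r s with hrs | hrs
      · have := h ⟨(r, s), hrs⟩
        simp only [phaseWeight, ← hWdef] at this
        linarith
      · have := h ⟨(s, r), hrs⟩
        simp only [phaseWeight, ← hWdef] at this
        linarith
    have hl : ∀ s, W s a + W s c = W s b + W s d := by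
      intro s
      have := hq 0 s
      simpa only [hW0, one_mul] using this
    -- The sum and the sum of squares determine a pair of numbers up to order, one coordinate at a
    -- time.
    have hor : ∀ s, W s a = W s b ∨ W s a = W s d := by
      intro s
      have h1 := hq s s
      have h2 := hl s
      have h3 : W s c = W s b + W s d - W s a := by linarith
      rw [h3] at h1
      have h4 : (W s a - W s b) * (W s a - W s d) = 0 := by linarith
      rcases mul_eq_zero.1 h4 with h5 | h5
      · left; linarith
      · right; linarith
    by_cases hab : a = b
    · subst hab
      exact Or.inl ⟨rfl, hWinj _ _ fun i => by have := hl i; simp only; linarith⟩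
    by_cases had : a = d
    · subst had
      exact Or.inr ⟨rfl, hWinj _ _ fun i => by have := hl i; simp only; linarith⟩
    -- The mixed products rule out different matchings in different coordinates: if `r` separates
    -- `a` from `b` and `s` separates `a` from `d`, the equation for `(r, s)` makes a product of
    -- nonzero differences vanish.
    exfalso
    obtain ⟨r, hr⟩ : ∃ r, W r a ≠ W r b := by
      by_contra! hcon; exact hab (hWinj _ _ hcon)
    obtain ⟨s, hs⟩ : ∃ s, W s a ≠ W s d := by
      by_contra! hcon; exact had (hWinj _ _ hcon)
    have hr' := (hor r).resolve_left hr
    have hs' := (hor s).resolve_right hs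
    have hrc : W r c = W r b := by have := hl r; linarith
    have hsc : W s c = W s d := by have := hl s; linarith
    have h1 := hq r s
    rw [hrc, hsc] at h1
    have h2 : (W r a - W r b) * (W s a - W s d) = 0 := by
      rw [hr', hs'] at h1 ⊢
      linarith
    rcases mul_eq_zero.1 h2 with h3 | h3
    · exact hr (by linarith)
    · exact hs (by linarith)

lemma integral_exp_int (m : ℤ) :
    ∫ β in Set.Icc (0 : ℝ) (2 * Real.pi), Complex.exp (-Complex.I * (β * m))
      = if m = 0 then ((2 * Real.pi : ℝ) : ℂ) else 0 := by
  rw [MeasureTheory.integral_Icc_eq_integral_Ioc,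
    ← intervalIntegral.integral_of_le (by positivity)]
  split_ifs with h
  · subst h
    simp
  · have hm : -Complex.I * (m : ℂ) ≠ 0 :=
      mul_ne_zero (neg_ne_zero.2 Complex.I_ne_zero) (by exact_mod_cast h)
    have e : ∀ β : ℝ, -Complex.I * ((β : ℂ) * m) = -Complex.I * m * β := fun β => by ring
    simp only [e]
    rw [integral_exp_mul_complex hm]
    have h1 : Complex.exp (-Complex.I * m * ((2 * Real.pi : ℝ) : ℂ)) = 1 := by
      rw [Complex.exp_eq_one_iff]
      exact ⟨-m, by push_cast; ring⟩
    rw [h1]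
    simp

omit [Fintype ι] in
lemma withOne_diagonal (w : Fin n → ι → ℤ) (r : Fin (n + 1)) :
    withOne (fun i => diagonal fun a => (w i a : ℂ)) r
      = diagonal fun a => (augmentedWeight w r a : ℂ) := by
  refine Fin.cases ?_ (fun i => ?_) r
  · simp [withOne, augmentedWeight]
  · simp [withOne, augmentedWeight]

lemma evolution_diagonal (w : Fin n → ι → ℤ) (β : PairIdx n → ℝ) :
    evolution (fun i => diagonal fun a => (w i a : ℂ)) β
      = diagonal fun a => Complex.exp (-Complex.I * ∑ p : PairIdx n, (β p : ℂ)
        * (augmentedWeight w p.1.1 a * augmentedWeight w p.1.2 a : ℤ)) := by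
  have h : (-Complex.I) • ∑ p : PairIdx n, (β p : ℂ)
      • (withOne (fun i => diagonal fun a => (w i a : ℂ)) p.1.1
        * withOne (fun i => diagonal fun a => (w i a : ℂ)) p.1.2)
      = diagonal fun a => -Complex.I * ∑ p : PairIdx n, (β p : ℂ)
        * (augmentedWeight w p.1.1 a * augmentedWeight w p.1.2 a : ℤ) := by
    ext a b
    simp only [withOne_diagonal, diagonal_mul_diagonal, Matrix.smul_apply, Matrix.sum_apply, diagonal_apply,
      smul_eq_mul]
    split_ifs <;> simp
  rw [evolution, h, exp_diagonal]
  congr 1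
  ext a
  rw [Pi.coe_exp, Complex.exp_eq_exp_ℂ]

/-- The second moment of a diagonal evolution whose integer weights separate the basis is the
projection onto the matched indices. -/
theorem secondMoment_diagonal {w : Fin n → ι → ℤ}
    (hw : ∀ a b, (∀ i, w i a = w i b) → a = b) :
    secondMoment (fun i => diagonal fun a => (w i a : ℂ)) = matchedProj ι := by
  ext x y
  rw [secondMoment, of_apply, matchedProj]
  simp only [evolution_diagonal]
  by_cases hxy : x = y
  · subst hxy
    rw [diagonal_apply_eq]
    -- Two phases and two conjugate phases combine into one integer frequency per parameter, so the
    -- integral over the box factors.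
    have e : ∀ β : PairIdx n → ℝ, tensor4
        (diagonal fun a => Complex.exp (-Complex.I * ∑ p : PairIdx n, (β p : ℂ)
          * (augmentedWeight w p.1.1 a * augmentedWeight w p.1.2 a : ℤ)))
        (diagonal fun a => Complex.exp (-Complex.I * ∑ p : PairIdx n, (β p : ℂ)
          * (augmentedWeight w p.1.1 a * augmentedWeight w p.1.2 a : ℤ)))
        ((diagonal fun a => Complex.exp (-Complex.I * ∑ p : PairIdx n, (β p : ℂ)
          * (augmentedWeight w p.1.1 a * augmentedWeight w p.1.2 a : ℤ))).map star)
        ((diagonal fun a => Complex.exp (-Complex.I * ∑ p : PairIdx n, (β p : ℂ)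
          * (augmentedWeight w p.1.1 a * augmentedWeight w p.1.2 a : ℤ))).map star) x x
        = ∏ p : PairIdx n, Complex.exp (-Complex.I * ((β p : ℂ) * (phaseWeight w p x : ℤ))) := by
      intro β
      simp only [tensor4, kroneckerMap_apply, map_apply, diagonal_apply_eq, Complex.star_def,
        ← Complex.exp_conj, ← Complex.exp_add, ← Complex.exp_sum, map_mul, map_neg, map_sum,
        Complex.conj_I, Complex.conj_ofReal, map_intCast]
      congr 1
      simp only [Finset.mul_sum, ← Finset.sum_add_distrib, phaseWeight]
      refine Finset.sum_congr rfl fun p _ => ?_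
      push_cast
      ring
    simp only [e]
    rw [MeasureTheory.setAverage_eq, MeasureTheory.volume_pi, MeasureTheory.Measure.restrict_pi_pi,
      MeasureTheory.integral_fintype_prod_eq_prod
        (fun p (b : ℝ) => Complex.exp (-Complex.I * ((b : ℂ) * (phaseWeight w p x : ℤ))))]
    simp only [integral_exp_int]
    have hvol : (MeasureTheory.Measure.pi fun _ : PairIdx n => (MeasureTheory.volume :
        MeasureTheory.Measure ℝ)).real (Set.univ.pi fun _ => Set.Icc 0 (2 * Real.pi))
        = ∏ _p : PairIdx n, (2 * Real.pi) := by
      rw [MeasureTheory.measureReal_def, MeasureTheory.Measure.pi_pi, ENNReal.toReal_prod]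
      refine Finset.prod_congr rfl fun p _ => ?_
      rw [Real.volume_Icc, sub_zero, ENNReal.toReal_ofReal (by positivity)]
    rw [hvol]
    by_cases hx : IsMatched x
    · rw [if_pos hx]
      have h0 := (isMatched_iff_phaseWeight hw x).1 hx
      simp only [h0, if_true]
      rw [← Complex.ofReal_prod, Complex.real_smul, ← Complex.ofReal_mul, inv_mul_cancel₀,
        Complex.ofReal_one]
      exact Finset.prod_ne_zero_iff.2 fun _ _ => by positivity
    · rw [if_neg hx]
      rw [isMatched_iff_phaseWeight hw] at hx
      push Not at hx
      obtain ⟨p, hp⟩ := hx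
      have h0 : ∏ p : PairIdx n, (if phaseWeight w p x = 0 then ((2 * Real.pi : ℝ) : ℂ) else 0)
          = 0 := Finset.prod_eq_zero (Finset.mem_univ p) (if_neg hp)
      rw [h0, smul_zero]
  · rw [diagonal_apply_ne _ hxy]
    have e : ∀ f g h k : ι → ℂ, tensor4 (diagonal f) (diagonal g) ((diagonal h).map star)
        ((diagonal k).map star) x y = 0 := by
      intro f g h k
      rw [diagonal_map (star_zero _), diagonal_map (star_zero _)]
      simp only [tensor4, diagonal_kronecker_diagonal]
      exact diagonal_apply_ne _ hxy
    simp only [e, MeasureTheory.setAverage_eq, MeasureTheory.integral_zero, smul_zero]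

end SecondMoment

/-! ### Standard Young tableaux -/

namespace YoungTableau

variable {n : ℕ} {μ : YoungDiagram}

lemma exists_label (T : YoungTableau n μ) (i : Fin n) {x y : ℕ} (hx : x ≤ (T.1 i).1.1)
    (hy : y ≤ (T.1 i).1.2) : ∃ k, (T.1 k).1 = (x, y) := by
  have hm : (x, y) ∈ μ.cells := μ.up_left_mem hx hy (T.1 i).2
  exact ⟨T.1.symm ⟨(x, y), hm⟩, by rw [Equiv.apply_symm_apply]⟩

lemma eq_of_box_eq (T : YoungTableau n μ) {i j : Fin n} (h : (T.1 i).1 = (T.1 j).1) : i = j :=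
  T.1.injective (Subtype.ext h)

/-- Labels increase weakly to the south-east. -/
lemma lt_of_box_le (T : YoungTableau n μ) {i j : Fin n} (hx : (T.1 i).1.1 ≤ (T.1 j).1.1)
    (hy : (T.1 i).1.2 ≤ (T.1 j).1.2) (hij : i ≠ j) : i < j := by
  -- Compare through the corner box in the row of `i` and the column of `j`.
  obtain ⟨k, hk⟩ := T.exists_label j hx le_rfl
  have hk1 : (T.1 k).1.1 = (T.1 i).1.1 := by rw [hk]
  have hk2 : (T.1 k).1.2 = (T.1 j).1.2 := by rw [hk]
  have h1 : i ≤ k := by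
    rcases eq_or_lt_of_le hy with h | h
    · exact (T.eq_of_box_eq (Prod.ext hk1.symm (h.trans hk2.symm))).le
    · exact (T.2 i k (Or.inl ⟨hk1.symm, by omega⟩)).le
  have h2 : k ≤ j := by
    rcases eq_or_lt_of_le hx with h | h
    · exact (T.eq_of_box_eq (Prod.ext (hk1.trans h) hk2)).le
    · exact (T.2 k j (Or.inr ⟨hk2, by omega⟩)).le
  exact lt_of_le_of_ne (h1.trans h2) hij

/-- A standard tableau is determined by the contents of its boxes. -/
lemma content_injective {T T' : YoungTableau n μ} (h : ∀ i, T.content i = T'.content i) :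
    T = T' := by
  have key : ∀ (m : ℕ) (i : Fin n), i.val = m → (T.1 i).1 = (T'.1 i).1 := by
    intro m
    induction m using Nat.strong_induction_on with
    | _ m ih =>
    -- Equal contents put the two boxes of a label on one diagonal. If the box in `A` were strictly
    -- to the north-west, `B` would fill that box with a smaller label, whose place in `A` is the
    -- same by induction.
    have aux : ∀ (A B : YoungTableau n μ) (i : Fin n), i.val = m →
        (∀ k : Fin n, k.val < m → (A.1 k).1 = (B.1 k).1) → A.content i = B.content i →
        ¬ (A.1 i).1.1 < (B.1 i).1.1 := by
      intro A B i him hAB hc hlt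
      simp only [content] at hc
      obtain ⟨k, hk⟩ := B.exists_label i (x := (A.1 i).1.1) (y := (A.1 i).1.2) (by omega)
        (by omega)
      have hki : k ≠ i := by
        rintro rfl
        rw [hk] at hlt
        exact lt_irrefl _ hlt
      have hk' : k < i := B.lt_of_box_le (by rw [hk]; omega) (by rw [hk]; simp only; omega) hki
      have := hAB k (by rw [← him]; exact hk')
      exact hki (A.eq_of_box_eq (this.trans hk))
    intro i hi
    have ih' : ∀ k : Fin n, k.val < m → (T.1 k).1 = (T'.1 k).1 := fun k hk => ih k.val hk k rfl
    have h1 := aux T T' i hi ih' (h i)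
    have h2 := aux T' T i hi (fun k hk => (ih' k hk).symm) (h i).symm
    have h3 := h i
    simp only [content] at h3
    exact Prod.ext (by omega) (by omega)
  apply Subtype.ext
  ext i : 1
  exact Subtype.ext (key i.val i rfl)

/-- The labels `j` and `j + 1` are either adjacent in a row or a column, or their boxes are not
comparable. -/
lemma axial_cases (T : YoungTableau n μ) (j : ℕ) (h : j + 1 < n) :
    ((((T.1 ⟨j, Nat.lt_of_succ_lt h⟩).1.1 = (T.1 ⟨j + 1, h⟩).1.1 ∧
        (T.1 ⟨j, Nat.lt_of_succ_lt h⟩).1.2 < (T.1 ⟨j + 1, h⟩).1.2) ∨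
      ((T.1 ⟨j, Nat.lt_of_succ_lt h⟩).1.2 = (T.1 ⟨j + 1, h⟩).1.2 ∧
        (T.1 ⟨j, Nat.lt_of_succ_lt h⟩).1.1 < (T.1 ⟨j + 1, h⟩).1.1)) ∧
      (T.axial j h = 1 ∨ T.axial j h = -1)) ∨
    (¬ (((T.1 ⟨j, Nat.lt_of_succ_lt h⟩).1.1 = (T.1 ⟨j + 1, h⟩).1.1 ∧
        (T.1 ⟨j, Nat.lt_of_succ_lt h⟩).1.2 < (T.1 ⟨j + 1, h⟩).1.2) ∨
      ((T.1 ⟨j, Nat.lt_of_succ_lt h⟩).1.2 = (T.1 ⟨j + 1, h⟩).1.2 ∧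
        (T.1 ⟨j, Nat.lt_of_succ_lt h⟩).1.1 < (T.1 ⟨j + 1, h⟩).1.1)) ∧
      2 ≤ |T.axial j h|) := by
  set a : Fin n := ⟨j, Nat.lt_of_succ_lt h⟩ with ha
  set b : Fin n := ⟨j + 1, h⟩ with hb
  have hab : a ≠ b := by simp [ha, hb]
  have hax : T.axial j h = ((T.1 b).1.2 : ℤ) - (T.1 b).1.1 - ((T.1 a).1.2 - (T.1 a).1.1) := rfl
  rw [hax]
  have hnot : ¬ ((T.1 b).1.1 ≤ (T.1 a).1.1 ∧ (T.1 b).1.2 ≤ (T.1 a).1.2) := fun hle => by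
    have := T.lt_of_box_le hle.1 hle.2 hab.symm
    simp [ha, hb, Fin.lt_def] at this
  -- No label lies strictly between `j` and `j + 1`, so the rectangle spanned by comparable boxes
  -- contains only these two; they are neighbours.
  have hbetween : ∀ x y : ℕ, (T.1 a).1.1 ≤ x → (T.1 a).1.2 ≤ y → x ≤ (T.1 b).1.1 →
      y ≤ (T.1 b).1.2 → (x = (T.1 a).1.1 ∧ y = (T.1 a).1.2) ∨
        (x = (T.1 b).1.1 ∧ y = (T.1 b).1.2) := by
    intro x y hx hy hx' hy'
    obtain ⟨k, hk⟩ := T.exists_label b hx' hy'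
    by_cases hka : a = k
    · left; rw [hka, hk]; exact ⟨rfl, rfl⟩
    by_cases hkb : k = b
    · right; rw [← hkb, hk]; exact ⟨rfl, rfl⟩
    have h1 := T.lt_of_box_le (i := a) (j := k) (by rw [hk]; exact hx) (by rw [hk]; exact hy) hka
    have h2 := T.lt_of_box_le (i := k) (j := b) (by rw [hk]; exact hx') (by rw [hk]; exact hy') hkb
    rw [Fin.lt_def] at h1 h2
    simp only [ha, hb] at h1 h2
    omega
  by_cases hcomp : (T.1 a).1.1 ≤ (T.1 b).1.1 ∧ (T.1 a).1.2 ≤ (T.1 b).1.2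
  · left
    have h1 := hbetween (T.1 a).1.1 (T.1 b).1.2 le_rfl hcomp.2 hcomp.1 le_rfl
    by_cases hx : (T.1 a).1.1 = (T.1 b).1.1
    · have h2 := hbetween (T.1 a).1.1 ((T.1 a).1.2 + 1) le_rfl (by omega) hcomp.1 (by omega)
      exact ⟨Or.inl ⟨hx, by omega⟩, by omega⟩
    · have h2 := hbetween ((T.1 a).1.1 + 1) (T.1 a).1.2 (by omega) le_rfl (by omega) hcomp.2
      exact ⟨Or.inr ⟨by omega, by omega⟩, by omega⟩
  -- For incomparable boxes the row and the column differ in opposite directions, each by at least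
  -- one, so the contents differ by at least two.
  · right
    refine ⟨by omega, ?_⟩
    rw [le_abs]
    omega

/-- The tableau with the labels `j` and `j + 1` exchanged. -/
def exchange (T : YoungTableau n μ) (j : ℕ) (h : j + 1 < n)
    (hT : ¬ (((T.1 ⟨j, Nat.lt_of_succ_lt h⟩).1.1 = (T.1 ⟨j + 1, h⟩).1.1 ∧
        (T.1 ⟨j, Nat.lt_of_succ_lt h⟩).1.2 < (T.1 ⟨j + 1, h⟩).1.2) ∨
      ((T.1 ⟨j, Nat.lt_of_succ_lt h⟩).1.2 = (T.1 ⟨j + 1, h⟩).1.2 ∧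
        (T.1 ⟨j, Nat.lt_of_succ_lt h⟩).1.1 < (T.1 ⟨j + 1, h⟩).1.1))) : YoungTableau n μ :=
  ⟨(Equiv.swap ⟨j, Nat.lt_of_succ_lt h⟩ ⟨j + 1, h⟩).trans T.1, by
    intro a b hab
    simp only [Equiv.trans_apply] at hab
    have h1 := T.2 _ _ hab
    set i₀ : Fin n := ⟨j, Nat.lt_of_succ_lt h⟩ with hi₀
    set i₁ : Fin n := ⟨j + 1, h⟩ with hi₁
    -- Exchanging consecutive labels reverses only the order of these two, and their boxes are
    -- unrelated by `hT`.
    by_cases hex : Equiv.swap i₀ i₁ a = i₀ ∧ Equiv.swap i₀ i₁ b = i₁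
    · rw [hex.1, hex.2] at hab
      exact absurd hab hT
    · rw [Fin.lt_def] at h1 ⊢
      simp only [Equiv.swap_apply_def] at h1 hex
      by_cases ha0 : a = i₀ <;> by_cases ha1 : a = i₁ <;> by_cases hb0 : b = i₀ <;>
        by_cases hb1 : b = i₁ <;> simp_all [Fin.ext_iff] <;> omega⟩

lemma axial_of_exchange {T S : YoungTableau n μ} {j : ℕ} {h : j + 1 < n}
    (hS : S.1 = (Equiv.swap ⟨j, Nat.lt_of_succ_lt h⟩ ⟨j + 1, h⟩).trans T.1) :
    S.content ⟨j, Nat.lt_of_succ_lt h⟩ = T.content ⟨j + 1, h⟩ ∧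
      S.content ⟨j + 1, h⟩ = T.content ⟨j, Nat.lt_of_succ_lt h⟩ ∧ S.axial j h = -T.axial j h := by
  have h1 : S.content ⟨j, Nat.lt_of_succ_lt h⟩ = T.content ⟨j + 1, h⟩ := by
    simp only [content, hS, Equiv.trans_apply, Equiv.swap_apply_left]
  have h2 : S.content ⟨j + 1, h⟩ = T.content ⟨j, Nat.lt_of_succ_lt h⟩ := by
    simp only [content, hS, Equiv.trans_apply, Equiv.swap_apply_right]
  exact ⟨h1, h2, by rw [axial, axial, h1, h2]; ring⟩

lemma exchange_symm {T S : YoungTableau n μ} {j : ℕ} {h : j + 1 < n}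
    (hS : S.1 = (Equiv.swap ⟨j, Nat.lt_of_succ_lt h⟩ ⟨j + 1, h⟩).trans T.1) :
    T.1 = (Equiv.swap ⟨j, Nat.lt_of_succ_lt h⟩ ⟨j + 1, h⟩).trans S.1 := by
  rw [hS]
  ext i : 1
  simp

end YoungTableau

/-! ### Young's orthogonal form -/

section OrthogonalForm

variable (n : ℕ) (μ : YoungDiagram)

/-- The real matrix of Young's orthogonal form of an adjacent transposition. -/
def realSwap (j : ℕ) (h : j + 1 < n) : Matrix (YoungTableau n μ) (YoungTableau n μ) ℝ :=
  Matrix.of fun T' T =>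
    if T' = T then 1 / (T.axial j h : ℝ)
    else if T'.1 = (Equiv.swap ⟨j, Nat.lt_of_succ_lt h⟩ ⟨j + 1, h⟩).trans T.1 then
      √(1 - 1 / (T.axial j h : ℝ) ^ 2)
    else 0

lemma adjacentSwap_eq_map (j : ℕ) (h : j + 1 < n) :
    adjacentSwap n μ j = (realSwap n μ j h).map Complex.ofReal := by
  ext T' T
  simp only [adjacentSwap, realSwap, of_apply, map_apply, dif_pos h]
  split_ifs <;> simp

lemma realSwap_symm (j : ℕ) (h : j + 1 < n) (T' T : YoungTableau n μ) :
    realSwap n μ j h T' T = realSwap n μ j h T T' := by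
  simp only [realSwap, of_apply]
  by_cases h1 : T' = T
  · subst h1; rfl
  · rw [if_neg h1, if_neg (Ne.symm h1)]
    by_cases h2 : T'.1 = (Equiv.swap ⟨j, Nat.lt_of_succ_lt h⟩ ⟨j + 1, h⟩).trans T.1
    · rw [if_pos h2, if_pos (YoungTableau.exchange_symm h2),
        (YoungTableau.axial_of_exchange h2).2.2]
      push_cast
      rw [neg_sq]
    · rw [if_neg h2, if_neg fun h3 => h2 (YoungTableau.exchange_symm h3)]

variable {n μ}

lemma realSwap_mulVec_single_of_exchange {T S : YoungTableau n μ} {j : ℕ} {h : j + 1 < n}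
    (hS : S.1 = (Equiv.swap ⟨j, Nat.lt_of_succ_lt h⟩ ⟨j + 1, h⟩).trans T.1) :
    realSwap n μ j h *ᵥ Pi.single T 1 = (1 / (T.axial j h : ℝ)) • Pi.single T 1
      + √(1 - 1 / (T.axial j h : ℝ) ^ 2) • Pi.single S 1 := by
  have hST : S ≠ T := by
    rintro rfl
    have h1 : S.1 ⟨j, Nat.lt_of_succ_lt h⟩ = S.1 ⟨j + 1, h⟩ := by
      conv_lhs => rw [hS]
      simp
    simpa using S.1.injective h1
  ext T'
  simp only [mulVec_single_one, col_apply, realSwap, of_apply, Pi.add_apply, Pi.smul_apply,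
    Pi.single_apply, smul_eq_mul]
  by_cases h1 : T' = T
  · subst h1
    simp [hST.symm]
  · by_cases h2 : T' = S
    · subst h2
      simp [h1, hS]
    · have h3 : ¬ T'.1 = (Equiv.swap ⟨j, Nat.lt_of_succ_lt h⟩ ⟨j + 1, h⟩).trans T.1 :=
        fun h3 => h2 (Subtype.ext (h3.trans hS.symm))
      simp [h1, h2, h3]

/-- The action of an adjacent transposition on the Young basis. -/
lemma realSwap_mulVec_single (T : YoungTableau n μ) (j : ℕ) (h : j + 1 < n) :
    ((T.axial j h : ℝ) ^ 2 = 1 ∧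
      realSwap n μ j h *ᵥ Pi.single T 1 = (1 / (T.axial j h : ℝ)) • Pi.single T 1) ∨
    ∃ S : YoungTableau n μ,
      S.1 = (Equiv.swap ⟨j, Nat.lt_of_succ_lt h⟩ ⟨j + 1, h⟩).trans T.1 ∧
      4 ≤ (T.axial j h : ℝ) ^ 2 := by
  rcases T.axial_cases j h with ⟨-, hax⟩ | ⟨hT, hax⟩
  · left
    have hsq : (T.axial j h : ℝ) ^ 2 = 1 := by
      rcases hax with hax | hax <;> rw [hax] <;> norm_num
    refine ⟨hsq, ?_⟩
    ext T'
    simp only [mulVec_single_one, col_apply, realSwap, of_apply, Pi.smul_apply,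
      Pi.single_apply, smul_eq_mul, hsq]
    split_ifs <;> simp
  · right
    refine ⟨T.exchange j h hT, rfl, ?_⟩
    have h2 : (2 : ℝ) ≤ |(T.axial j h : ℝ)| := by exact_mod_cast hax
    rw [← sq_abs]
    nlinarith

/-- On the span of `T` and its exchange `S` the matrix is the reflection with diagonal `1/r`, `-1/r`
and off-diagonal `√(1 - 1/r²)`. If no exchange exists, it is the sign `1/r = ±1`. -/
lemma realSwap_mul_self (j : ℕ) (h : j + 1 < n) : realSwap n μ j h * realSwap n μ j h = 1 := by
  refine ext_of_mulVec_single fun T => ?_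
  rw [← mulVec_mulVec, one_mulVec]
  rcases realSwap_mulVec_single T j h with ⟨hsq, hT⟩ | ⟨S, hS, hsq⟩
  · rw [hT, mulVec_smul, hT, smul_smul, ← sq, div_pow, hsq]
    simp
  · have hT := realSwap_mulVec_single_of_exchange hS
    have hS' := realSwap_mulVec_single_of_exchange (YoungTableau.exchange_symm hS)
    rw [(YoungTableau.axial_of_exchange hS).2.2] at hS'
    have hnn : 0 ≤ 1 - 1 / (T.axial j h : ℝ) ^ 2 := by
      rw [sub_nonneg, div_le_one (by linarith)]; linarith
    have hq := Real.mul_self_sqrt hnn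
    rw [hT, mulVec_add, mulVec_smul, mulVec_smul, hT, hS']
    push_cast
    rw [neg_sq]
    ext U
    simp only [Pi.add_apply, Pi.smul_apply, smul_eq_mul]
    have hr : (1 / (T.axial j h : ℝ)) * (1 / (T.axial j h : ℝ)) = 1 / (T.axial j h : ℝ) ^ 2 := by
      rw [div_mul_div_comm, one_mul, sq]
    rw [div_neg]
    linear_combination (Pi.single T 1 : YoungTableau n μ → ℝ) U * (hq + hr)

lemma realSwap_sum_sq (j : ℕ) (h : j + 1 < n) (T : YoungTableau n μ) :
    ∑ S, realSwap n μ j h T S ^ 2 = 1 := by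
  have h1 := congrFun (congrFun (realSwap_mul_self (μ := μ) j h) T) T
  rw [mul_apply, one_apply_eq] at h1
  rw [← h1]
  exact Finset.sum_congr rfl fun S _ => by rw [sq, realSwap_symm n μ j h S T]

/-- The real diagonal matrix of the contents of a label. -/
def contentMatrix (n : ℕ) (μ : YoungDiagram) (i : Fin n) :
    Matrix (YoungTableau n μ) (YoungTableau n μ) ℝ :=
  diagonal fun T => (T.content i : ℝ)

/-- The relation `s_j X_j + 1 = X_{j+1} s_j`, checked on the Young basis: the diagonal part is `c_j
/ r + 1 = c_{j+1} / r` with `r = c_{j+1} - c_j`, and the other part holds because the exchange moves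
the content of `j` to `j + 1`. -/
lemma realSwap_mul_content (j : ℕ) (h : j + 1 < n) :
    realSwap n μ j h * contentMatrix n μ ⟨j, Nat.lt_of_succ_lt h⟩ + 1
      = contentMatrix n μ ⟨j + 1, h⟩ * realSwap n μ j h := by
  refine ext_of_mulVec_single fun T => ?_
  have hD : ∀ (i : Fin n) (S : YoungTableau n μ),
      contentMatrix n μ i *ᵥ Pi.single S 1 = (S.content i : ℝ) • Pi.single S 1 := by
    intro i S
    ext U
    simp only [contentMatrix, mulVec_diagonal, Pi.smul_apply, Pi.single_apply, smul_eq_mul]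
    split_ifs with hU
    · rw [hU]
    · simp
  rw [add_mulVec, one_mulVec, ← mulVec_mulVec, ← mulVec_mulVec, hD, mulVec_smul]
  have hax : (T.axial j h : ℝ) = T.content ⟨j + 1, h⟩ - T.content ⟨j, Nat.lt_of_succ_lt h⟩ := by
    rw [YoungTableau.axial]; push_cast; ring
  have hc : (T.axial j h : ℝ) ≠ 0 →
      (T.content ⟨j, Nat.lt_of_succ_lt h⟩ : ℝ) * (1 / (T.axial j h : ℝ)) + 1
      = 1 / (T.axial j h : ℝ) * T.content ⟨j + 1, h⟩ := by
    intro h0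
    field_simp
    rw [hax]; ring
  rcases realSwap_mulVec_single T j h with ⟨hsq, hT⟩ | ⟨S, hS, hsq⟩
  · have h0 : (T.axial j h : ℝ) ≠ 0 := fun h0 => by rw [h0] at hsq; norm_num at hsq
    rw [hT, mulVec_smul, hD, smul_smul, smul_smul, ← hc h0, add_smul, one_smul]
  · have h0 : (T.axial j h : ℝ) ≠ 0 := fun h0 => by rw [h0] at hsq; norm_num at hsq
    rw [realSwap_mulVec_single_of_exchange hS, mulVec_add, mulVec_smul, mulVec_smul, hD, hD,
      (YoungTableau.axial_of_exchange hS).2.1, smul_add, smul_smul, smul_smul, smul_smul, smul_smul,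
      ← hc h0, add_smul, one_smul, mul_comm (√_)]
    abel

lemma content_zero (T : YoungTableau n μ) (h : 0 < n) : T.content ⟨0, h⟩ = 0 := by
  obtain ⟨k, hk⟩ := T.exists_label ⟨0, h⟩ (x := 0) (y := 0) (Nat.zero_le _) (Nat.zero_le _)
  have hk0 : k = ⟨0, h⟩ := by
    by_contra hne
    have := T.lt_of_box_le (i := k) (j := ⟨0, h⟩) (by rw [hk]; exact Nat.zero_le _)
      (by rw [hk]; exact Nat.zero_le _) hne
    simp [Fin.lt_def] at this
  rw [YoungTableau.content, ← hk0, hk]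
  simp

/-- The Young–Jucys–Murphy elements are diagonal in the Young basis, with the contents as
eigenvalues. -/
lemma yjm_eq_diagonal (i : Fin n) :
    yjm n μ i = diagonal fun T : YoungTableau n μ => (T.content i : ℂ) := by
  have key : ∀ (i : ℕ) (h : i < n), ∑ k ∈ Finset.range i, transposition n μ k i
      = (contentMatrix n μ ⟨i, h⟩).map Complex.ofReal := by
    intro i
    induction i with
    | zero =>
      intro h
      ext T T'
      simp [contentMatrix, content_zero]
    | succ i ih =>
      intro h
      rw [Finset.sum_range_succ]
      have h1 : ∀ k ∈ Finset.range i, transposition n μ k (i + 1)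
          = adjacentSwap n μ i * transposition n μ k i * adjacentSwap n μ i := by
        intro k hk
        rw [transposition, if_neg (Finset.mem_range.1 hk).ne]
      have h2 : transposition n μ i (i + 1) = adjacentSwap n μ i := by
        rw [transposition, if_pos rfl]
      rw [Finset.sum_congr rfl h1, h2, ← Finset.sum_mul, ← Finset.mul_sum,
        ih (Nat.lt_of_succ_lt h), adjacentSwap_eq_map n μ i h]
      -- Multiplying the relation by the involution `s_i` on the right gives `X_{i+1} = s_i X_i s_i
      -- + s_i`, the recursion of the Jucys–Murphy elements.
      have h3 : realSwap n μ i h * contentMatrix n μ ⟨i, Nat.lt_of_succ_lt h⟩ * realSwap n μ i h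
          + realSwap n μ i h = contentMatrix n μ ⟨i + 1, h⟩ := by
        have := congrArg (· * realSwap n μ i h) (realSwap_mul_content (μ := μ) i h)
        simp only [add_mul, one_mul, Matrix.mul_assoc, realSwap_mul_self, mul_one] at this
        rw [Matrix.mul_assoc]
        exact this
      rw [← h3]
      have hm : ∀ A B : Matrix (YoungTableau n μ) (YoungTableau n μ) ℝ,
          A.map Complex.ofReal * B.map Complex.ofReal = (A * B).map Complex.ofReal :=
        fun A B => (Matrix.map_mul (f := Complex.ofRealHom)).symm
      rw [hm, hm]
      ext T T'
      simp
  rw [yjm, key i.val i.isLt]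
  ext T T'
  simp only [contentMatrix, map_apply, diagonal_apply]
  split_ifs <;> simp

/-- Any two standard tableaux are connected by admissible exchanges of consecutive labels. -/
lemma youngTableau_connected (a b : YoungTableau n μ) :
    Relation.ReflTransGen
      (fun a b => ∃ j : Fin (n - 1), realSwap n μ j (by omega) a b ≠ 0) a b := by
  set R : YoungTableau n μ → YoungTableau n μ → Prop :=
    fun a b => ∃ j : Fin (n - 1), realSwap n μ j (by omega) a b ≠ 0
  -- Sorting by a potential: `φ` measures how well `c` is ordered relative to `b`, and a tableau
  -- reachable from `a` with maximal `φ` is shown to be `b`.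
  let φ : YoungTableau n μ → ℤ := fun c => ∑ i : Fin n, (i.val : ℤ) * (b.1.symm (c.1 i)).val
  have : Nonempty {c // Relation.ReflTransGen R a c} := ⟨⟨a, Relation.ReflTransGen.refl⟩⟩
  obtain ⟨⟨c, hc⟩, hmax⟩ :=
    Finite.exists_max fun c : {c // Relation.ReflTransGen R a c} => φ c.1
  have hasc : ∀ (j : ℕ) (h : j + 1 < n),
      b.1.symm (c.1 ⟨j, Nat.lt_of_succ_lt h⟩) < b.1.symm (c.1 ⟨j + 1, h⟩) := by
    intro j h
    by_contra hcon
    set i₀ : Fin n := ⟨j, Nat.lt_of_succ_lt h⟩ with hi₀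
    set i₁ : Fin n := ⟨j + 1, h⟩ with hi₁
    have hne : i₀ ≠ i₁ := by simp [hi₀, hi₁]
    have hne' : b.1.symm (c.1 i₁) ≠ b.1.symm (c.1 i₀) := fun e =>
      hne (c.1.injective (b.1.symm.injective e)).symm
    have hdesc : b.1.symm (c.1 i₁) < b.1.symm (c.1 i₀) := lt_of_le_of_ne (not_lt.1 hcon) hne'
    rcases realSwap_mulVec_single c j h with ⟨hsq, -⟩ | ⟨S, hS, hsq⟩
    -- Neighbouring boxes cannot form a descent, because `b` is standard and orders them as `c`
    -- does. So an exchange is available at every descent.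
    · rcases c.axial_cases j h with ⟨hrel, -⟩ | ⟨-, hax⟩
      · have := b.2 (b.1.symm (c.1 i₀)) (b.1.symm (c.1 i₁)) (by
          rw [Equiv.apply_symm_apply, Equiv.apply_symm_apply]; exact hrel)
        exact hcon this
      · have h2 : (2 : ℝ) ≤ |(c.axial j h : ℝ)| := by exact_mod_cast hax
        rw [← sq_abs] at hsq
        nlinarith
    · have hstep : R c S := by
        refine ⟨⟨j, by omega⟩, ?_⟩
        have h1 := congrFun (realSwap_mulVec_single_of_exchange hS) S
        have hcS : S ≠ c := by
          rintro rfl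
          have h1 : S.1 i₀ = S.1 i₁ := by
            conv_lhs => rw [hS]
            simp [hi₀, hi₁]
          exact hne (S.1.injective h1)
        simp only [mulVec_single_one, col_apply, Pi.add_apply, Pi.smul_apply, smul_eq_mul,
          Pi.single_eq_same, Pi.single_eq_of_ne hcS, mul_zero, zero_add, mul_one] at h1
        rw [realSwap_symm, h1]
        refine (Real.sqrt_pos.2 ?_).ne'
        rw [sub_pos, div_lt_one (by linarith)]
        linarith
      have h1 := hmax ⟨S, hc.tail hstep⟩
      have h2 : φ S = ∑ i : Fin n, ((Equiv.swap i₀ i₁ i).val : ℤ) * (b.1.symm (c.1 i)).val := by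
        rw [← Equiv.sum_comp (Equiv.swap i₀ i₁)]
        refine Finset.sum_congr rfl fun i _ => ?_
        rw [Equiv.swap_apply_self, hS]
        rfl
      -- The gain from removing a descent is positive, as in the rearrangement inequality, against
      -- maximality.
      have h3 : φ S - φ c = (b.1.symm (c.1 i₀)).val - (b.1.symm (c.1 i₁)).val := by
        rw [h2, ← Finset.sum_sub_distrib, Fintype.sum_eq_add i₀ i₁ hne]
        · rw [Equiv.swap_apply_left, Equiv.swap_apply_right]
          simp only [hi₀, hi₁]
          push_cast
          ring
        · rintro i ⟨h0, h1⟩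
          rw [Equiv.swap_apply_of_ne_of_ne h0 h1, sub_self]
      rw [Fin.lt_def] at hdesc
      simp only at h1
      omega
  have hmono : StrictMono fun i : Fin n => b.1.symm (c.1 i) := by
    cases n with
    | zero => exact fun i => i.elim0
    | succ m => exact Fin.strictMono_iff_lt_succ.2 fun i => hasc i.val (by omega)
  -- A strictly increasing permutation of `Fin n` is the identity.
  have hid : (fun i : Fin n => b.1.symm (c.1 i)) = id := by
    refine (hmono.range_inj strictMono_id).1 ?_
    rw [Set.range_id]
    exact (c.1.trans b.1.symm).surjective.range_eq
  have hcb : c = b := by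
    apply Subtype.ext
    ext i : 1
    have := congrFun hid i
    simp only [id, Equiv.symm_apply_eq] at this
    exact this
  rw [← hcb]
  exact hc

end OrthogonalForm

/-! ### Qubit permutations on a charge sector: connectedness and second moment -/

section ChargeSector

variable {n r : ℕ}

/-- The action of a permutation of the qubits on the strings with `r` zeros. -/
def ChargeBasis.permute (σ : Perm (Fin n)) (x : ChargeBasis n r) : ChargeBasis n r :=
  ⟨x.1 ∘ σ.symm, by
    refine Eq.trans ?_ x.2
    refine Finset.card_bij (fun i _ => σ.symm i) ?_ (fun i _ j _ h => σ.symm.injective h) ?_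
    · intro i hi
      simpa using hi
    · intro i hi
      exact ⟨σ i, by simpa using hi, by simp⟩⟩

lemma ChargeBasis.permute_mul (σ ρ : Perm (Fin n)) (x : ChargeBasis n r) :
    x.permute (σ * ρ) = (x.permute ρ).permute σ := rfl

lemma ChargeBasis.permute_inv_permute (σ : Perm (Fin n)) (x : ChargeBasis n r) :
    (x.permute σ).permute σ⁻¹ = x := by
  rw [← ChargeBasis.permute_mul, inv_mul_cancel]
  rfl

/-- Equally many zeros give a bijection of the zero sets, which extends to all sites. With two
symbols the remaining sites match automatically. -/
lemma ChargeBasis.exists_permute_eq (x y : ChargeBasis n r) :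
    ∃ σ : Perm (Fin n), x.permute σ = y := by
  have hcard : Fintype.card {i // x.1 i = 0} = Fintype.card {i // y.1 i = 0} := by
    rw [Fintype.card_subtype, Fintype.card_subtype, x.2, y.2]
  let e := Fintype.equivOfCardEq hcard
  have hz : ∀ i, y.1 (e.extendSubtype i) = x.1 i := by
    intro i
    by_cases hi : x.1 i = 0
    · rw [hi]
      exact e.extendSubtype_mem i hi
    · have h := e.extendSubtype_not_mem i hi
      omega
  refine ⟨e.extendSubtype, Subtype.ext (funext fun i => ?_)⟩
  have h := hz (e.extendSubtype.symm i)
  rw [Equiv.apply_symm_apply] at h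
  exact h.symm

/-- The real matrix of a permutation of the qubits on a charge sector. -/
def realQubitPerm (n r : ℕ) (σ : Perm (Fin n)) :
    Matrix (ChargeBasis n r) (ChargeBasis n r) ℝ :=
  Matrix.of fun y x => if y = x.permute σ then 1 else 0

lemma qubitPerm_eq_map (σ : Perm (Fin n)) :
    qubitPerm n r σ = (realQubitPerm n r σ).map Complex.ofReal := by
  ext y x
  have h : y.1 = x.1 ∘ σ.symm ↔ y = x.permute σ :=
    (Subtype.ext_iff (a1 := y) (a2 := x.permute σ)).symm
  simp only [qubitPerm, realQubitPerm, of_apply, map_apply, h]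
  split_ifs <;> simp

lemma ChargeBasis.eq_permute_iff (σ : Perm (Fin n)) (x y : ChargeBasis n r) :
    y = x.permute σ ↔ x = y.permute σ⁻¹ := by
  constructor
  · rintro rfl
    exact (x.permute_inv_permute σ).symm
  · rintro rfl
    simpa using (y.permute_inv_permute σ⁻¹).symm

lemma realQubitPerm_symm {σ : Perm (Fin n)} (hσ : σ.IsSwap) (y x : ChargeBasis n r) :
    realQubitPerm n r σ y x = realQubitPerm n r σ x y := by
  obtain ⟨i, j, -, rfl⟩ := hσ
  have h := ChargeBasis.eq_permute_iff (Equiv.swap i j) x y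
  rw [Equiv.swap_inv] at h
  simp only [realQubitPerm, of_apply, h]

lemma realQubitPerm_sum_sq (σ : Perm (Fin n)) (y : ChargeBasis n r) :
    ∑ x, realQubitPerm n r σ y x ^ 2 = 1 := by
  have h (x : ChargeBasis n r) := ChargeBasis.eq_permute_iff σ x y
  simp only [realQubitPerm, of_apply, h, ite_pow, one_pow]
  simp

/-- A generating set of permutations connects all strings with the same number of zeros. -/
lemma chargeBasis_connected {𝒯 : Finset (Perm (Fin n))} (hswap : ∀ σ ∈ 𝒯, σ.IsSwap)
    (hgen : Subgroup.closure (𝒯 : Set (Perm (Fin n))) = ⊤) (a b : ChargeBasis n r) :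
    Relation.ReflTransGen (fun a b => ∃ σ : 𝒯, realQubitPerm n r σ a b ≠ 0) a b := by
  set R : ChargeBasis n r → ChargeBasis n r → Prop :=
    fun a b => ∃ σ : 𝒯, realQubitPerm n r σ a b ≠ 0
  -- Swaps are involutions, so steps can be reversed; this handles inverses in the closure
  -- induction.
  have hsymm : ∀ x y, R x y → R y x := by
    rintro x y ⟨σ, h⟩
    exact ⟨σ, by rwa [realQubitPerm_symm (hswap σ σ.2)]⟩
  have hreach : ∀ σ : Perm (Fin n), ∀ x : ChargeBasis n r,
      Relation.ReflTransGen R x (x.permute σ) := by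
    intro σ
    have hσ : σ ∈ Subgroup.closure (𝒯 : Set (Perm (Fin n))) := hgen ▸ Subgroup.mem_top σ
    induction hσ using Subgroup.closure_induction with
    | mem σ hσ =>
      intro x
      refine Relation.ReflTransGen.single (hsymm _ _ ⟨⟨σ, hσ⟩, ?_⟩)
      simp [realQubitPerm]
    | one => exact fun x => Relation.ReflTransGen.refl
    | mul σ ρ _ _ h₁ h₂ => exact fun x => (h₂ x).trans (h₁ _)
    | inv σ _ h =>
      intro x
      have h₁ := h (x.permute σ⁻¹)
      have h₂ := x.permute_inv_permute σ⁻¹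
      rw [inv_inv] at h₂
      rw [h₂] at h₁
      have : Std.Symm R := ⟨hsymm⟩
      exact Relation.ReflTransGen.stdSymm.symm _ _ h₁
  obtain ⟨σ, rfl⟩ := a.exists_permute_eq b
  exact hreach σ a

lemma secondMoment_pauliZ (n r : ℕ) : secondMoment (pauliZ n r) = matchedProj (ChargeBasis n r) := by
  have h : pauliZ n r = fun i => diagonal fun x : ChargeBasis n r =>
      (((if x.1 i = 0 then 1 else -1 : ℤ)) : ℂ) := by
    funext i
    simp [pauliZ]
  rw [h]
  refine secondMoment_diagonal (w := fun i (x : ChargeBasis n r) => if x.1 i = 0 then 1 else -1) ?_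
  intro a b hab
  refine Subtype.ext (funext fun i => ?_)
  have := hab i
  split_ifs at this <;> omega

end ChargeSector

lemma secondMoment_yjm (n : ℕ) (μ : YoungDiagram) :
    secondMoment (yjm n μ) = matchedProj (YoungTableau n μ) := by
  rw [show yjm n μ = fun i => diagonal fun T : YoungTableau n μ => (T.content i : ℂ) from
    funext yjm_eq_diagonal]
  exact secondMoment_diagonal fun a b hab => YoungTableau.content_injective hab

end

theorem mainTheorem3 (n : ℕ) (hn : 2 ≤ n) :
    -- `U(1)` symmetry: any charge sector, any generating set of transpositions
    (∀ (r : ℕ) (_ : r ≤ n) (𝒯 : Finset (Equiv.Perm (Fin n))) (_ : ∀ σ ∈ 𝒯, σ.IsSwap)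
        (_ : Subgroup.closure (𝒯 : Set (Equiv.Perm (Fin n))) = ⊤),
      LinearIndependent ℂ (plusState (ι := ChargeBasis n r)) ∧
      (∃ P : Matrix (Sym2 (ChargeBasis n r)) (Sym2 (ChargeBasis n r)) ℝ,
        (∀ x, (modifiedU1 n r 𝒯).mulVec (plusState x) = ∑ y, (P x y : ℂ) • plusState y) ∧
        P.IsIrreducible ∧ P.IsSymm ∧ P ∈ doublyStochastic ℝ (Sym2 (ChargeBasis n r))) ∧
      ∃ (hM : ∀ v ∈ plusSpace (ChargeBasis n r), (modifiedU1 n r 𝒯).toLin' v ∈ plusSpace (ChargeBasis n r))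
        (hC : ∀ v ∈ symSpace (ChargeBasis n r), (cayleyU1 n r 𝒯).toLin' v ∈ symSpace (ChargeBasis n r)),
        2 ≤ Fintype.card (ChargeBasis n r) →
          (1 / 4 * spectralGap ((modifiedU1 n r 𝒯).toLin'.restrict hM) ≤ spectralGap ((cayleyU1 n r 𝒯).toLin'.restrict hC) ∧
            spectralGap ((cayleyU1 n r 𝒯).toLin'.restrict hC) ≤ 2 * spectralGap ((modifiedU1 n r 𝒯).toLin'.restrict hM)) ∧
          (1 / 4 * spectralGap ((modifiedU1 n r 𝒯).toLin'.restrict hM) ≤ spectralGap (cayleyU1 n r 𝒯).toLin' ∧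
            spectralGap (cayleyU1 n r 𝒯).toLin' ≤ 2 * spectralGap ((modifiedU1 n r 𝒯).toLin'.restrict hM))) ∧
    -- `SU(d)` symmetry: any irreducible representation, nearest-neighbour transpositions
    (∀ (μ : YoungDiagram) (_ : μ.card = n),
      LinearIndependent ℂ (plusState (ι := YoungTableau n μ)) ∧
      (∃ P : Matrix (Sym2 (YoungTableau n μ)) (Sym2 (YoungTableau n μ)) ℝ,
        (∀ x, (modifiedSU n μ).mulVec (plusState x) = ∑ y, (P x y : ℂ) • plusState y) ∧
        P.IsIrreducible ∧ P.IsSymm ∧ P ∈ doublyStochastic ℝ (Sym2 (YoungTableau n μ))) ∧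
      ∃ (hM : ∀ v ∈ plusSpace (YoungTableau n μ), (modifiedSU n μ).toLin' v ∈ plusSpace (YoungTableau n μ))
        (hC : ∀ v ∈ symSpace (YoungTableau n μ), (cayleySU n μ).toLin' v ∈ symSpace (YoungTableau n μ)),
        2 ≤ Fintype.card (YoungTableau n μ) →
          (1 / 4 * spectralGap ((modifiedSU n μ).toLin'.restrict hM) ≤ spectralGap ((cayleySU n μ).toLin'.restrict hC) ∧
            spectralGap ((cayleySU n μ).toLin'.restrict hC) ≤ 2 * spectralGap ((modifiedSU n μ).toLin'.restrict hM)) ∧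
          (1 / 4 * spectralGap ((modifiedSU n μ).toLin'.restrict hM) ≤ spectralGap (cayleySU n μ).toLin' ∧
            spectralGap (cayleySU n μ).toLin' ≤ 2 * spectralGap ((modifiedSU n μ).toLin'.restrict hM))) := by
  refine ⟨fun r _ 𝒯 hswap hgen => ?_, fun μ _ => ?_⟩
  -- The empty set generates the trivial group, which lacks the swap of the first two sites since `n
  -- ≥ 2`. Nonemptiness gives the average over the swaps total mass 1.
  · have : Nonempty 𝒯 := by
      rw [nonempty_subtype]
      by_contra hempty
      have h0 : (𝒯 : Set (Equiv.Perm (Fin n))) = ∅ :=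
        Set.eq_empty_of_forall_notMem fun σ hσ => hempty ⟨σ, hσ⟩
      rw [h0, Subgroup.closure_empty] at hgen
      have hsw := Subgroup.mem_top (Equiv.swap (⟨0, by omega⟩ : Fin n) ⟨1, by omega⟩)
      rw [← hgen, Subgroup.mem_bot, Equiv.Perm.one_def, Equiv.swap_eq_refl_iff] at hsw
      simp at hsw
    exact moment_comparison (pauliZ n r) (secondMoment_pauliZ n r)
      (fun σ : 𝒯 => realQubitPerm n r σ) (funext fun σ => qubitPerm_eq_map _)
      (fun σ => realQubitPerm_symm (hswap σ σ.2)) (fun σ => realQubitPerm_sum_sq _)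
      (chargeBasis_connected hswap hgen)
  · have : Nonempty (Fin (n - 1)) := ⟨⟨0, by omega⟩⟩
    exact moment_comparison (yjm n μ) (secondMoment_yjm n μ)
      (fun j : Fin (n - 1) => realSwap n μ j (by omega))
      (funext fun j => adjacentSwap_eq_map n μ j (by omega))
      (fun j => realSwap_symm n μ j (by omega)) (fun j => realSwap_sum_sq j (by omega))
      youngTableau_connected
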